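/- Let $(\mathcal C,\mathbb E,\mathfrak s)$ be an extriangulated category: $\mathcal C$ is an additive category, $\mathbb E\colon\mathcal C^{op}\times\mathcal C\to Ab$ is a biadditive functor, and $\mathfrak s$ is a realization of $\mathbb E$. Let $\mathcal N\subseteq\mathcal C$ be a thick subcategory, i.e. a full additive subcategory closed under isomorphisms and direct summands and satisfying 2-out-of-3 for $\mathfrak s$-conflations. Write $[\mathcal N]$ for the ideal of morphisms factoring through an object of $\mathcal N$. Let $\mathcal L$ be the class of $\mathfrak s$-inflations with cone in $\mathcal N$, let $\mathcal R$ be the class of $\mathfrak s$-deflations with cocone in $\mathcal N$, and let $\mathcal S_{\mathcal N}$ be the smallest class of morphisms that is closed under composition and contains $\mathcal L$ and $\mathcal R$. Assume that $\mathcal N$ is percolating: every morphism $X\to N$ and every morphism $N\to Y$ with $N\in\mathcal N$ factors as an $\mathfrak s$-deflation to some object $N'\in\mathcal N$ followed by an $\mathfrak s$-inflation from $N'$. Assume moreover: - (P2) if $f\colon A\to B$ is a split monomorphism whose image in $\mathcal C/[\mathcal N]$ is an isomorphism, then there are $N\in\mathcal N$ and $j\colon N\to B$ such that $[f\ j]\colon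 A\oplus N\to B$ is an isomorphism; - (P3) if $l\circ f=0$ with $l\in\mathcal L$, then $f\in[\mathcal N]$; dually, if $f\circ r=0$ with $r\in\mathcal R$, then $f\in[\mathcal N]$. Then $\mathcal S=\mathcal S_{\mathcal N}$ equals $\mathcal L\circ\mathcal R=\{l\circ r\mid l\in\mathcal L,\ r\in\mathcal R\}$ and satisfies the following. - (M1) $\mathcal S$ satisfies 2-out-of-3 with respect to composition. - (M2) $\mathcal S$ is a multiplicative system: it admits a left and a right calculus of fractions. - (M3) For all $\mathfrak s$-triangles $\langle A\xrightarrow{x}B\xrightarrow{y}C,\delta\rangle$ and $\langle A'\xrightarrow{x'}B'\xrightarrow{y'}C',\delta'\rangle$ and all $a\colon A\to A'$, $c\colon C\to C'$ in $\mathcal S$ with $a_*\delta=c^*\delta'$, there is $b\colon B\to B'$ in $\mathcal S$ with $b\circ x=x'\circ a$ and $c\circ y=y'\circ b$. - (M4) $\{t\circ x\circ s\mid x\text{ an }\mathfrak s\text{-inflation},\ s,t\in\mathcal S\}$ is closed under composition, and so is $\{t\circ y\circ s\mid y\text{ an }\mathfrak s\text{-deflation},\ s,t\in\mathcal S\}$.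 Let $\mathcal N_{\mathcal S}$ be the full subcategory of the objects $X$ such that $X\to 0$ and $0\to X$ lie in $\mathcal S$, let $p\colon\mathcal C\to\mathcal C/[\mathcal N_{\mathcal S}]$ be the ideal quotient, and let $\overline{\mathcal S}$ be the closure of $p(\mathcal S)$ under composition with isomorphisms. Then $\mathcal N_{\mathcal S}=\mathcal N$ and $\mathcal S=p^{-1}(\overline{\mathcal S})$. Consequently, the localization $Q\colon\mathcal C\to\widetilde{\mathcal C}=\mathcal C[\mathcal S^{-1}]$ is extriangulated. That is, $\widetilde{\mathcal C}$ is additive and carries an extriangulated structure $(\widetilde{\mathbb E},\widetilde{\mathfrak s})$ together with a natural transformation $\mu\colon\mathbb E\Rightarrow\widetilde{\mathbb E}\circ(Q^{op}\times Q)$ making $(Q,\mu)$ an exact functor, such that: - every element of $\widetilde{\mathbb E}(C,A)$ has the form $(Q(t)^{-1})^*(Q(s)^{-1})_*\,\mu(\delta)$ with $t\colon Z\to C$ and $s\colon A\to X$ in $\mathcal S$ and $\delta\in\mathbb E(Z,X)$; - $\mu(\delta)=0$ if and only if $s_*\delta=0$ for some $s\in\mathcal S$; - if $\mathfrak s(\delta)=[X\xrightarrow{x}Y\xrightarrow{y}Z]$,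 then $\widetilde{\mathfrak s}\big((Q(t)^{-1})^*(Q(s)^{-1})_*\,\mu(\delta)\big)=[A\xrightarrow{Q(x\circ s)}Y\xrightarrow{Q(t\circ y)}C]$; - $(Q,\mu)$ is universal. Every exact functor $(F,\phi)$ from $(\mathcal C,\mathbb E,\mathfrak s)$ to a weakly extriangulated category such that $F$ sends the morphisms of $\mathcal S$ to isomorphisms factors as $(F,\phi)=(\widetilde F,\widetilde\phi)\circ(Q,\mu)$ for a unique exact functor $(\widetilde F,\widetilde\phi)$. Every natural transformation $\eta$ of exact functors between two such functors $(F,\phi),(G,\psi)$ is of the form $\eta=\widetilde\eta\circ Q$ for a unique natural transformation $\widetilde\eta$ of exact functors from $(\widetilde F,\widetilde\phi)$ to $(\widetilde G,\widetilde\psi)$. -/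

import Mathlib

open CategoryTheory CategoryTheory.Limits ZeroObject Opposite

universe u v w u' v' w' u'' v'' w''

namespace Extri

section Sequences

variable {C : Type u} [Category.{v} C]

/-- A sequence `A ⟶ B ⟶ Z` with prescribed end terms. -/
structure Seq (A Z : C) where
  mid : C
  inc : A ⟶ mid
  proj : mid ⟶ Z

/-- Two sequences with the same end terms are equivalent if there is an isomorphism between
their middle terms that is compatible with all the morphisms. -/
def Seq.Equivalent {A Z : C} (σ τ : Seq A Z) : Prop :=
  ∃ b : σ.mid ≅ τ.mid, σ.inc ≫ b.hom = τ.inc ∧ b.hom ≫ τ.proj = σ.proj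

instance seqSetoid (A Z : C) : Setoid (Seq A Z) where
  r := Seq.Equivalent
  iseqv :=
    { refl := fun σ => ⟨Iso.refl _, by simp, by simp⟩
      symm := by
        rintro σ τ ⟨b, h1, h2⟩
        exact ⟨b.symm, by simp [← h1], by simp [← h2]⟩
      trans := by
        rintro σ τ ρ ⟨b, h1, h2⟩ ⟨c, h3, h4⟩
        refine ⟨b ≪≫ c, ?_, ?_⟩
        · rw [Iso.trans_hom, ← Category.assoc, h1, h3]
        · rw [Iso.trans_hom, Category.assoc, h4, h2] }

end Sequences

/-- A biadditive functor `E : Cᵒᵖ × C ⥤ Ab`, together with a map assigning to each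
`δ ∈ E(Z, A)` an equivalence class of sequences `A ⟶ B ⟶ Z`. -/
structure ExtData (C : Type u) [Category.{v} C] [Preadditive C] where
  E : Cᵒᵖ ⥤ C ⥤ AddCommGrpCat.{w}
  additive_right : ∀ Z : Cᵒᵖ, (E.obj Z).Additive
  additive_left : ∀ A : C, (E.flip.obj A).Additive
  realize : ∀ {Z A : C}, ((E.obj (op Z)).obj A) → Quotient (seqSetoid A Z)

namespace ExtData

variable {C : Type u} [Category.{v} C] [Preadditive C] (T : ExtData.{u, v, w} C)

/-- The group `E(Z, A)` of extensions. -/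
abbrev Ext (Z A : C) : Type w := (T.E.obj (op Z)).obj A

variable {T}

/-- `a_* δ = E(Z, a)(δ)`. -/
def push {Z A A' : C} (a : A ⟶ A') (δ : T.Ext Z A) : T.Ext Z A' :=
  (T.E.obj (op Z)).map a δ

/-- `c^* δ = E(c, A)(δ)`. -/
def pull {Z Z' A : C} (c : Z' ⟶ Z) (δ : T.Ext Z A) : T.Ext Z' A :=
  (T.E.map c.op).app A δ

variable (T)

/-- `⟨A ⟶ B ⟶ Z, δ⟩` is an `s`-triangle. -/
def IsTriangle {A B Z : C} (x : A ⟶ B) (y : B ⟶ Z) (δ : T.Ext Z A) : Prop :=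
  T.realize δ = Quotient.mk (seqSetoid A Z) ⟨B, x, y⟩

/-- `A ⟶ B ⟶ Z` is an `s`-conflation. -/
def IsConflation {A B Z : C} (x : A ⟶ B) (y : B ⟶ Z) : Prop :=
  ∃ δ : T.Ext Z A, T.IsTriangle x y δ

/-- The class of `s`-inflations. -/
def inflations : MorphismProperty C := fun _ B x =>
  ∃ (Z : C) (y : B ⟶ Z), T.IsConflation x y

/-- The class of `s`-deflations. -/
def deflations : MorphismProperty C := fun B _ y =>
  ∃ (A : C) (x : A ⟶ B), T.IsConflation x y

/-- Weakly extriangulated categories. -/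
structure IsWeaklyExtriangulated [HasZeroObject C] [HasBinaryBiproducts C] : Prop where
  /-- exactness of `C(X, A) ⟶ C(X, B) ⟶ C(X, Z)` -/
  exact₁ : ∀ {A B Z : C} (x : A ⟶ B) (y : B ⟶ Z) (δ : T.Ext Z A), T.IsTriangle x y δ →
    ∀ (X : C) (f : X ⟶ B), f ≫ y = 0 ↔ ∃ g : X ⟶ A, g ≫ x = f
  /-- exactness of `C(X, B) ⟶ C(X, Z) ⟶ E(X, A)` -/
  exact₂ : ∀ {A B Z : C} (x : A ⟶ B) (y : B ⟶ Z) (δ : T.Ext Z A), T.IsTriangle x y δ →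
    ∀ (X : C) (f : X ⟶ Z), pull f δ = 0 ↔ ∃ g : X ⟶ B, g ≫ y = f
  /-- exactness of `C(Z, X) ⟶ C(B, X) ⟶ C(A, X)` -/
  exact₁' : ∀ {A B Z : C} (x : A ⟶ B) (y : B ⟶ Z) (δ : T.Ext Z A), T.IsTriangle x y δ →
    ∀ (X : C) (f : B ⟶ X), x ≫ f = 0 ↔ ∃ g : Z ⟶ X, y ≫ g = f
  /-- exactness of `C(B, X) ⟶ C(A, X) ⟶ E(Z, X)` -/
  exact₂' : ∀ {A B Z : C} (x : A ⟶ B) (y : B ⟶ Z) (δ : T.Ext Z A), T.IsTriangle x y δ →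
    ∀ (X : C) (f : A ⟶ X), push f δ = 0 ↔ ∃ g : B ⟶ X, x ≫ g = f
  /-- `0 ∈ E(0, A)` is realized by `A = A ⟶ 0` -/
  zero_right : ∀ A : C, T.IsTriangle (𝟙 A) (0 : A ⟶ 0) (0 : T.Ext 0 A)
  /-- `0 ∈ E(A, 0)` is realized by `0 ⟶ A = A` -/
  zero_left : ∀ A : C, T.IsTriangle (0 : 0 ⟶ A) (𝟙 A) (0 : T.Ext A 0)
  /-- morphisms `(a, b, id)` of triangles with a mapping cone -/
  map_right : ∀ {A B Z A' B' : C} (x : A ⟶ B) (y : B ⟶ Z) (δ : T.Ext Z A) (a : A ⟶ A')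
    (x' : A' ⟶ B') (y' : B' ⟶ Z), T.IsTriangle x y δ → T.IsTriangle x' y' (push a δ) →
    ∃ b : B ⟶ B', x ≫ b = a ≫ x' ∧ b ≫ y' = y ∧
      T.IsTriangle (biprod.lift x a) (biprod.desc b (-x')) (pull y' δ)
  /-- morphisms `(id, b, c)` of triangles with a mapping cocone -/
  map_left : ∀ {A B Z B' Z' : C} (x : A ⟶ B) (y : B ⟶ Z) (δ : T.Ext Z A) (c : Z' ⟶ Z)
    (x' : A ⟶ B') (y' : B' ⟶ Z'), T.IsTriangle x y δ → T.IsTriangle x' y' (pull c δ) →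
    ∃ b : B' ⟶ B, x' ≫ b = x ∧ b ≫ y = y' ≫ c ∧
      T.IsTriangle (biprod.lift (-y') b) (biprod.desc c y) (push x' δ)

/-- Extriangulated categories. -/
structure IsExtriangulated [HasZeroObject C] [HasBinaryBiproducts C] : Prop
    extends T.IsWeaklyExtriangulated where
  inflations_comp : T.inflations.IsStableUnderComposition
  deflations_comp : T.deflations.IsStableUnderComposition

end ExtData

open ExtData

section ExactFunctors

variable {C : Type u} [Category.{v} C] [Preadditive C]
  {D : Type u'} [Category.{v'} D] [Preadditive D]
  {D' : Type u''} [Category.{v''} D'] [Preadditive D']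

/-- For a functor `F`, the datum of a natural transformation `φ : E ⟶ E' ∘ (Fᵒᵖ × F)` such that
`(F, φ)` is an exact functor (this includes that `F` is additive). -/
structure ExactStructure (T : ExtData.{u, v, w} C) (T' : ExtData.{u', v', w'} D)
    (F : C ⥤ D) where
  additive : F.Additive
  φ : ∀ Z A : C, T.Ext Z A →+ T'.Ext (F.obj Z) (F.obj A)
  φ_push : ∀ {Z A A' : C} (a : A ⟶ A') (δ : T.Ext Z A),
    φ Z A' (push a δ) = push (F.map a) (φ Z A δ)
  φ_pull : ∀ {Z Z' A : C} (c : Z' ⟶ Z) (δ : T.Ext Z A),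
    φ Z' A (pull c δ) = pull (F.map c) (φ Z A δ)
  φ_triangle : ∀ {A B Z : C} (x : A ⟶ B) (y : B ⟶ Z) (δ : T.Ext Z A), T.IsTriangle x y δ →
    T'.IsTriangle (F.map x) (F.map y) (φ Z A δ)

/-- Exact functors `(F, φ)`. -/
structure ExactFunctor (T : ExtData.{u, v, w} C) (T' : ExtData.{u', v', w'} D) where
  F : C ⥤ D
  str : ExactStructure T T' F

variable {T : ExtData.{u, v, w} C} {T' : ExtData.{u', v', w'} D}
  {T'' : ExtData.{u'', v'', w''} D'}

/-- The composition of exact functors, `(G, ψ) ∘ (F, φ) = (G ∘ F, (ψ ∘ (Fᵒᵖ × F)) · φ)`. -/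
def ExactFunctor.comp (P : ExactFunctor T T') (R : ExactFunctor T' T'') :
    ExactFunctor T T'' where
  F := P.F ⋙ R.F
  str :=
    { additive := by
        have := P.str.additive
        have := R.str.additive
        infer_instance
      φ := fun Z A => (R.str.φ (P.F.obj Z) (P.F.obj A)).comp (P.str.φ Z A)
      φ_push := fun a δ => by
        simp [P.str.φ_push, R.str.φ_push]
      φ_pull := fun c δ => by
        simp [P.str.φ_pull, R.str.φ_pull]
      φ_triangle := fun x y δ h =>
        R.str.φ_triangle _ _ _ (P.str.φ_triangle x y δ h) }

/-- A natural transformation between the underlying functors of two exact functors is a natural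
transformation of exact functors if `(η_A)_* φ(δ) = (η_Z)^* ψ(δ)` for all `δ ∈ E(Z, A)`. -/
def IsExactNatTrans (P R : ExactFunctor T T') (η : P.F ⟶ R.F) : Prop :=
  ∀ {Z A : C} (δ : T.Ext Z A),
    push (η.app A) (P.str.φ Z A δ) = pull (η.app Z) (R.str.φ Z A δ)

end ExactFunctors

section Classes

variable {C : Type u} [Category.{v} C] [Preadditive C]

/-- The ideal `[N]`: morphisms which factor through an object of `N`. -/
def ideal (N : ObjectProperty C) : MorphismProperty C := fun X Y f =>
  ∃ (M : C) (_ : N M) (i : X ⟶ M) (j : M ⟶ Y), i ≫ j = f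

/-- Congruence modulo the ideal `[N]`. -/
def idealRel (N : ObjectProperty C) : HomRel C := fun _ _ f g => ideal N (f - g)

/-- The ideal quotient functor `p : C ⥤ C/[N]`. -/
abbrev idealQuotient (N : ObjectProperty C) : C ⥤ CategoryTheory.Quotient (idealRel N) :=
  CategoryTheory.Quotient.functor (idealRel N)

/-- For a class `S` of morphisms, `N_S` consists of the objects `X` such that `X ⟶ 0` and
`0 ⟶ X` belong to `S`. -/
def nullObjects [HasZeroObject C] (S : MorphismProperty C) : ObjectProperty C := fun X =>
  S (0 : X ⟶ 0) ∧ S (0 : 0 ⟶ X)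

/-- The class `S̄` in `C/[N_S]`: the closure of `p(S)` under composition with isomorphisms. -/
def bar [HasZeroObject C] (S : MorphismProperty C) :
    MorphismProperty (CategoryTheory.Quotient (idealRel (nullObjects S))) :=
  S.map (idealQuotient (nullObjects S))

variable (T : ExtData.{u, v, w} C)

/-- Thick subcategories (full additive subcategories closed under isomorphisms and direct
summands, with 2-out-of-3 for conflations). -/
structure IsThick [HasZeroObject C] [HasBinaryBiproducts C] (N : ObjectProperty C) : Prop where
  zero : N 0
  biprod : ∀ X Y : C, N X → N Y → N (X ⊞ Y)
  iso : N.IsClosedUnderIsomorphisms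
  summand : ∀ X Y : C, N (X ⊞ Y) → N X
  left : ∀ {A B Z : C} (x : A ⟶ B) (y : B ⟶ Z), T.IsConflation x y → N B → N Z → N A
  mid : ∀ {A B Z : C} (x : A ⟶ B) (y : B ⟶ Z), T.IsConflation x y → N A → N Z → N B
  right : ∀ {A B Z : C} (x : A ⟶ B) (y : B ⟶ Z), T.IsConflation x y → N A → N B → N Z

/-- The class `L` of inflations with cone in `N`. -/
def classL (N : ObjectProperty C) : MorphismProperty C := fun _ B x =>
  ∃ (Z : C) (y : B ⟶ Z), T.IsConflation x y ∧ N Z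

/-- The class `R` of deflations with cocone in `N`. -/
def classR (N : ObjectProperty C) : MorphismProperty C := fun B _ y =>
  ∃ (A : C) (x : A ⟶ B), T.IsConflation x y ∧ N A

/-- `S_N`, the smallest class of morphisms closed under composition which contains `L` and `R`
(identities belong to `L` as soon as `0 ∈ N`). -/
def classS (N : ObjectProperty C) : MorphismProperty C :=
  (classL T N ⊔ classR T N).multiplicativeClosure

/-- `L ∘ R = {l ∘ r | l ∈ L, r ∈ R}`. -/
def classLR (N : ObjectProperty C) : MorphismProperty C := fun X Y f =>
  ∃ (M : C) (r : X ⟶ M) (l : M ⟶ Y), classR T N r ∧ classL T N l ∧ r ≫ l = f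

/-- Percolating subcategories. -/
structure IsPercolating [HasZeroObject C] [HasBinaryBiproducts C] (N : ObjectProperty C) : Prop
    extends IsThick T N where
  /-- (P1) -/
  factor_to : ∀ {X M : C} (f : X ⟶ M), N M →
    ∃ (M' : C) (g : X ⟶ M') (h : M' ⟶ M), N M' ∧ T.deflations g ∧ T.inflations h ∧ g ≫ h = f
  /-- (P1') -/
  factor_from : ∀ {M Y : C} (f : M ⟶ Y), N M →
    ∃ (M' : C) (g : M ⟶ M') (h : M' ⟶ Y), N M' ∧ T.deflations g ∧ T.inflations h ∧ g ≫ h = f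

/-- (P2): if `f : A ⟶ B` is a split monomorphism which becomes an isomorphism in `C/[N]`, then
`[f j] : A ⊞ M ⟶ B` is an isomorphism for some `M` in `N` and `j : M ⟶ B`. -/
def CondP2 [HasBinaryBiproducts C] (N : ObjectProperty C) : Prop :=
  ∀ {A B : C} (f : A ⟶ B), IsSplitMono f → IsIso ((idealQuotient N).map f) →
    ∃ (M : C) (_ : N M) (j : M ⟶ B), IsIso (biprod.desc f j)

/-- (P3): morphisms killed by some `l ∘ -` with `l ∈ L`, or by some `- ∘ r` with `r ∈ R`, belong
to the ideal `[N]`. -/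
structure CondP3 (N : ObjectProperty C) : Prop where
  left : ∀ {X A B : C} (l : A ⟶ B), classL T N l → ∀ f : X ⟶ A, f ≫ l = 0 → ideal N f
  right : ∀ {X B Z : C} (r : B ⟶ Z), classR T N r → ∀ f : Z ⟶ X, r ≫ f = 0 → ideal N f

variable (S : MorphismProperty C)

/-- (M2): `S` is a multiplicative system. -/
structure CondM2 : Prop where
  left : S.HasLeftCalculusOfFractions
  right : S.HasRightCalculusOfFractions

/-- (M3): morphisms of the outer terms of two triangles which lie in `S` and are compatible with
the extensions complete to a morphism of triangles with middle component in `S`. -/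
def CondM3 : Prop :=
  ∀ {A B Z A' B' Z' : C} (x : A ⟶ B) (y : B ⟶ Z) (δ : T.Ext Z A)
    (x' : A' ⟶ B') (y' : B' ⟶ Z') (δ' : T.Ext Z' A') (a : A ⟶ A') (c : Z ⟶ Z'),
    T.IsTriangle x y δ → T.IsTriangle x' y' δ' → push a δ = pull c δ' → S a → S c →
    ∃ b : B ⟶ B', S b ∧ x ≫ b = a ≫ x' ∧ b ≫ y' = y ≫ c

/-- The class of morphisms `t ∘ x ∘ s` with `s, t ∈ S` and `x ∈ W`. -/
def sandwich (W : MorphismProperty C) : MorphismProperty C := fun X Y f =>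
  ∃ (A B : C) (s : X ⟶ A) (x : A ⟶ B) (t : B ⟶ Y), S s ∧ W x ∧ S t ∧ s ≫ x ≫ t = f

/-- (M4): the classes of all `t ∘ x ∘ s` with `s, t ∈ S`, where `x` is an inflation, respectively a
deflation, are closed under composition. -/
structure CondM4 : Prop where
  inf : (sandwich S T.inflations).IsStableUnderComposition
  defl : (sandwich S T.deflations).IsStableUnderComposition

end Classes

section Localization

variable {C : Type u} [Category.{v} C] [Preadditive C] (T : ExtData.{u, v, w} C)
  (S : MorphismProperty C) [Preadditive S.Localization]
  (T' : ExtData.{u, max u v, w'} S.Localization)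

/-- `Ẽ` and `s̃` are given by fractions: each element of `Ẽ(QZ, QA)` has the form
`Q(t)^{-1*} Q(s)^{-1}_* μ(δ)` for some `Z ⟵t- Z₁ -δ-> A₁ ⟵s- A` with `s, t ∈ S`; the kernel of `μ`
consists of the extensions killed by some `s_*` with `s ∈ S`; and if `δ` is realized by
`A₁ -x-> B -y-> Z₁`, then this fraction is realized by `A -Q(x ∘ s)-> B -Q(t ∘ y)-> Z`. -/
structure IsFractionExtension (μ : ExactStructure T T' S.Q) : Prop where
  exists_fraction : ∀ {Z A : C} (ε : T'.Ext (S.Q.obj Z) (S.Q.obj A)),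
    ∃ (Z₁ A₁ : C) (t : Z₁ ⟶ Z) (s : A ⟶ A₁) (δ : T.Ext Z₁ A₁), S t ∧ S s ∧
      push (S.Q.map s) (pull (S.Q.map t) ε) = μ.φ Z₁ A₁ δ
  eq_zero_iff : ∀ {Z A : C} (δ : T.Ext Z A),
    μ.φ Z A δ = 0 ↔ ∃ (A₁ : C) (s : A ⟶ A₁), S s ∧ push s δ = 0
  realize_fraction : ∀ {Z A Z₁ A₁ B : C} (ε : T'.Ext (S.Q.obj Z) (S.Q.obj A))
    (t : Z₁ ⟶ Z) (s : A ⟶ A₁) (δ : T.Ext Z₁ A₁) (x : A₁ ⟶ B) (y : B ⟶ Z₁), S t → S s →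
    push (S.Q.map s) (pull (S.Q.map t) ε) = μ.φ Z₁ A₁ δ → T.IsTriangle x y δ →
    T'.IsTriangle (S.Q.map (s ≫ x)) (S.Q.map (y ≫ t)) ε

/-- Universality of `(Q, μ)` among the exact functors to weakly extriangulated categories which
invert `S`, for exact functors and for natural transformations of exact functors. -/
structure IsUniversal (μ : ExactStructure T T' S.Q) : Prop where
  functor : ∀ (D : Type u'') [Category.{v''} D] [Preadditive D] [HasZeroObject D]
    [HasBinaryBiproducts D] (U : ExtData.{u'', v'', w''} D), U.IsWeaklyExtriangulated →
    ∀ P : ExactFunctor T U, S.IsInvertedBy P.F →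
      ∃! P' : ExactFunctor T' U, P = ExactFunctor.comp ⟨S.Q, μ⟩ P'
  natTrans : ∀ (D : Type u'') [Category.{v''} D] [Preadditive D] [HasZeroObject D]
    [HasBinaryBiproducts D] (U : ExtData.{u'', v'', w''} D), U.IsWeaklyExtriangulated →
    ∀ (P' R' : ExactFunctor T' U) (η : S.Q ⋙ P'.F ⟶ S.Q ⋙ R'.F),
      IsExactNatTrans (ExactFunctor.comp ⟨S.Q, μ⟩ P') (ExactFunctor.comp ⟨S.Q, μ⟩ R') η →
      ∃! η' : P'.F ⟶ R'.F, IsExactNatTrans P' R' η' ∧ η = Functor.whiskerLeft S.Q η'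

end Localization

end Extri

open Extri

/-! The engine is a swap: an inflation `x` followed by `r ∈ R` equals a morphism of `R` followed by
an inflation (`exists_swap_inflation`). Percolation factors the map from the cocone of `r` to the
cone of `x` through an object of `N`; pulling back to that object and dividing by the cocone of `r`
gives the new factorization. Hence `L ∘ R` is closed under composition and equals `S_N`. (P3) turns
equalities after composition with `L` or `R` into equalities modulo `[N]`, and `S` is stable under
adding elements of `[N]` (`classLR_of_ideal_sub`); this yields 2-out-of-3. (P2) enters as the
existence of complements in `N`, the self-dual condition in `IsAdmissible`, so that every statement
about `L` gives its dual about `R` by passing to `Cᵒᵖ`.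

The calculus of fractions holds because a map out of an object of `N` is killed by a morphism of
`R`. (M3) follows by factoring `a` and `c` into `R` and `L` and using that in homotopy bicartesian
squares deflations and inflations pass to the parallel side; (M4) is the swap again.

The groups `Ẽ` are morphism groups: glue two copies of `C`, with `E(Z, A)` as the morphisms from `Z`
in the first copy to `A` in the second, and invert `S` in both copies. That `μ(δ) = 0` is detected
by pushforwards alone needs `IsAdmissible.exists_push_eq_zero`, which trades a killing pullback for
a killing pushforward. The triangles of the localization are the sequences isomorphic to images of
triangles; `IsLocalizedExt.exists_mid` makes this a well-defined realization, the axioms follow by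
clearing denominators, and (M4) gives composition of inflations and deflations. Universality follows
because a value on `Ẽ` is determined by its value on one fraction. -/

namespace Extri

namespace ExtData

variable {C : Type u} [Category.{v} C] [Preadditive C] {T : ExtData.{u, v, w} C}

/-! ### Pushforward and pullback of extensions. -/

section PushPull

variable {Z Z' Z'' A A' A'' : C}

@[simp]
lemma push_add (a : A ⟶ A') (δ ε : T.Ext Z A) : push a (δ + ε) = push a δ + push a ε :=
  map_add _ _ _

@[simp]
lemma push_zero (a : A ⟶ A') : push a (0 : T.Ext Z A) = 0 := map_zero _

@[simp]
lemma push_sub (a : A ⟶ A') (δ ε : T.Ext Z A) : push a (δ - ε) = push a δ - push a ε :=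
  map_sub _ _ _

@[simp]
lemma pull_add (c : Z' ⟶ Z) (δ ε : T.Ext Z A) : pull c (δ + ε) = pull c δ + pull c ε :=
  map_add _ _ _

@[simp]
lemma pull_zero (c : Z' ⟶ Z) : pull c (0 : T.Ext Z A) = 0 := map_zero _

@[simp]
lemma push_id (δ : T.Ext Z A) : push (𝟙 A) δ = δ := by simp [push]

@[simp]
lemma pull_id (δ : T.Ext Z A) : pull (𝟙 Z) δ = δ := by simp [pull]

lemma push_comp (a : A ⟶ A') (a' : A' ⟶ A'') (δ : T.Ext Z A) :
    push (a ≫ a') δ = push a' (push a δ) := by simp [push]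

lemma pull_comp (c : Z'' ⟶ Z') (c' : Z' ⟶ Z) (δ : T.Ext Z A) :
    pull (c ≫ c') δ = pull c (pull c' δ) := by simp [pull]

lemma push_pull (a : A ⟶ A') (c : Z' ⟶ Z) (δ : T.Ext Z A) :
    push a (pull c δ) = pull c (push a δ) :=
  (ConcreteCategory.congr_hom ((T.E.map c.op).naturality a) δ).symm

@[simp]
lemma add_push (a b : A ⟶ A') (δ : T.Ext Z A) : push (a + b) δ = push a δ + push b δ := by
  have := T.additive_right (op Z)
  simp [push, Functor.map_add]

@[simp]
lemma zero_push (δ : T.Ext Z A) : push (0 : A ⟶ A') δ = 0 := by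
  have := T.additive_right (op Z)
  simp [push]

@[simp]
lemma add_pull (a b : Z' ⟶ Z) (δ : T.Ext Z A) : pull (a + b) δ = pull a δ + pull b δ := by
  have := T.additive_left A
  have h : (T.E.flip.obj A).map (a.op + b.op) = _ := Functor.map_add _
  exact ConcreteCategory.congr_hom h δ

@[simp]
lemma zero_pull (δ : T.Ext Z A) : pull (0 : Z' ⟶ Z) δ = 0 := by
  have h := add_pull (0 : Z' ⟶ Z) 0 δ
  rw [add_zero] at h
  simpa using h

@[simp]
lemma neg_pull (a : Z' ⟶ Z) (δ : T.Ext Z A) : pull (-a) δ = -pull a δ := by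
  rw [eq_neg_iff_add_eq_zero, ← add_pull, neg_add_cancel, zero_pull]

@[simp]
lemma sub_pull (a b : Z' ⟶ Z) (δ : T.Ext Z A) : pull (a - b) δ = pull a δ - pull b δ := by
  rw [sub_eq_add_neg, add_pull, neg_pull, sub_eq_add_neg]

lemma push_inv_push (e : A ≅ A') (δ : T.Ext Z A) : push e.inv (push e.hom δ) = δ := by
  rw [← push_comp, e.hom_inv_id, push_id]

lemma push_hom_inv (e : A ≅ A') (δ : T.Ext Z A') : push e.hom (push e.inv δ) = δ := by
  rw [← push_comp, e.inv_hom_id, push_id]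

lemma pull_inv_hom (e : Z' ≅ Z) (δ : T.Ext Z A) : pull e.inv (pull e.hom δ) = δ := by
  rw [← pull_comp, e.inv_hom_id, pull_id]

lemma pull_hom_inv (e : Z' ≅ Z) (δ : T.Ext Z' A) : pull e.hom (pull e.inv δ) = δ := by
  rw [← pull_comp, e.hom_inv_id, pull_id]

lemma push_injective (a : A ⟶ A') [IsIso a] {δ ε : T.Ext Z A} (h : push a δ = push a ε) :
    δ = ε := by
  simpa only [← push_comp, IsIso.hom_inv_id, push_id] using congrArg (push (inv a)) h

lemma pull_injective (c : Z' ⟶ Z) [IsIso c] {δ ε : T.Ext Z A} (h : pull c δ = pull c ε) :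
    δ = ε := by
  simpa only [← pull_comp, IsIso.inv_hom_id, pull_id] using congrArg (pull (inv c)) h

end PushPull

/-! ### Exact sequences and triangles. -/

variable (T) in
/-- The four exactness conditions satisfied by triangles. -/
structure IsExactSeq {A B Z : C} (x : A ⟶ B) (y : B ⟶ Z) (δ : T.Ext Z A) : Prop where
  exact₁ : ∀ (X : C) (f : X ⟶ B), f ≫ y = 0 ↔ ∃ g : X ⟶ A, g ≫ x = f
  exact₂ : ∀ (X : C) (f : X ⟶ Z), pull f δ = 0 ↔ ∃ g : X ⟶ B, g ≫ y = f
  exact₁' : ∀ (X : C) (f : B ⟶ X), x ≫ f = 0 ↔ ∃ g : Z ⟶ X, y ≫ g = f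
  exact₂' : ∀ (X : C) (f : A ⟶ X), push f δ = 0 ↔ ∃ g : B ⟶ X, x ≫ g = f

namespace IsExactSeq

variable {A B Z A' B' Z' : C} {x : A ⟶ B} {y : B ⟶ Z} {δ : T.Ext Z A}
  {x' : A' ⟶ B'} {y' : B' ⟶ Z'} {δ' : T.Ext Z' A'}

lemma comp_eq_zero (h : T.IsExactSeq x y δ) : x ≫ y = 0 :=
  (h.exact₁ _ x).2 ⟨𝟙 _, Category.id_comp _⟩

lemma pull_proj (h : T.IsExactSeq x y δ) : pull y δ = 0 :=
  (h.exact₂ _ y).2 ⟨𝟙 _, Category.id_comp _⟩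

lemma push_inc (h : T.IsExactSeq x y δ) : push x δ = 0 :=
  (h.exact₂' _ x).2 ⟨𝟙 _, Category.comp_id _⟩

/-- A morphism of exact sequences with invertible outer components is invertible. -/
lemma isIso_mid (h : T.IsExactSeq x y δ) (h' : T.IsExactSeq x' y' δ') (a : A ⟶ A') (b : B ⟶ B')
    (c : Z ⟶ Z') [IsIso a] [IsIso c] (hx : x ≫ b = a ≫ x') (hy : b ≫ y' = y ≫ c)
    (hδ : push a δ = pull c δ') : IsIso b := by
  -- `y' ≫ inv c` lifts along `y` because pulling back along `y'` kills `δ'`; the lift misses being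
  -- a section of `b` only by a map through `x'`, which can be corrected. The retraction below is
  -- dual.
  obtain ⟨s, hs⟩ : ∃ s : B' ⟶ B, s ≫ b = 𝟙 B' := by
    obtain ⟨g, hg⟩ := (h.exact₂ _ (y' ≫ inv c)).1 (push_injective a (by
      rw [push_zero, push_pull, hδ, ← pull_comp, Category.assoc, IsIso.inv_hom_id,
        Category.comp_id, h'.pull_proj]))
    obtain ⟨k, hk⟩ := (h'.exact₁ _ (𝟙 B' - g ≫ b)).1 (by
      rw [Preadditive.sub_comp, Category.assoc, hy, reassoc_of% hg]; simp)
    refine ⟨g + k ≫ inv a ≫ x, ?_⟩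
    simp [Preadditive.add_comp, hx, hk]
  obtain ⟨t, ht⟩ : ∃ t : B' ⟶ B, b ≫ t = 𝟙 B := by
    obtain ⟨g, hg⟩ := (h'.exact₂' _ (inv a ≫ x)).1 (pull_injective c (by
      rw [pull_zero, ← push_pull, ← hδ, push_comp, ← push_comp a, IsIso.hom_inv_id, push_id,
        h.push_inc]))
    obtain ⟨k, hk⟩ := (h.exact₁' _ (𝟙 B - b ≫ g)).1 (by
      rw [Preadditive.comp_sub, reassoc_of% hx, hg]; simp)
    refine ⟨g + y' ≫ inv c ≫ k, ?_⟩
    simp [Preadditive.comp_add, reassoc_of% hy, hk]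
  have : s = t := by simpa [ht] using congrArg (· ≫ t) hs
  exact ⟨t, ht, this ▸ hs⟩

end IsExactSeq

lemma IsTriangle.congr {A B Z B' : C} {x : A ⟶ B} {y : B ⟶ Z} {δ : T.Ext Z A}
    (h : T.IsTriangle x y δ) (b : B ≅ B') {x' : A ⟶ B'} {y' : B' ⟶ Z} (hx : x ≫ b.hom = x')
    (hy : b.hom ≫ y' = y) : T.IsTriangle x' y' δ :=
  Eq.trans h (_root_.Quotient.sound ⟨b, hx, hy⟩)

lemma exists_triangle {Z A : C} (δ : T.Ext Z A) :
    ∃ (B : C) (x : A ⟶ B) (y : B ⟶ Z), T.IsTriangle x y δ := by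
  obtain ⟨σ, hσ⟩ := _root_.Quotient.exists_rep (T.realize δ)
  exact ⟨σ.mid, σ.inc, σ.proj, hσ.symm⟩

namespace IsWeaklyExtriangulated

variable [HasZeroObject C] [HasBinaryBiproducts C] (hT : T.IsWeaklyExtriangulated)
  {A B Z A' B' Z' : C} {x : A ⟶ B} {y : B ⟶ Z} {δ : T.Ext Z A}
  {x' : A' ⟶ B'} {y' : B' ⟶ Z'} {δ' : T.Ext Z' A'}

include hT

lemma isExactSeq (h : T.IsTriangle x y δ) : T.IsExactSeq x y δ :=
  ⟨hT.exact₁ x y δ h, hT.exact₂ x y δ h, hT.exact₁' x y δ h, hT.exact₂' x y δ h⟩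

end IsWeaklyExtriangulated
end ExtData
end Extri

/-! ### Duality: the opposite extriangulated category. -/

namespace Extri
namespace ExtData

section Op

variable {C : Type u} [Category.{v} C] [Preadditive C] {T : ExtData.{u, v, w} C}

/-- The opposite of a sequence. -/
def opSeq {Z A : Cᵒᵖ} (σ : Quotient (seqSetoid Z.unop A.unop)) : Quotient (seqSetoid A Z) :=
  _root_.Quotient.map' (fun σ : Seq Z.unop A.unop => (⟨op σ.mid, σ.proj.op, σ.inc.op⟩ : Seq A Z))
    (by
      rintro σ τ ⟨b, h₁, h₂⟩
      refine ⟨b.symm.op, ?_, ?_⟩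
      · simp [← h₂, ← op_comp]
      · simp [← h₁, ← op_comp]) σ

omit [Preadditive C] in
lemma opSeq_injective {Z A : Cᵒᵖ} :
    Function.Injective (opSeq : Quotient (seqSetoid Z.unop A.unop) → _) := by
  intro σ τ
  induction σ using _root_.Quotient.inductionOn
  induction τ using _root_.Quotient.inductionOn
  intro h
  obtain ⟨b, h₁, h₂⟩ := _root_.Quotient.exact h
  refine _root_.Quotient.sound ⟨b.symm.unop, ?_, ?_⟩
  · simpa using (congrArg (·.unop ≫ b.inv.unop) h₂).symm
  · simpa using (congrArg (b.inv.unop ≫ ·.unop) h₁).symm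

variable (T) in
/-- The biadditive functor and realization on the opposite category. -/
def op : ExtData.{u, v, w} Cᵒᵖ where
  E := unopUnop C ⋙ T.E.flip
  additive_right A := by
    have := T.additive_left A.unop.unop
    exact ⟨fun {X Y f g} => this.map_add (f := f) (g := g)⟩
  additive_left Z := by
    have := T.additive_right Z
    exact ⟨fun {X Y f g} => this.map_add (f := f.unop.unop) (g := g.unop.unop)⟩
  realize {A Z} δ := opSeq (T.realize (Z := Z.unop) (A := A.unop) δ)

lemma op_isTriangle {A B Z : C} {x : A ⟶ B} {y : B ⟶ Z} {δ : T.Ext Z A} :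
    T.op.IsTriangle (A := Opposite.op Z) (Z := Opposite.op A) y.op x.op δ ↔ T.IsTriangle x y δ := by
  refine ⟨fun h => opSeq_injective (Z := Opposite.op A) (A := Opposite.op Z) h, fun h => ?_⟩
  exact congrArg (opSeq (Z := Opposite.op A) (A := Opposite.op Z)) h

lemma op_isConflation {A B Z : C} {x : A ⟶ B} {y : B ⟶ Z} :
    T.op.IsConflation y.op x.op ↔ T.IsConflation x y :=
  ⟨fun ⟨δ, h⟩ => ⟨δ, op_isTriangle.1 h⟩, fun ⟨δ, h⟩ => ⟨δ, op_isTriangle.2 h⟩⟩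

end Op

namespace IsWeaklyExtriangulated

variable {C : Type u} [Category.{v} C] [Preadditive C] {T : ExtData.{u, v, w} C}
variable [HasZeroObject C] [HasBinaryBiproducts C] (hT : T.IsWeaklyExtriangulated)
  {A B Z A' B' Z' : C} {x : A ⟶ B} {y : B ⟶ Z} {δ : T.Ext Z A}
  {x' : A' ⟶ B'} {y' : B' ⟶ Z'} {δ' : T.Ext Z' A'}

include hT

/-- The common extension `push a δ = pull c δ'` is realized once, and `b` is a composite through its
middle term. -/
lemma exists_mid (h : T.IsTriangle x y δ) (h' : T.IsTriangle x' y' δ') (a : A ⟶ A') (c : Z ⟶ Z')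
    (hδ : push a δ = pull c δ') : ∃ b : B ⟶ B', x ≫ b = a ≫ x' ∧ b ≫ y' = y ≫ c := by
  obtain ⟨B'', x'', y'', h''⟩ := exists_triangle (push a δ)
  obtain ⟨b₁, h₁, h₂, -⟩ := hT.map_right x y δ a x'' y'' h h''
  obtain ⟨b₂, h₃, h₄, -⟩ := hT.map_left x' y' δ' c x'' y'' h' (hδ ▸ h'')
  exact ⟨b₁ ≫ b₂, by rw [reassoc_of% h₁, h₃], by rw [Category.assoc, h₄, reassoc_of% h₂]⟩

/-- Comparing with an arbitrary realization of `δ'` through `isIso_mid` leaves only a change of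
middle term, which the equivalence of sequences allows. -/
lemma transport (h : T.IsTriangle x y δ) (a : A ≅ A') (b : B ≅ B') (c : Z ≅ Z')
    (hx : x ≫ b.hom = a.hom ≫ x') (hy : b.hom ≫ y' = y ≫ c.hom)
    (hδ : push a.hom δ = pull c.hom δ') : T.IsTriangle x' y' δ' := by
  obtain ⟨B'', x'', y'', h''⟩ := exists_triangle δ'
  obtain ⟨β, h₁, h₂⟩ := hT.exists_mid h h'' a.hom c.hom hδ
  have := (hT.isExactSeq h).isIso_mid (hT.isExactSeq h'') a.hom β c.hom h₁ h₂ hδ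
  refine h''.congr ((asIso β).symm ≪≫ b) ?_ ?_
  · rw [← cancel_epi a.hom, Iso.trans_hom, ← reassoc_of% h₁]
    simp [hx]
  · simp [hy, ← h₂]

lemma triangle_zero_right (A : C) {Z : C} (hZ : IsZero Z) :
    T.IsTriangle (𝟙 A) (0 : A ⟶ Z) (0 : T.Ext Z A) :=
  hT.transport (hT.zero_right A) (Iso.refl _) (Iso.refl _) ((isZero_zero C).iso hZ)
    (by simp) (by simp) (by simp)

lemma triangle_zero_left (A : C) {Z : C} (hZ : IsZero Z) :
    T.IsTriangle (0 : Z ⟶ A) (𝟙 A) (0 : T.Ext A Z) :=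
  hT.transport (hT.zero_left A) ((isZero_zero C).iso hZ) (Iso.refl _) (Iso.refl _)
    (by simp) (by simp) (by simp)

/-- The isomorphism between a biproduct in the opposite category and the opposite of the biproduct
of the summands in reverse order. -/
noncomputable def biprodOpIso {C : Type u} [Category.{v} C] [Preadditive C]
    [HasBinaryBiproducts C] (X Y : C) :
    (Opposite.op X ⊞ Opposite.op Y : Cᵒᵖ) ≅ Opposite.op (Y ⊞ X) where
  hom := biprod.desc (biprod.snd : Y ⊞ X ⟶ X).op (biprod.fst : Y ⊞ X ⟶ Y).op
  inv := biprod.lift (biprod.inr : X ⟶ Y ⊞ X).op (biprod.inl : Y ⟶ Y ⊞ X).op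
  hom_inv_id := by
    apply biprod.hom_ext' <;> apply biprod.hom_ext <;> simp [← op_comp]
  inv_hom_id := by
    apply Quiver.Hom.unop_inj
    simp only [biprod.lift_desc, unop_add, unop_comp, Quiver.Hom.unop_op, unop_id]
    rw [add_comm]
    exact biprod.total

/-- The axioms are dual in pairs; the only discrepancy is the order of the summands in the mapping
cones, which `biprodOpIso` exchanges. -/
protected lemma op : T.op.IsWeaklyExtriangulated where
  exact₁ x y δ h X f := by
    have := hT.exact₁' _ _ _ (op_isTriangle.1 h) X.unop f.unop
    constructor
    · intro hf
      obtain ⟨g, hg⟩ := this.1 (congrArg Quiver.Hom.unop hf)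
      exact ⟨g.op, Quiver.Hom.unop_inj hg⟩
    · rintro ⟨g, hg⟩
      exact Quiver.Hom.unop_inj (this.2 ⟨g.unop, congrArg Quiver.Hom.unop hg⟩)
  exact₂ x y δ h X f := by
    refine (hT.exact₂' _ _ _ (op_isTriangle.1 h) X.unop f.unop).trans ?_
    exact ⟨fun ⟨g, hg⟩ => ⟨g.op, Quiver.Hom.unop_inj hg⟩,
      fun ⟨g, hg⟩ => ⟨g.unop, congrArg Quiver.Hom.unop hg⟩⟩
  exact₁' x y δ h X f := by
    have := hT.exact₁ _ _ _ (op_isTriangle.1 h) X.unop f.unop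
    constructor
    · intro hf
      obtain ⟨g, hg⟩ := this.1 (congrArg Quiver.Hom.unop hf)
      exact ⟨g.op, Quiver.Hom.unop_inj hg⟩
    · rintro ⟨g, hg⟩
      exact Quiver.Hom.unop_inj (this.2 ⟨g.unop, congrArg Quiver.Hom.unop hg⟩)
  exact₂' x y δ h X f := by
    refine (hT.exact₂ _ _ _ (op_isTriangle.1 h) X.unop f.unop).trans ?_
    exact ⟨fun ⟨g, hg⟩ => ⟨g.op, Quiver.Hom.unop_inj hg⟩,
      fun ⟨g, hg⟩ => ⟨g.unop, congrArg Quiver.Hom.unop hg⟩⟩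
  zero_right A :=
    op_isTriangle.2 (hT.triangle_zero_left A.unop (isZero_zero Cᵒᵖ).unop)
  zero_left A :=
    op_isTriangle.2 (hT.triangle_zero_right A.unop (isZero_zero Cᵒᵖ).unop)
  map_right {A B Z A' B'} x y δ a x' y' h h' := by
    obtain ⟨b, h₁, h₂, h₃⟩ := hT.map_left _ _ _ a.unop _ _ (op_isTriangle.1 h) (op_isTriangle.1 h')
    refine ⟨b.op, Quiver.Hom.unop_inj h₂, Quiver.Hom.unop_inj h₁, ?_⟩
    refine IsTriangle.congr (op_isTriangle.2 h₃) (biprodOpIso B.unop A'.unop).symm ?_ ?_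
    · apply biprod.hom_ext <;> apply Quiver.Hom.unop_inj <;> simp [biprodOpIso] <;> rfl
    · rw [← cancel_epi (biprodOpIso B.unop A'.unop).hom]
      apply biprod.hom_ext' <;> apply Quiver.Hom.unop_inj <;> simp [biprodOpIso] <;> rfl
  map_left {A B Z B' Z'} x y δ c x' y' h h' := by
    obtain ⟨b, h₁, h₂, h₃⟩ := hT.map_right _ _ _ c.unop _ _ (op_isTriangle.1 h) (op_isTriangle.1 h')
    refine ⟨b.op, Quiver.Hom.unop_inj h₂, Quiver.Hom.unop_inj h₁, ?_⟩
    refine IsTriangle.congr (op_isTriangle.2 h₃) (biprodOpIso Z'.unop B.unop).symm ?_ ?_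
    · apply biprod.hom_ext <;> apply Quiver.Hom.unop_inj <;> simp [biprodOpIso] <;> rfl
    · rw [← cancel_epi (biprodOpIso Z'.unop B.unop).hom]
      apply biprod.hom_ext' <;> apply Quiver.Hom.unop_inj <;> simp [biprodOpIso] <;> rfl

end IsWeaklyExtriangulated

section

variable {C : Type u} [Category.{v} C] [Preadditive C] {T : ExtData.{u, v, w} C}

lemma op_inflations {X Y : Cᵒᵖ} (f : X ⟶ Y) : T.op.inflations f ↔ T.deflations f.unop :=
  ⟨fun ⟨Z, y, h⟩ => ⟨Z.unop, y.unop, op_isConflation.1 h⟩,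
    fun ⟨Z, y, h⟩ => ⟨Opposite.op Z, y.op, op_isConflation.2 h⟩⟩

lemma op_deflations {X Y : Cᵒᵖ} (f : X ⟶ Y) : T.op.deflations f ↔ T.inflations f.unop :=
  ⟨fun ⟨Z, y, h⟩ => ⟨Z.unop, y.unop, op_isConflation.1 h⟩,
    fun ⟨Z, y, h⟩ => ⟨Opposite.op Z, y.op, op_isConflation.2 h⟩⟩

protected lemma IsExtriangulated.op [HasZeroObject C] [HasBinaryBiproducts C]
    (hT : T.IsExtriangulated) : T.op.IsExtriangulated where
  toIsWeaklyExtriangulated := hT.toIsWeaklyExtriangulated.op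
  inflations_comp := ⟨fun _ _ hf hg =>
    (op_inflations _).2 (hT.deflations_comp.comp_mem _ _ ((op_inflations _).1 hg)
      ((op_inflations _).1 hf))⟩
  deflations_comp := ⟨fun _ _ hf hg =>
    (op_deflations _).2 (hT.inflations_comp.comp_mem _ _ ((op_deflations _).1 hg)
      ((op_deflations _).1 hf))⟩

end

end ExtData
end Extri

/-! ### Long exact sequences, split triangles and the octahedra. -/

namespace Extri
namespace ExtData

section Shear

variable {C : Type u} [Category.{v} C] [Preadditive C] [HasBinaryBiproducts C]

/-- The automorphism `(x, y) ↦ (x, y + h x)` of a biproduct. -/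
@[simps]
noncomputable def shear {X Y : C} (h : X ⟶ Y) : X ⊞ Y ≅ X ⊞ Y where
  hom := biprod.lift biprod.fst (biprod.fst ≫ h + biprod.snd)
  inv := biprod.lift biprod.fst (biprod.snd - biprod.fst ≫ h)
  hom_inv_id := by apply biprod.hom_ext <;> simp
  inv_hom_id := by apply biprod.hom_ext <;> simp

/-- The isomorphism `(x, y) ↦ (y, -x)` between biproducts. -/
@[simps]
noncomputable def rotate (X Y : C) : X ⊞ Y ≅ Y ⊞ X where
  hom := biprod.lift biprod.snd (-biprod.fst)
  inv := biprod.lift (-biprod.snd) biprod.fst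
  hom_inv_id := by apply biprod.hom_ext <;> simp
  inv_hom_id := by apply biprod.hom_ext <;> simp

end Shear

namespace IsWeaklyExtriangulated

variable {C : Type u} [Category.{v} C] [Preadditive C] {T : ExtData.{u, v, w} C}
variable [HasZeroObject C] [HasBinaryBiproducts C] (hT : T.IsWeaklyExtriangulated)
  {A B Z A' B' Z' : C} {x : A ⟶ B} {y : B ⟶ Z} {δ : T.Ext Z A}
  {x' : A' ⟶ B'} {y' : B' ⟶ Z'} {δ' : T.Ext Z' A'}

include hT

/-- Exactness of `C(X, Z) ⟶ E(X, A) ⟶ E(X, B)`. -/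
lemma exists_pull_eq (h : T.IsTriangle x y δ) {X : C} (η : T.Ext X A) (hη : push x η = 0) :
    ∃ f : X ⟶ Z, pull f δ = η := by
  -- This extension over `Z ⊞ X` restricts to `δ` on `Z` and to `η` on `X`. Since `x` kills both,
  -- the mapping cocone along `Z ⟶ Z ⊞ X` has extension zero and splits by `g`. Its restriction to
  -- `X` writes `biprod.inr` as a map through `Z` plus a map through `w`; the latter kills the
  -- extension, so `η` is pulled back from `δ`.
  obtain ⟨W, x', w, h'⟩ := exists_triangle
    (pull (biprod.fst : Z ⊞ X ⟶ Z) δ + pull (biprod.snd : Z ⊞ X ⟶ X) η)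
  obtain ⟨b, -, -, h₃⟩ := hT.map_left x' w _ biprod.inl x y h' (by simpa [← pull_comp] using h)
  obtain ⟨g, hg⟩ := ((hT.isExactSeq h₃).exact₂ _ (𝟙 _)).1 (by
    rw [pull_id, push_add, push_pull, push_pull, hη, (hT.isExactSeq h).push_inc]; simp)
  refine ⟨biprod.inr ≫ g ≫ biprod.fst, ?_⟩
  have h₀ := congrArg (pull (biprod.inr ≫ g ≫ biprod.snd)) (hT.isExactSeq h').pull_proj
  have e : (biprod.inr : X ⟶ Z ⊞ X) ≫ g ≫ biprod.snd ≫ w =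
      biprod.inr - biprod.inr ≫ g ≫ biprod.fst ≫ biprod.inl := by
    rw [eq_sub_iff_add_eq, ← Preadditive.comp_add, ← Preadditive.comp_add, add_comm,
      ← biprod.desc_eq, hg, Category.comp_id]
  rw [pull_zero, ← pull_comp, Category.assoc, Category.assoc, e] at h₀
  simp only [neg_pull, pull_add, ← pull_comp, Preadditive.sub_comp, Category.assoc, biprod.inr_fst, biprod.inr_snd,
    biprod.inl_fst, biprod.inl_snd, zero_sub, sub_zero, pull_id, Category.comp_id,
    comp_zero] at h₀
  exact neg_add_eq_zero.1 h₀

/-- A first choice `c₀` comes from `exists_pull_eq`. It fits some `b₀` instead of `b`, and `b - b₀`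
factors through `y` by `k`; adding `k ≫ y'` repairs this without changing the pullback of `δ'`. -/
lemma exists_third (h : T.IsTriangle x y δ) (h' : T.IsTriangle x' y' δ') (a : A ⟶ A')
    (b : B ⟶ B') (hx : x ≫ b = a ≫ x') :
    ∃ c : Z ⟶ Z', b ≫ y' = y ≫ c ∧ push a δ = pull c δ' := by
  obtain ⟨c₀, hc₀⟩ := hT.exists_pull_eq h' (push a δ) (by
    rw [← push_comp, ← hx, push_comp, (hT.isExactSeq h).push_inc, push_zero])
  obtain ⟨b₀, h₁, h₂⟩ := hT.exists_mid h h' a c₀ hc₀.symm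
  obtain ⟨k, hk⟩ := ((hT.isExactSeq h).exact₁' _ (b - b₀)).1 (by
    rw [Preadditive.comp_sub, hx, h₁, sub_self])
  refine ⟨c₀ + k ≫ y', ?_, ?_⟩
  · rw [Preadditive.comp_add, reassoc_of% hk, ← h₂]; simp
  · rw [add_pull, pull_comp, (hT.isExactSeq h').pull_proj, pull_zero, add_zero, hc₀]

lemma exists_first (h : T.IsTriangle x y δ) (h' : T.IsTriangle x' y' δ') (b : B ⟶ B')
    (c : Z ⟶ Z') (hy : b ≫ y' = y ≫ c) :
    ∃ a : A ⟶ A', x ≫ b = a ≫ x' ∧ push a δ = pull c δ' := by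
  obtain ⟨a, h₁, h₂⟩ := hT.op.exists_third (op_isTriangle.2 h') (op_isTriangle.2 h) c.op b.op
    (by rw [← op_comp, hy, op_comp])
  exact ⟨a.unop, congrArg Quiver.Hom.unop h₁, h₂.symm⟩

/-- Exactness gives a section of `c`, after a correction through `y`, and shows that `c` is a
monomorphism. -/
lemma isIso_third (h : T.IsTriangle x y δ) (h' : T.IsTriangle x' y' δ') (a : A ⟶ A') (b : B ⟶ B')
    (c : Z ⟶ Z') [IsIso a] [IsIso b] (hx : x ≫ b = a ≫ x') (hy : b ≫ y' = y ≫ c)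
    (hδ : push a δ = pull c δ') : IsIso c := by
  have e := hT.isExactSeq h
  have e' := hT.isExactSeq h'
  obtain ⟨s, hs⟩ : ∃ s : Z' ⟶ Z, s ≫ c = 𝟙 Z' := by
    have hinv : inv a ≫ x = x' ≫ inv b := by simp [hx]
    obtain ⟨f, hf⟩ := hT.exists_pull_eq h (push (inv a) δ') (by
      rw [← push_comp, hinv, push_comp, e'.push_inc, push_zero])
    obtain ⟨g, hg⟩ := (e'.exact₂ _ (f ≫ c - 𝟙 _)).1 (by
      rw [sub_pull, pull_comp, ← hδ, ← push_pull, hf, ← push_comp]; simp)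
    refine ⟨f - g ≫ inv b ≫ y, ?_⟩
    rw [Preadditive.sub_comp, Category.assoc, Category.assoc, ← hy, IsIso.inv_hom_id_assoc, hg]
    abel
  have hmono : ∀ (X : C) (f : X ⟶ Z), f ≫ c = 0 → f = 0 := by
    intro X f hf
    obtain ⟨g, hg⟩ := (e.exact₂ _ f).1 (push_injective a (by
      rw [push_pull, hδ, ← pull_comp, hf]; simp))
    obtain ⟨k, hk⟩ := (e'.exact₁ _ (g ≫ b)).1 (by
      rw [Category.assoc, hy, reassoc_of% hg, hf])
    have : g = k ≫ inv a ≫ x := by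
      rw [← cancel_mono b]; simp [hx, hk]
    rw [← hg, this]; simp [e.comp_eq_zero]
  exact ⟨s, sub_eq_zero.1 (hmono _ _ (by simp [Preadditive.sub_comp, hs])), hs⟩

lemma isIso_first (h : T.IsTriangle x y δ) (h' : T.IsTriangle x' y' δ') (a : A ⟶ A') (b : B ⟶ B')
    (c : Z ⟶ Z') [IsIso b] [IsIso c] (hx : x ≫ b = a ≫ x') (hy : b ≫ y' = y ≫ c)
    (hδ : push a δ = pull c δ') : IsIso a := by
  have := hT.op.isIso_third (op_isTriangle.2 h') (op_isTriangle.2 h) c.op b.op a.op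
    (by rw [← op_comp, hy, op_comp]) (by rw [← op_comp, hx, op_comp]) hδ.symm
  exact (isIso_op_iff a).1 this

lemma cone_unique (h : T.IsTriangle x y δ) {y₁ : B ⟶ Z'} {δ₁ : T.Ext Z' A}
    (h₁ : T.IsTriangle x y₁ δ₁) : ∃ c : Z ≅ Z', y ≫ c.hom = y₁ ∧ pull c.hom δ₁ = δ := by
  obtain ⟨c, hc, hδ⟩ := hT.exists_third h h₁ (𝟙 _) (𝟙 _) (by simp)
  have := hT.isIso_third h h₁ (𝟙 _) (𝟙 _) c (by simp) hc hδ
  exact ⟨asIso c, by simpa using hc.symm, by simpa using hδ.symm⟩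

/-- A split sequence satisfies the exactness conditions for the extension `0`, so `isIso_mid`
identifies it with any realization of `0`. -/
lemma triangle_of_split {r : B ⟶ A} {s : Z ⟶ B} (hxr : x ≫ r = 𝟙 A) (hsy : s ≫ y = 𝟙 Z)
    (hxy : x ≫ y = 0) (h : r ≫ x + y ≫ s = 𝟙 B) : T.IsTriangle x y 0 := by
  obtain ⟨B', x', y', h'⟩ := exists_triangle (0 : T.Ext Z A)
  have e' := hT.isExactSeq h'
  obtain ⟨s', hs'⟩ := (e'.exact₂ _ (𝟙 Z)).1 (by simp)
  have hsr : s ≫ r = 0 := by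
    have : s ≫ (r ≫ x + y ≫ s) ≫ r = s ≫ r := by rw [h, Category.id_comp]
    simpa [reassoc_of% hsy, hxr] using this
  let b : B ⟶ B' := r ≫ x' + y ≫ s'
  have hb₁ : x ≫ b = 𝟙 A ≫ x' := by simp [b, reassoc_of% hxr, reassoc_of% hxy]
  have hb₂ : b ≫ y' = y ≫ 𝟙 Z := by simp [b, hs', e'.comp_eq_zero]
  have e : T.IsExactSeq x y (0 : T.Ext Z A) :=
    { exact₁ := fun X f => ⟨fun hf => ⟨f ≫ r, by
        have : f ≫ (r ≫ x + y ≫ s) = f := by rw [h, Category.comp_id]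
        simpa [reassoc_of% hf] using this⟩, by rintro ⟨g, rfl⟩; simp [hxy]⟩
      exact₂ := fun X f => ⟨fun _ => ⟨f ≫ s, by simp [hsy]⟩, fun _ => by simp⟩
      exact₁' := fun X f => ⟨fun hf => ⟨s ≫ f, by
        have : (r ≫ x + y ≫ s) ≫ f = f := by rw [h, Category.id_comp]
        simpa [hf] using this⟩, by rintro ⟨g, rfl⟩; simp [reassoc_of% hxy]⟩
      exact₂' := fun X f => ⟨fun _ => ⟨r ≫ f, by simp [reassoc_of% hxr]⟩, fun _ => by simp⟩ }
  have := e.isIso_mid e' (𝟙 A) b (𝟙 Z) hb₁ hb₂ (by simp)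
  exact h'.congr (asIso b).symm (by simp [← cancel_mono b, hb₁]) (by simp [← cancel_epi b, hb₂])

lemma triangle_inl_snd (X Y : C) : T.IsTriangle (biprod.inl : X ⟶ X ⊞ Y) biprod.snd 0 :=
  hT.triangle_of_split (r := biprod.fst) (s := biprod.inr) (by simp) (by simp) (by simp)
    biprod.total

lemma triangle_inr_fst (X Y : C) : T.IsTriangle (biprod.inr : Y ⟶ X ⊞ Y) biprod.fst 0 :=
  hT.triangle_of_split (r := biprod.snd) (s := biprod.inl) (by simp) (by simp) (by simp)
    ((add_comm _ _).trans biprod.total)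

/-- The direct sum of a triangle and the triangle `0 ⟶ Y = Y`. -/
lemma triangle_add_id (h : T.IsTriangle x y δ) (Y : C) :
    T.IsTriangle (biprod.lift x (0 : A ⟶ Y)) (biprod.map y (𝟙 Y)) (pull biprod.fst δ) := by
  -- The sum is the mapping cone of the zero map `A ⟶ Y`. The component of `b` in `Y` factors
  -- through `y` by `k`, and the automorphism `c` removes it together with the sign.
  obtain ⟨b, h₁, h₂, h₃⟩ := hT.map_right x y δ (0 : A ⟶ Y) biprod.inr biprod.fst h
    (by simpa using hT.triangle_inr_fst Z Y)
  obtain ⟨k, hk⟩ := ((hT.isExactSeq h).exact₁' _ (b ≫ biprod.snd)).1 (by simp [reassoc_of% h₁])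
  let c : Z ⊞ Y ≅ Z ⊞ Y :=
    { hom := biprod.lift biprod.fst (biprod.fst ≫ k - biprod.snd)
      inv := biprod.lift biprod.fst (biprod.fst ≫ k - biprod.snd)
      hom_inv_id := by apply biprod.hom_ext <;> simp
      inv_hom_id := by apply biprod.hom_ext <;> simp }
  refine hT.transport h₃ (Iso.refl _) (Iso.refl _) c (by simp) ?_ ?_
  · apply biprod.hom_ext <;> apply biprod.hom_ext' <;> simp [c, h₂, ← hk, reassoc_of% h₂]
  · simp [c, ← pull_comp]

/-- The octahedron axiom for the composition of two deflations. -/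
theorem octahedron (h : T.IsTriangle x y δ) {Z₁ N K : C} {l : Z₁ ⟶ Z} {q : Z ⟶ N}
    {ζ : T.Ext N Z₁} (h₁ : T.IsTriangle l q ζ) {g : K ⟶ B} {κ : T.Ext N K}
    (h₂ : T.IsTriangle g (y ≫ q) κ) :
    ∃ (j : A ⟶ K) (p : K ⟶ Z₁), T.IsTriangle j p (pull l δ) ∧ j ≫ g = x ∧ g ≫ y = p ≫ l ∧
      push j δ = pull q κ ∧ push p κ = ζ := by
  -- A realization `K₀` of `pull l δ` is a mapping cocone of `Z₁ ⊞ B ⟶ Z`. The plan is to show that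
  -- `K` is one as well, so that `K₀ ≅ K`.
  obtain ⟨K₀, j₀, p₀, hK₀⟩ := exists_triangle (pull l δ)
  obtain ⟨b₀, hb₁, hb₂, hb₃⟩ := hT.map_left x y δ l j₀ p₀ h hK₀
  obtain ⟨a, ha₁, ha₂⟩ := hT.exists_first h₂ h₁ y (𝟙 _) (by simp)
  obtain ⟨b, hb₄, hb₅, hb₆⟩ := hT.map_right g (y ≫ q) κ a l q h₂ (by rwa [ha₂, pull_id])
  obtain ⟨e, he⟩ := ((hT.isExactSeq h₁).exact₁ _ (y - b)).1 (by simp [hb₅])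
  -- `map_right` produces some `b` in place of `y`. As `(y - b) ≫ q = 0`, the difference is `e ≫ l`,
  -- and a shear absorbs it.
  have h₃ : T.IsTriangle (biprod.lift g (g ≫ e + a)) (biprod.desc y (-l)) (pull q κ) := by
    refine hb₆.congr (shear e) ?_ ?_
    · apply biprod.hom_ext <;> simp
    · apply biprod.hom_ext' <;> simp [he]
  obtain ⟨v, hv₁, hv₂⟩ := hT.exists_first hb₃ h₃ (rotate Z₁ B).hom (𝟙 _)
    (by apply biprod.hom_ext' <;> simp)
  have := hT.isIso_first hb₃ h₃ v (rotate Z₁ B).hom (𝟙 _) hv₁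
    (by apply biprod.hom_ext' <;> simp) hv₂
  have hv₃ : b₀ = v ≫ g := by simpa using congrArg (· ≫ biprod.fst) hv₁
  have hv₄ : p₀ = v ≫ (g ≫ e + a) := by simpa using congrArg (· ≫ biprod.snd) hv₁
  refine ⟨j₀ ≫ v, g ≫ e + a, hK₀.congr (asIso v) rfl hv₄.symm, ?_, ?_, ?_, ?_⟩
  · rw [Category.assoc, ← hv₃, hb₁]
  · simp [he, hb₄, ← ha₁]
  · rw [push_comp, hv₂, pull_id]
  · rw [add_push, push_comp, (hT.isExactSeq h₂).push_inc, push_zero, zero_add, ha₂, pull_id]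

/-- The octahedron axiom for the composition of two inflations. -/
theorem octahedron' (h : T.IsTriangle x y δ) {D N K : C} {l : B ⟶ D} {q : D ⟶ N}
    {ζ : T.Ext N B} (h₁ : T.IsTriangle l q ζ) {g : D ⟶ K} {κ : T.Ext K A}
    (h₂ : T.IsTriangle (x ≫ l) g κ) :
    ∃ (p : Z ⟶ K) (j : K ⟶ N), T.IsTriangle p j (push y ζ) ∧ g ≫ j = q ∧ l ≫ g = y ≫ p ∧
      pull j ζ = push x κ ∧ pull p κ = δ := by
  obtain ⟨j, p, h₃, h₄, h₅, h₆, h₇⟩ := hT.op.octahedron (op_isTriangle.2 h₁) (op_isTriangle.2 h)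
    (op_isTriangle.2 h₂)
  exact ⟨p.unop, j.unop, op_isTriangle.1 h₃, congrArg Quiver.Hom.unop h₄,
    congrArg Quiver.Hom.unop h₅, h₆, h₇⟩

end IsWeaklyExtriangulated

namespace IsExtriangulated

variable {C : Type u} [Category.{v} C] [Preadditive C] {T : ExtData.{u, v, w} C}
variable [HasZeroObject C] [HasBinaryBiproducts C] (hT : T.IsExtriangulated)
  {A B Z : C} {x : A ⟶ B} {y : B ⟶ Z} {δ : T.Ext Z A}

include hT

/-- Exactness of `E(Z, X) ⟶ E(B, X) ⟶ E(A, X)`. -/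
lemma exists_pull_proj_eq (h : T.IsTriangle x y δ) {X : C} (η : T.Ext B X) (hη : pull x η = 0) :
    ∃ ε : T.Ext Z X, pull y ε = η := by
  obtain ⟨W, i, w, h'⟩ := exists_triangle η
  -- The octahedron for `w ≫ y` makes the cocone `K` an extension of `A` by `X` with class `pull x η
  -- = 0`. A retraction `r` of `j` then pushes `κ` to the required extension.
  obtain ⟨K, g, κ, h₂⟩ := hT.deflations_comp.comp_mem w y ⟨_, _, _, h'⟩ ⟨_, _, _, h⟩
  obtain ⟨j, p, h₃, -, -, h₄, -⟩ := hT.octahedron h' h h₂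
  obtain ⟨r, hr⟩ := ((hT.isExactSeq h₃).exact₂' _ (𝟙 _)).1 (by rw [hη, push_zero])
  exact ⟨push r κ, by rw [← push_pull, ← h₄, ← push_comp, hr, push_id]⟩

end IsExtriangulated

end ExtData
end Extri

/-! ### Conflations and homotopy bicartesian squares. -/

namespace Extri
namespace ExtData

section Def

variable {C : Type u} [Category.{v} C] [Preadditive C] [HasBinaryBiproducts C]

/-- Homotopy bicartesian squares: commutative squares `u ≫ σ = d ≫ τ` whose associated sequence
`X ⟶ Y ⊞ M ⟶ V` is a conflation. -/
def IsSq (T : ExtData.{u, v, w} C) {X Y M V : C} (u : X ⟶ Y) (d : X ⟶ M) (σ : Y ⟶ V)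
    (τ : M ⟶ V) : Prop :=
  T.IsConflation (biprod.lift u d) (biprod.desc σ (-τ))

/-- The automorphism `-1` of an object. -/
@[simps]
def negIso (X : C) : X ≅ X where
  hom := -𝟙 X
  inv := -𝟙 X

end Def

namespace IsWeaklyExtriangulated

variable {C : Type u} [Category.{v} C] [Preadditive C] {T : ExtData.{u, v, w} C}
variable [HasZeroObject C] [HasBinaryBiproducts C] (hT : T.IsWeaklyExtriangulated)
  {A B Z A' B' Z' : C} {x : A ⟶ B} {y : B ⟶ Z} {x' : A' ⟶ B'} {y' : B' ⟶ Z'}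
  {X Y M V : C} {u : X ⟶ Y} {d : X ⟶ M} {σ : Y ⟶ V} {τ : M ⟶ V}

include hT

lemma conf_iso (h : T.IsConflation x y) (a : A ≅ A') (b : B ≅ B') (c : Z ≅ Z')
    (hx : x ≫ b.hom = a.hom ≫ x') (hy : b.hom ≫ y' = y ≫ c.hom) : T.IsConflation x' y' := by
  obtain ⟨δ, h⟩ := h
  exact ⟨pull c.inv (push a.hom δ), hT.transport h a b c hx hy (pull_hom_inv c _).symm⟩

lemma conf_neg_right (h : T.IsConflation x y) : T.IsConflation x (-y) :=
  hT.conf_iso h (Iso.refl _) (Iso.refl _) (negIso _) (by simp) (by simp)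

lemma conf_neg_left (h : T.IsConflation x y) : T.IsConflation (-x) y :=
  hT.conf_iso h (negIso _) (Iso.refl _) (Iso.refl _) (by simp) (by simp)

lemma conf_comp_eq_zero (h : T.IsConflation x y) : x ≫ y = 0 :=
  (hT.isExactSeq h.choose_spec).comp_eq_zero

lemma conf_lift (h : T.IsConflation x y) {W : C} (f : W ⟶ B) (hf : f ≫ y = 0) :
    ∃ g : W ⟶ A, g ≫ x = f :=
  ((hT.isExactSeq h.choose_spec).exact₁ _ f).1 hf

lemma conf_desc (h : T.IsConflation x y) {W : C} (f : B ⟶ W) (hf : x ≫ f = 0) :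
    ∃ g : Z ⟶ W, y ≫ g = f :=
  ((hT.isExactSeq h.choose_spec).exact₁' _ f).1 hf

lemma conf_cone_unique (h : T.IsConflation x y) {y₁ : B ⟶ Z'} (h₁ : T.IsConflation x y₁) :
    ∃ c : Z ≅ Z', y ≫ c.hom = y₁ := by
  obtain ⟨c, hc, -⟩ := hT.cone_unique h.choose_spec h₁.choose_spec
  exact ⟨c, hc⟩

lemma conf_of_split {r : B ⟶ A} {s : Z ⟶ B} (hxr : x ≫ r = 𝟙 A) (hsy : s ≫ y = 𝟙 Z)
    (hxy : x ≫ y = 0) (h : r ≫ x + y ≫ s = 𝟙 B) : T.IsConflation x y :=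
  ⟨_, hT.triangle_of_split hxr hsy hxy h⟩

lemma conf_inl_snd (X Y : C) : T.IsConflation (biprod.inl : X ⟶ X ⊞ Y) biprod.snd :=
  ⟨_, hT.triangle_inl_snd X Y⟩

lemma conf_inr_fst (X Y : C) : T.IsConflation (biprod.inr : Y ⟶ X ⊞ Y) biprod.fst :=
  ⟨_, hT.triangle_inr_fst X Y⟩

lemma conf_of_isIso_left (f : A ⟶ B) [IsIso f] : T.IsConflation f (0 : B ⟶ 0) :=
  hT.conf_iso ⟨_, hT.zero_right A⟩ (Iso.refl _) (asIso f) (Iso.refl _) (by simp) (by simp)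

lemma conf_of_isIso_right (f : A ⟶ B) [IsIso f] : T.IsConflation (0 : 0 ⟶ A) f :=
  hT.conf_iso ⟨_, hT.zero_left A⟩ (Iso.refl _) (Iso.refl _) (asIso f) (by simp) (by simp)

/-- The octahedron axiom for the composition of two deflations. -/
lemma conf_octahedron (h : T.IsConflation x y) {Z₁ N K : C} {l : Z₁ ⟶ Z} {q : Z ⟶ N}
    (h₁ : T.IsConflation l q) {g : K ⟶ B} (h₂ : T.IsConflation g (y ≫ q)) :
    ∃ (j : A ⟶ K) (p : K ⟶ Z₁), T.IsConflation j p ∧ j ≫ g = x ∧ g ≫ y = p ≫ l := by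
  obtain ⟨j, p, h₃, h₄, h₅, -, -⟩ :=
    hT.octahedron h.choose_spec h₁.choose_spec h₂.choose_spec
  exact ⟨j, p, ⟨_, h₃⟩, h₄, h₅⟩

/-- The octahedron axiom for the composition of two inflations. -/
lemma conf_octahedron' (h : T.IsConflation x y) {D N K : C} {l : B ⟶ D} {q : D ⟶ N}
    (h₁ : T.IsConflation l q) {g : D ⟶ K} (h₂ : T.IsConflation (x ≫ l) g) :
    ∃ (p : Z ⟶ K) (j : K ⟶ N), T.IsConflation p j ∧ g ≫ j = q ∧ l ≫ g = y ≫ p := by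
  obtain ⟨j, p, h₃, h₄, h₅, -, -⟩ :=
    hT.octahedron' h.choose_spec h₁.choose_spec h₂.choose_spec
  exact ⟨j, p, ⟨_, h₃⟩, h₄, h₅⟩

lemma sq_comm (h : T.IsSq u d σ τ) : u ≫ σ = d ≫ τ := by
  have := hT.conf_comp_eq_zero h
  rwa [biprod.lift_desc, Preadditive.comp_neg, ← sub_eq_add_neg, sub_eq_zero] at this

lemma sq_symm (h : T.IsSq u d σ τ) : T.IsSq d u τ σ :=
  hT.conf_iso h (Iso.refl _) (biprod.braiding _ _) (negIso _)
    (by apply biprod.hom_ext <;> simp) (by apply biprod.hom_ext' <;> simp)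

lemma sq_lift (h : T.IsSq u d σ τ) {W : C} (f : W ⟶ Y) (g : W ⟶ M) (hfg : f ≫ σ = g ≫ τ) :
    ∃ k : W ⟶ X, k ≫ u = f ∧ k ≫ d = g := by
  obtain ⟨k, hk⟩ := hT.conf_lift h (biprod.lift f g) (by simp [hfg])
  exact ⟨k, by simpa using congrArg (· ≫ biprod.fst) hk,
    by simpa using congrArg (· ≫ biprod.snd) hk⟩

lemma sq_desc (h : T.IsSq u d σ τ) {W : C} (f : Y ⟶ W) (g : M ⟶ W) (hfg : u ≫ f = d ≫ g) :
    ∃ k : V ⟶ W, σ ≫ k = f ∧ τ ≫ k = g := by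
  obtain ⟨k, hk⟩ := hT.conf_desc h (biprod.desc f (-g)) (by simp [hfg])
  exact ⟨k, by simpa using congrArg (biprod.inl ≫ ·) hk,
    by simpa using congrArg (biprod.inr ≫ ·) hk⟩

lemma op_isSq : T.op.IsSq σ.op τ.op u.op d.op ↔ T.IsSq u d σ τ := by
  let b : Opposite.op (Y ⊞ M) ≅ Opposite.op Y ⊞ Opposite.op M :=
    { hom := biprod.lift (biprod.inl : Y ⟶ Y ⊞ M).op (-(biprod.inr : M ⟶ Y ⊞ M)).op
      inv := biprod.desc (biprod.fst : Y ⊞ M ⟶ Y).op (-(biprod.snd : Y ⊞ M ⟶ M)).op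
      hom_inv_id := by
        apply Quiver.Hom.unop_inj
        simp
      inv_hom_id := by
        apply biprod.hom_ext' <;> apply biprod.hom_ext <;> simp [← op_comp] }
  have h₁ : (biprod.desc σ (-τ)).op ≫ b.hom = biprod.lift σ.op τ.op := by
    apply biprod.hom_ext <;> apply Quiver.Hom.unop_inj <;> simp [b]
  have h₂ : b.hom ≫ biprod.desc u.op (-d.op) = (biprod.lift u d).op := by
    apply Quiver.Hom.unop_inj
    apply biprod.hom_ext <;> simp [b]
  refine ⟨fun h => op_isConflation.1 (hT.op.conf_iso h (Iso.refl _) b.symm (Iso.refl _) ?_ ?_),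
    fun h => hT.op.conf_iso (op_isConflation.2 h) (Iso.refl _) b (Iso.refl _) ?_ ?_⟩
  · rw [← h₁]; simp
  · rw [← h₂]; simp
  · rw [h₁]; simp
  · rw [h₂]; simp

/-- Pushouts of inflations along arbitrary morphisms. -/
lemma exists_pushout {W : C} {w : M ⟶ W} (h : T.IsConflation d w) (u : X ⟶ Y) :
    ∃ (V : C) (σ : Y ⟶ V) (τ : M ⟶ V) (w' : V ⟶ W),
      T.IsSq u d σ τ ∧ T.IsConflation σ w' ∧ τ ≫ w' = w := by
  obtain ⟨δ, h⟩ := h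
  obtain ⟨V, σ, w', h'⟩ := exists_triangle (push u δ)
  obtain ⟨τ, h₁, h₂, h₃⟩ := hT.map_right d w δ u σ w' h h'
  exact ⟨V, σ, τ, w', hT.sq_symm ⟨_, h₃⟩, ⟨_, h'⟩, h₂⟩

/-- Pullbacks of deflations along arbitrary morphisms. -/
lemma exists_pullback {K : C} {k : K ⟶ Y} (h : T.IsConflation k σ) (τ : M ⟶ V) :
    ∃ (X : C) (u : X ⟶ Y) (d : X ⟶ M) (k' : K ⟶ X),
      T.IsSq u d σ τ ∧ T.IsConflation k' d ∧ k' ≫ u = k := by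
  obtain ⟨X, d, u, k', h₁, h₂, h₃⟩ := hT.op.exists_pushout (op_isConflation.2 h) τ.op
  exact ⟨X.unop, u.unop, d.unop, k'.unop, hT.op_isSq.1 (hT.op.sq_symm h₁), op_isConflation.1 h₂,
    congrArg Quiver.Hom.unop h₃⟩

/-- In a square, if `d` is an inflation, then so is the parallel morphism `σ`. -/
lemma sq_inflation (h : T.IsSq u d σ τ) {W : C} {w : M ⟶ W} (hd : T.IsConflation d w) :
    ∃ w' : V ⟶ W, T.IsConflation σ w' ∧ τ ≫ w' = w := by
  -- The cone of `biprod.lift u d` is unique up to isomorphism, so the square agrees with the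
  -- constructed pushout.
  obtain ⟨V₀, σ₀, τ₀, w₀, h₁, h₂, h₃⟩ := hT.exists_pushout hd u
  obtain ⟨c, hc⟩ := hT.conf_cone_unique h h₁
  have hσ : σ ≫ c.hom = σ₀ := by simpa using congrArg (biprod.inl ≫ ·) hc
  have hτ : τ ≫ c.hom = τ₀ := by simpa using congrArg (biprod.inr ≫ ·) hc
  refine ⟨c.hom ≫ w₀, hT.conf_iso h₂ (Iso.refl _) c.symm (Iso.refl _) (by simp [← hσ]) (by simp),
    by rw [reassoc_of% hτ, h₃]⟩

/-- A factorization between inflations with the same source is part of a square. -/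
lemma exists_sq_of_inflations {x' : A ⟶ B'} (h : T.IsConflation x y) (h' : T.IsConflation x' y')
    (g : B ⟶ B') (hg : x ≫ g = x') : ∃ c : Z ⟶ Z', T.IsSq y g c y' := by
  obtain ⟨δ, h⟩ := h
  obtain ⟨δ', h'⟩ := h'
  obtain ⟨c₀, hc₁, hc₂⟩ := hT.exists_third h h' (𝟙 _) g (by simp [hg])
  obtain ⟨b₀, h₁, h₂, h₃⟩ := hT.map_left x' y' δ' c₀ x y h' (by rw [← hc₂, push_id]; exact h)
  -- The square from `map_left` has `b₀` in place of `g`; both agree on `A`, so the difference is `y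
  -- ≫ k`, absorbed by the automorphism `e` and by replacing `c₀`.
  obtain ⟨k, hk⟩ := ((hT.isExactSeq h).exact₁' _ (g - b₀)).1 (by simp [hg, h₁])
  let e : Z ⊞ B' ≅ Z ⊞ B' :=
    { hom := biprod.lift (-biprod.fst) (biprod.snd - biprod.fst ≫ k)
      inv := biprod.lift (-biprod.fst) (biprod.snd - biprod.fst ≫ k)
      hom_inv_id := by apply biprod.hom_ext <;> simp
      inv_hom_id := by apply biprod.hom_ext <;> simp }
  refine ⟨c₀ + k ≫ y', hT.conf_iso ⟨_, h₃⟩ (Iso.refl _) e (negIso _) ?_ ?_⟩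
  · apply biprod.hom_ext <;> simp [e, hk]
  · apply biprod.hom_ext' <;> simp [e]

end IsWeaklyExtriangulated

namespace IsExtriangulated

variable {C : Type u} [Category.{v} C] [Preadditive C] {T : ExtData.{u, v, w} C}
variable [HasZeroObject C] [HasBinaryBiproducts C] (hT : T.IsExtriangulated)
  {X Y M V : C} {u : X ⟶ Y} {d : X ⟶ M} {σ : Y ⟶ V} {τ : M ⟶ V}

include hT

/-- In a square, if `d` is a deflation, then so is the parallel morphism `σ`. -/
lemma sq_deflation' (h : T.IsSq u d σ τ) {K : C} {k : K ⟶ X} (hd : T.IsConflation k d) :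
    T.IsConflation (k ≫ u) σ := by
  have hW := hT.toIsWeaklyExtriangulated
  obtain ⟨χ, hχ⟩ := hW.sq_symm h
  obtain ⟨κ, hd⟩ := hd
  -- The composite `X ⊞ Y ⟶ M ⊞ Y ⟶ V` is a deflation with cocone `P`. The octahedron makes `P` an
  -- extension of `X` by `K` with class `pull d κ = 0`, hence a split one.
  have hs := hW.triangle_add_id hd Y
  obtain ⟨P, g, κ', hκ'⟩ := hT.deflations_comp.comp_mem _ _ ⟨_, _, _, hs⟩ ⟨_, _, _, hχ⟩
  obtain ⟨j, π, h₁, h₂, h₃, -, -⟩ := hW.octahedron hs hχ hκ'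
  rw [← pull_comp, biprod.lift_fst, (hW.isExactSeq hd).pull_proj] at h₁
  have e₁ := hW.isExactSeq h₁
  obtain ⟨s, hs'⟩ := (e₁.exact₂ _ (𝟙 _)).1 (by simp)
  obtain ⟨ρ, hρ⟩ := (e₁.exact₂' _ (𝟙 _)).1 (by simp)
  have h₄ : g ≫ biprod.fst ≫ d = π ≫ d := by
    simpa using congrArg (· ≫ biprod.fst) h₃
  have h₅ : g ≫ biprod.snd = π ≫ u := by
    simpa using congrArg (· ≫ biprod.snd) h₃
  have h₆ : j ≫ g ≫ biprod.fst = k := by simp [reassoc_of% h₂]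
  obtain ⟨e, he⟩ := ((hW.isExactSeq hd).exact₁ _ (s ≫ g ≫ biprod.fst - 𝟙 _)).1 (by
    simp [h₄, reassoc_of% hs'])
  -- The section of `π` is corrected by a map through `K` so that `t ≫ g` becomes the graph of `u`.
  obtain ⟨t, ht⟩ : ∃ t : X ⟶ P, t = s - e ≫ j := ⟨_, rfl⟩
  have ht₁ : t ≫ π = 𝟙 _ := by simp [ht, hs', e₁.comp_eq_zero]
  have ht₂ : t ≫ g = biprod.lift (𝟙 _) u := by
    apply biprod.hom_ext
    · simp [ht, h₆, he]
    · simp [ht, h₅, reassoc_of% hs', reassoc_of% e₁.comp_eq_zero]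
  obtain ⟨ϖ, hϖ⟩ := (e₁.exact₁ _ (𝟙 _ - π ≫ t)).1 (by simp [ht₁])
  have hjϖ : j ≫ ϖ = 𝟙 _ := by
    have : (j ≫ ϖ ≫ j) ≫ ρ = j ≫ ρ := by
      rw [hϖ]; simp [reassoc_of% e₁.comp_eq_zero]
    simpa [hρ] using this
  have htϖ : t ≫ ϖ = 0 := by
    have : (t ≫ ϖ ≫ j) ≫ ρ = 0 := by
      rw [hϖ]; simp [reassoc_of% ht₁]
    simpa [hρ] using this
  have c₁ : T.IsConflation t ϖ := hW.conf_of_split ht₁ hjϖ htϖ (by rw [hϖ]; abel)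
  have c₂ : T.IsConflation (t ≫ g) (biprod.desc (-u) (𝟙 Y)) := by
    rw [ht₂]
    refine hW.conf_of_split (r := biprod.fst) (s := biprod.inr) (by simp) (by simp) (by simp) ?_
    apply biprod.hom_ext <;> apply biprod.hom_ext' <;> simp
  -- Divide `P ⟶ X ⊞ Y ⟶ V` by `X`, embedded through `t`: `P` becomes `K` and, the graph of `u`
  -- having cone `Y`, `X ⊞ Y` becomes `Y`. This gives `K ⟶ Y ⟶ V` up to signs.
  obtain ⟨p, q, h₈, h₉, h₁₀⟩ := hW.conf_octahedron' c₁ ⟨_, hκ'⟩ c₂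
  have hq : q = -σ := by simpa using congrArg (biprod.inr ≫ ·) h₉
  have hp : p = -(k ≫ u) := by
    simpa [reassoc_of% hjϖ, reassoc_of% h₂] using (congrArg (j ≫ ·) h₁₀).symm
  subst hq hp
  simpa using hW.conf_neg_left (hW.conf_neg_right h₈)

/-- In a square, if `σ` is an inflation, then so is the parallel morphism `d`. -/
lemma sq_inflation' (h : T.IsSq u d σ τ) {W : C} {w : V ⟶ W} (hσ : T.IsConflation σ w) :
    T.IsConflation d (τ ≫ w) := by
  have hW := hT.toIsWeaklyExtriangulated
  exact op_isConflation.1 (hT.op.sq_deflation' (hW.op.sq_symm (hW.op_isSq.2 h))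
    (op_isConflation.2 hσ))

/-- If `n` is an inflation, `m` is a deflation, and `n ≫ m` is a deflation, then the composition of
the kernel of `m` with the cokernel of `n` is a deflation with the same cocone as `n ≫ m`. -/
lemma three_by_three {N K Z A M L : C} {n : N ⟶ K} {z : K ⟶ Z} (h : T.IsConflation n z)
    {x : A ⟶ K} {m : K ⟶ M} (h' : T.IsConflation x m) {k : L ⟶ N}
    (hk : T.IsConflation k (n ≫ m)) : ∃ j : L ⟶ A, T.IsConflation j (x ≫ z) ∧ j ≫ x = k ≫ n := by
  have hW := hT.toIsWeaklyExtriangulated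
  obtain ⟨ζ, hζ⟩ := h
  -- A shear of the conflation `N ⟶ K ⊞ M ⟶ Z ⊞ M` gives a square with `n ≫ m` on one side; hence
  -- the parallel map `K ⟶ Z ⊞ M` is a deflation with cocone `L`. Restricting it over `Z` gives the
  -- claim.
  have h₁ : T.IsSq n (n ≫ m) (biprod.lift z (-m)) (-biprod.inr : M ⟶ Z ⊞ M) := by
    refine hW.conf_iso ⟨_, hW.triangle_add_id hζ M⟩ (Iso.refl _) (shear m) (Iso.refl _) ?_ ?_
    · apply biprod.hom_ext <;> simp
    · apply biprod.hom_ext <;> apply biprod.hom_ext' <;> simp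
  have h₂ := hT.sq_deflation' h₁ hk
  obtain ⟨j, p, h₃, h₄, h₅⟩ := hW.conf_octahedron h₂ (hW.conf_inl_snd Z M) (g := x)
    (by simpa using hW.conf_neg_right h')
  have hp : x ≫ z = p := by simpa using congrArg (· ≫ biprod.fst) h₅
  exact ⟨j, hp ▸ h₃, h₄⟩

end IsExtriangulated

end ExtData
end Extri

/-! ### The class `L ∘ R`: composition and 2-out-of-3. -/

namespace Extri
open ExtData

variable {C : Type u} [Category.{v} C] [Preadditive C] [HasZeroObject C]
  [HasBinaryBiproducts C] {T : ExtData.{u, v, w} C} {N : ObjectProperty C}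

variable (T N) in
/-- The hypotheses on a percolating subcategory, in a self-dual form: split monomorphisms which are
invertible modulo `[N]` have a complement in `N`. -/
structure IsAdmissible : Prop where
  extriangulated : T.IsExtriangulated
  percolating : IsPercolating T N
  p3 : CondP3 T N
  exists_complement : ∀ {A B : C} (σ : A ⟶ B) (ρ : B ⟶ A), σ ≫ ρ = 𝟙 A → ideal N (𝟙 B - ρ ≫ σ) →
    ∃ (M : C) (_ : N M) (j : M ⟶ B) (q : B ⟶ M),
      j ≫ q = 𝟙 M ∧ σ ≫ q = 0 ∧ j ≫ ρ = 0 ∧ ρ ≫ σ + q ≫ j = 𝟙 B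

omit [HasZeroObject C] [HasBinaryBiproducts C] in
lemma op_classL {X Y : Cᵒᵖ} (f : X ⟶ Y) : classL T.op N.op f ↔ classR T N f.unop :=
  ⟨fun ⟨Z, y, h, hZ⟩ => ⟨Z.unop, y.unop, op_isConflation.1 h, hZ⟩,
    fun ⟨Z, y, h, hZ⟩ => ⟨Opposite.op Z, y.op, op_isConflation.2 h, hZ⟩⟩

omit [HasZeroObject C] [HasBinaryBiproducts C] in
lemma op_classR {X Y : Cᵒᵖ} (f : X ⟶ Y) : classR T.op N.op f ↔ classL T N f.unop :=
  ⟨fun ⟨Z, y, h, hZ⟩ => ⟨Z.unop, y.unop, op_isConflation.1 h, hZ⟩,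
    fun ⟨Z, y, h, hZ⟩ => ⟨Opposite.op Z, y.op, op_isConflation.2 h, hZ⟩⟩

omit [HasZeroObject C] [HasBinaryBiproducts C] in
lemma op_classLR {X Y : Cᵒᵖ} (f : X ⟶ Y) : classLR T.op N.op f ↔ classLR T N f.unop :=
  ⟨fun ⟨M, r, l, hr, hl, h⟩ => ⟨M.unop, l.unop, r.unop, (op_classL _).1 hl, (op_classR _).1 hr,
      congrArg Quiver.Hom.unop h⟩,
    fun ⟨M, r, l, hr, hl, h⟩ => ⟨Opposite.op M, l.op, r.op, (op_classR _).2 hl, (op_classL _).2 hr,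
      Quiver.Hom.unop_inj h⟩⟩

omit [Preadditive C] [HasZeroObject C] [HasBinaryBiproducts C] in
lemma op_ideal {X Y : Cᵒᵖ} (f : X ⟶ Y) : ideal N.op f ↔ ideal N f.unop :=
  ⟨fun ⟨M, hM, i, j, h⟩ => ⟨M.unop, hM, j.unop, i.unop, congrArg Quiver.Hom.unop h⟩,
    fun ⟨M, hM, i, j, h⟩ => ⟨Opposite.op M, hM, j.op, i.op, Quiver.Hom.unop_inj h⟩⟩

namespace IsAdmissible

variable (H : IsAdmissible T N)
include H

lemma weak : T.IsWeaklyExtriangulated := H.extriangulated.toIsWeaklyExtriangulated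

lemma prop_of_iso {X Y : C} (e : X ≅ Y) (h : N X) : N Y := by
  have := H.percolating.iso
  exact N.prop_of_iso e h

protected lemma op : IsAdmissible T.op N.op where
  extriangulated := H.extriangulated.op
  percolating :=
    { zero := H.prop_of_iso ((isZero_zero C).iso (isZero_zero Cᵒᵖ).unop) H.percolating.zero
      biprod := fun X Y hX hY => H.prop_of_iso
        (IsWeaklyExtriangulated.biprodOpIso X.unop Y.unop).unop
        (H.percolating.biprod Y.unop X.unop hY hX)
      iso := by
        have := H.percolating.iso
        infer_instance
      summand := fun X Y h => H.percolating.summand X.unop Y.unop (H.prop_of_iso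
        ((IsWeaklyExtriangulated.biprodOpIso X.unop Y.unop).unop.symm ≪≫ biprod.braiding _ _) h)
      left := fun x y h hB hZ => H.percolating.right _ _ (op_isConflation.1 h) hZ hB
      mid := fun x y h hA hZ => H.percolating.mid _ _ (op_isConflation.1 h) hZ hA
      right := fun x y h hA hB => H.percolating.left _ _ (op_isConflation.1 h) hB hA
      factor_to := fun f hM => by
        obtain ⟨M', g, h, h₁, h₂, h₃, h₄⟩ := H.percolating.factor_from f.unop hM
        exact ⟨Opposite.op M', h.op, g.op, h₁, (op_deflations _).2 h₃, (op_inflations _).2 h₂,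
          Quiver.Hom.unop_inj h₄⟩
      factor_from := fun f hM => by
        obtain ⟨M', g, h, h₁, h₂, h₃, h₄⟩ := H.percolating.factor_to f.unop hM
        exact ⟨Opposite.op M', h.op, g.op, h₁, (op_deflations _).2 h₃, (op_inflations _).2 h₂,
          Quiver.Hom.unop_inj h₄⟩ }
  p3 :=
    { left := fun l hl f hf => (op_ideal _).2
        (H.p3.right _ ((op_classL _).1 hl) _ (congrArg Quiver.Hom.unop hf))
      right := fun l hl f hf => (op_ideal _).2
        (H.p3.left _ ((op_classR _).1 hl) _ (congrArg Quiver.Hom.unop hf)) }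
  exists_complement := fun σ ρ h h' => by
    obtain ⟨M, hM, j, q, h₁, h₂, h₃, h₄⟩ := H.exists_complement ρ.unop σ.unop
      (congrArg Quiver.Hom.unop h) ((op_ideal _).1 h')
    exact ⟨Opposite.op M, hM, q.op, j.op, Quiver.Hom.unop_inj h₁, Quiver.Hom.unop_inj h₃,
      Quiver.Hom.unop_inj h₂, Quiver.Hom.unop_inj h₄⟩

/-- By the octahedron, the cone of a composite is an extension of the two cones. -/
lemma classL_comp {X Y Z : C} {f : X ⟶ Y} {g : Y ⟶ Z} (hf : classL T N f) (hg : classL T N g) :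
    classL T N (f ≫ g) := by
  obtain ⟨A, y, h₁, hA⟩ := hf
  obtain ⟨B, q, h₂, hB⟩ := hg
  obtain ⟨D, z, h₃⟩ := H.extriangulated.inflations_comp.comp_mem f g ⟨_, _, h₁⟩ ⟨_, _, h₂⟩
  obtain ⟨p, j, h₄, -, -⟩ := H.weak.conf_octahedron' h₁ h₂ h₃
  exact ⟨D, z, h₃, H.percolating.mid _ _ h₄ hA hB⟩

lemma classR_comp {X Y Z : C} {f : X ⟶ Y} {g : Y ⟶ Z} (hf : classR T N f) (hg : classR T N g) :
    classR T N (f ≫ g) :=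
  (op_classL (f ≫ g).op).1 (H.op.classL_comp ((op_classL g.op).2 hg) ((op_classL f.op).2 hf))

lemma classL_of_isIso {X Y : C} (f : X ⟶ Y) [IsIso f] : classL T N f :=
  ⟨_, _, H.weak.conf_of_isIso_left f, H.percolating.zero⟩

lemma classR_of_isIso {X Y : C} (f : X ⟶ Y) [IsIso f] : classR T N f :=
  ⟨_, _, H.weak.conf_of_isIso_right f, H.percolating.zero⟩

/-- If `d` is a deflation with cocone in `N` and `d ≫ h` is an inflation, then `d` is an inflation
with cone in `N`. -/
lemma classL_of_inflation_comp {X M B : C} {d : X ⟶ M} (hd : classR T N d) (h : M ⟶ B)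
    (hi : T.inflations (d ≫ h)) : classL T N d := by
  obtain ⟨L, k, hk, hL⟩ := hd
  obtain ⟨D, c, hc⟩ := hi
  obtain ⟨V, x', b, -, h₁, -, -⟩ := H.weak.exists_pushout hc d
  -- Since `d ≫ h` factors through `d`, shearing the pushout of `d ≫ h` along `d` replaces that side
  -- by zero. Now `b` is parallel to `d`, hence in `R`, and it is also a split monomorphism.
  have h₂ : T.IsSq d (0 : X ⟶ B) (x' - h ≫ b) b := by
    refine H.weak.conf_iso h₁ (Iso.refl _) (shear (-h)) (Iso.refl _) ?_ ?_
    · apply biprod.hom_ext <;> simp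
    · apply biprod.hom_ext' <;> simp
  have h₃ := H.weak.sq_symm h₂
  have hb := H.extriangulated.sq_deflation' h₃ hk
  obtain ⟨ρ, hρ, -⟩ := H.weak.sq_desc h₃ (𝟙 B) 0 (by simp)
  -- (P3) applies because `b ≫ (𝟙 - ρ ≫ b) = 0`. So `b` has a complement in `N`: it is an inflation
  -- with cone in `N`, and then so is the parallel map `d`.
  obtain ⟨M', hM', j, q, h₄, h₅, h₆, h₇⟩ := H.exists_complement b ρ hρ
    (H.p3.right b ⟨L, _, hb, hL⟩ _ (by simp [reassoc_of% hρ]))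
  exact ⟨M', _, H.extriangulated.sq_inflation' h₃ (H.weak.conf_of_split hρ h₄ h₅ h₇), hM'⟩

/-- A morphism from an object of `N` which becomes an inflation after composition with another
morphism is an inflation. -/
lemma inflation_of_comp {X A B : C} (hX : N X) (n : X ⟶ A) (l : A ⟶ B)
    (h : T.inflations (n ≫ l)) : T.inflations n := by
  obtain ⟨M, d, n', hM, ⟨L, k, hd⟩, hn', rfl⟩ := H.percolating.factor_from n hX
  obtain ⟨W, w, hw, -⟩ := H.classL_of_inflation_comp ⟨L, k, hd, H.percolating.left _ _ hd hX hM⟩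
    (n' ≫ l) (by simpa using h)
  exact H.extriangulated.inflations_comp.comp_mem _ _ ⟨_, _, hw⟩ hn'

/-- An inflation followed by a morphism in `R` is a morphism in `R` followed by an inflation. -/
lemma exists_swap_inflation {A B Z D : C} {x : A ⟶ B} {q : B ⟶ D} (hx : T.IsConflation x q)
    {r : B ⟶ Z} (hr : classR T N r) :
    ∃ (Y : C) (r' : A ⟶ Y) (x' : Y ⟶ Z) (D' : C) (q' : Z ⟶ D'), classR T N r' ∧
      T.IsConflation x' q' ∧ r' ≫ x' = x ≫ r ∧ (N D → N D') := by
  obtain ⟨P, i, hi, hP⟩ := hr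
  obtain ⟨M, d, e, hM, ⟨L, k, hd⟩, ⟨D', w, he⟩, hde⟩ := H.percolating.factor_from (i ≫ q) hP
  have hL := H.percolating.left _ _ hd hP hM
  -- `M` plays the role of the image of `P` in `D`, and `K` that of the sum of `A` and `P` inside
  -- `B`. The wanted middle object is `Y = K / P`, and `Y ⟶ Z` has cone `D / M`.
  obtain ⟨K, u, m, x₀, h₁, h₂, h₃⟩ := H.weak.exists_pullback hx e
  have hu := H.extriangulated.sq_inflation' (H.weak.sq_symm h₁) he
  obtain ⟨n, hn₁, hn₂⟩ := H.weak.sq_lift h₁ i d hde.symm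
  obtain ⟨Y, z, hz⟩ := H.inflation_of_comp hP n u (hn₁ ▸ ⟨_, _, hi⟩)
  obtain ⟨p, j, h₄, -, h₅⟩ := H.weak.conf_octahedron' hz hu (hn₁ ▸ hi)
  -- This makes `A ⟶ K ⟶ Y` a deflation whose cocone is that of `P ⟶ M`, which lies in `N`.
  obtain ⟨f, h₆, -⟩ := H.extriangulated.three_by_three hz h₂ (hn₂ ▸ hd)
  exact ⟨Y, x₀ ≫ z, p, D', j, ⟨L, f, h₆, hL⟩, h₄,
    by rw [Category.assoc, ← h₅, reassoc_of% h₃], H.percolating.right _ _ he hM⟩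

lemma classLR_of_classL {X Y : C} {f : X ⟶ Y} (hf : classL T N f) : classLR T N f :=
  ⟨X, 𝟙 X, f, H.classR_of_isIso _, hf, Category.id_comp _⟩

lemma classLR_of_classR {X Y : C} {f : X ⟶ Y} (hf : classR T N f) : classLR T N f :=
  ⟨Y, f, 𝟙 Y, hf, H.classL_of_isIso _, Category.comp_id _⟩

lemma isMultiplicative : (classLR T N).IsMultiplicative where
  id_mem X := H.classLR_of_classL (H.classL_of_isIso _)
  comp_mem := by
    rintro X Y Z _ _ ⟨A, r, l, hr, ⟨D, c, hl, hD⟩, rfl⟩ ⟨B, r₁, l₁, hr₁, hl₁, rfl⟩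
    obtain ⟨Y', r', l', D', q', h₁, h₂, h₃, h₄⟩ := H.exists_swap_inflation hl hr₁
    exact ⟨Y', r ≫ r', l' ≫ l₁, H.classR_comp hr h₁, H.classL_comp ⟨_, _, h₂, h₄ hD⟩ hl₁,
      by simp [reassoc_of% h₃]⟩

lemma classLR_comp {X Y Z : C} {f : X ⟶ Y} {g : Y ⟶ Z} (hf : classLR T N f)
    (hg : classLR T N g) : classLR T N (f ≫ g) :=
  H.isMultiplicative.comp_mem f g hf hg

lemma classS_eq : classS T N = classLR T N := by
  have := H.isMultiplicative
  apply le_antisymm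
  · rw [classS, MorphismProperty.multiplicativeClosure_le_iff]
    exact sup_le (fun _ _ _ h => H.classLR_of_classL h) (fun _ _ _ h => H.classLR_of_classR h)
  · rintro X Y _ ⟨M, r, l, hr, hl, rfl⟩
    rw [classS]
    exact MorphismProperty.IsStableUnderComposition.comp_mem _ _
      (MorphismProperty.le_multiplicativeClosure _ _ (Or.inr hr))
      (MorphismProperty.le_multiplicativeClosure _ _ (Or.inl hl))

/-- A morphism between the targets of two morphisms in `L` with the same source belongs to `S`. -/
lemma classLR_of_classL_of_classL {X Y Z : C} {l : X ⟶ Y} {g : Y ⟶ Z} (hl : classL T N l)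
    (hg : classL T N (l ≫ g)) : classLR T N g := by
  obtain ⟨D, w, hl, hD⟩ := hl
  obtain ⟨D', w', hg, hD'⟩ := hg
  -- `g` is parallel to the induced map `c` of cones. Splitting `c` by percolation into a deflation
  -- and an inflation splits `g` correspondingly through the pullback `P`.
  obtain ⟨c, hc⟩ := H.weak.exists_sq_of_inflations hl hg g rfl
  obtain ⟨M, d, e, hM, ⟨L, k, hd⟩, ⟨E, f, he⟩, rfl⟩ := H.percolating.factor_from c hD
  obtain ⟨P, u, d₁, k', h₁, h₂, h₃⟩ := H.weak.exists_pullback hg e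
  have hu := H.extriangulated.sq_inflation' (H.weak.sq_symm h₁) he
  have hL := H.percolating.left _ _ hd hD hM
  obtain ⟨κ, hd⟩ := hd
  have e₁ : biprod.desc (d ≫ e) (-w') = biprod.map d (𝟙 Z) ≫ biprod.desc e (-w') := by
    apply biprod.hom_ext' <;> simp
  rw [IsSq, e₁] at hc
  obtain ⟨j, p, h₄, -, h₅⟩ := H.weak.conf_octahedron ⟨_, H.weak.triangle_add_id hd Z⟩
    (H.weak.sq_symm h₁) hc
  exact ⟨P, p, u, ⟨L, j, h₄, hL⟩, ⟨E, _, hu, H.percolating.right _ _ he hM hD'⟩,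
    by simpa using (congrArg (· ≫ biprod.snd) h₅).symm⟩

/-- Pushing `f` out along `r` gives `Y ⟶ V` in `R`, through which `g` factors by some `k`. Both `σ :
M ⟶ V` and `σ ≫ k = l` lie in `L`, so `k` is covered by `classLR_of_classL_of_classL`. -/
lemma classLR_of_classL_comp {X Y Z : C} {f : X ⟶ Y} {g : Y ⟶ Z} (hf : classL T N f)
    (hfg : classLR T N (f ≫ g)) : classLR T N g := by
  obtain ⟨D, w, hf, hD⟩ := hf
  obtain ⟨M, r, l, ⟨P, i, hr, hP⟩, hl, h⟩ := hfg
  obtain ⟨V, σ, τ, w', h₁, h₂, -⟩ := H.weak.exists_pushout hf r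
  obtain ⟨k, hk₁, hk₂⟩ := H.weak.sq_desc h₁ l g h
  rw [← hk₂]
  refine H.classLR_comp (H.classLR_of_classR ⟨P, _, H.extriangulated.sq_deflation'
    (H.weak.sq_symm h₁) hr, hP⟩) ?_
  exact H.classLR_of_classL_of_classL ⟨D, w', h₂, hD⟩ (hk₁ ▸ hl)

lemma classLR_of_comp_classR {X Y Z : C} {f : X ⟶ Y} {g : Y ⟶ Z} (hg : classR T N g)
    (hfg : classLR T N (f ≫ g)) : classLR T N f :=
  (op_classLR f.op).1 (H.op.classLR_of_classL_comp ((op_classL g.op).2 hg)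
    ((op_classLR (f ≫ g).op).2 hfg))

lemma classL_inl (X : C) {M : C} (hM : N M) : classL T N (biprod.inl : X ⟶ X ⊞ M) :=
  ⟨M, _, H.weak.conf_inl_snd X M, hM⟩

/-- The class `S` is stable under adding morphisms in the ideal `[N]`. -/
lemma classLR_of_ideal_sub {X Y : C} {f g : X ⟶ Y} (hg : classLR T N g)
    (h : ideal N (f - g)) : classLR T N f := by
  obtain ⟨M, hM, i, j, h⟩ := h
  -- If `f - g` factors through `M` as `i ≫ j`, then `f` is the graph of `i`, which lies in `L`,
  -- followed by `biprod.desc g j`, whose restriction along `biprod.inl ∈ L` is `g`.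
  have h₁ : classLR T N (biprod.desc g j : X ⊞ M ⟶ Y) :=
    H.classLR_of_classL_comp (H.classL_inl X hM) (by simpa using hg)
  have h₂ : classL T N (biprod.lift (𝟙 X) i) := by
    refine ⟨M, biprod.desc (-i) (𝟙 M), H.weak.conf_of_split (r := biprod.fst) (s := biprod.inr)
      (by simp) (by simp) (by simp) ?_, hM⟩
    apply biprod.hom_ext <;> apply biprod.hom_ext' <;> simp
  have h₃ : f = biprod.lift (𝟙 X) i ≫ biprod.desc g j := by simp [h]
  rw [h₃]
  exact H.classLR_comp (H.classLR_of_classL h₂) h₁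

/-- After division by the image `P₁` of the cocone of `r`, the composite `r' ≫ m` factors as `r ≫ j`
with `j ∈ R`. Then `g ≫ z` and `j ≫ l''` agree after `r`, hence modulo `[N]` by (P3), so `g ≫ z ∈
S`; finally `z ∈ R` is cancelled. -/
lemma classLR_of_classR_comp {X Y Z : C} {r : X ⟶ Y} {g : Y ⟶ Z} (hr : classR T N r)
    (h : classLR T N (r ≫ g)) : classLR T N g := by
  have hr₀ := hr
  obtain ⟨P, i, hr, hP⟩ := hr
  obtain ⟨M, r', l', hr', ⟨D, c, hl', hD⟩, h⟩ := h
  obtain ⟨P₁, d, n, hP₁, -, ⟨M', m, hn⟩, hdn⟩ := H.percolating.factor_from (i ≫ r') hP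
  obtain ⟨Z', z, hz⟩ := H.extriangulated.inflations_comp.comp_mem n l' ⟨_, _, hn⟩ ⟨_, _, hl'⟩
  obtain ⟨l'', j₂, h₁, -, h₂⟩ := H.weak.conf_octahedron' hn hl' hz
  obtain ⟨Q, π, hπ, hQ⟩ := H.classR_comp hr' ⟨_, _, hn, hP₁⟩
  -- The cocone `P` of `r` embeds into the cocone `Q` of `r' ≫ m`; the quotient `Q / P`, again in
  -- `N`, is the cocone of `j`.
  obtain ⟨a, ha⟩ := H.weak.conf_lift hπ i (by
    rw [← reassoc_of% hdn, H.weak.conf_comp_eq_zero hn, comp_zero])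
  obtain ⟨Q', a', ha'⟩ := H.inflation_of_comp hP a π (ha ▸ ⟨_, _, hr⟩)
  obtain ⟨p, j, h₃, h₄, -⟩ := H.weak.conf_octahedron' ha' hπ (ha ▸ hr)
  have hj : classR T N j := ⟨Q', p, h₃, H.percolating.right _ _ ha' hP hQ⟩
  refine H.classLR_of_comp_classR (g := z) ⟨P₁, _, hz, hP₁⟩
    (H.classLR_of_ideal_sub (g := j ≫ l'') ⟨_, j, l'', hj, ⟨_, _, h₁, hD⟩, rfl⟩ ?_)
  refine H.p3.right r hr₀ _ ?_
  rw [Preadditive.comp_sub, reassoc_of% h₄, ← h₂, reassoc_of% h, sub_self]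

lemma classLR_of_comp_classL {X Y Z : C} {f : X ⟶ Y} {g : Y ⟶ Z} (hg : classL T N g)
    (hfg : classLR T N (f ≫ g)) : classLR T N f :=
  (op_classLR f.op).1 (H.op.classLR_of_classR_comp ((op_classR g.op).2 hg)
    ((op_classLR (f ≫ g).op).2 hfg))

lemma hasTwoOutOfThreeProperty : (classLR T N).HasTwoOutOfThreeProperty where
  comp_mem _ _ hf hg := H.classLR_comp hf hg
  of_precomp := by
    rintro X Y Z _ g ⟨M, r, l, hr, hl, rfl⟩ h
    rw [Category.assoc] at h
    exact H.classLR_of_classL_comp hl (H.classLR_of_classR_comp hr h)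
  of_postcomp := by
    rintro X Y Z f _ ⟨M, r, l, hr, hl, rfl⟩ h
    rw [← Category.assoc] at h
    exact H.classLR_of_comp_classR hr (H.classLR_of_comp_classL hl h)

end IsAdmissible
end Extri

/-! ### Calculus of fractions, (M3), (M4), the ideal quotient and vanishing extensions. -/

namespace Extri
open ExtData

variable {C : Type u} [Category.{v} C] [Preadditive C] [HasZeroObject C]
  [HasBinaryBiproducts C] {T : ExtData.{u, v, w} C} {N : ObjectProperty C}

namespace IsAdmissible

variable (H : IsAdmissible T N)
include H

/-- A morphism out of an object of `N` is annihilated by a morphism in `R`. -/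
lemma exists_classR_comp_eq_zero {M Y : C} (hM : N M) (f : M ⟶ Y) :
    ∃ (Y' : C) (m : Y ⟶ Y'), classR T N m ∧ f ≫ m = 0 := by
  obtain ⟨M', d, n, hM', -, ⟨Y', m, hn⟩, rfl⟩ := H.percolating.factor_from f hM
  exact ⟨Y', m, ⟨_, _, hn, hM'⟩, by simp [H.weak.conf_comp_eq_zero hn]⟩

lemma exists_classR_comp_eq_zero_of_ideal {X Y : C} {f : X ⟶ Y} (hf : ideal N f) :
    ∃ (Y' : C) (m : Y ⟶ Y'), classR T N m ∧ f ≫ m = 0 := by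
  obtain ⟨M, hM, i, j, rfl⟩ := hf
  obtain ⟨Y', m, hm, h⟩ := H.exists_classR_comp_eq_zero hM j
  exact ⟨Y', m, hm, by simp [h]⟩

/-- For the Ore condition, `f` is made to vanish on the cocone of `r` by a morphism of `R`; it then
descends along `r`, and `l` is pushed out along the descended map. For cancellation, (P3) deals with
`r`, and the remaining map out of the cone of `l` is killed because that cone lies in `N`. -/
lemma hasLeftCalculusOfFractions : (classLR T N).HasLeftCalculusOfFractions where
  toIsMultiplicative := H.isMultiplicative
  exists_leftFraction X Y φ := by
    obtain ⟨s, ⟨M, r, l, ⟨P, i, hr, hP⟩, ⟨D, w, hl, hD⟩, rfl⟩, f⟩ := φ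
    obtain ⟨Y₁, m, hm, h⟩ := H.exists_classR_comp_eq_zero hP (i ≫ f)
    obtain ⟨f₁, hf₁⟩ := H.weak.conf_desc hr (f ≫ m) (by simpa using h)
    obtain ⟨V, σ, τ, w', h₁, h₂, -⟩ := H.weak.exists_pushout hl f₁
    refine ⟨⟨τ, m ≫ σ, H.classLR_comp (H.classLR_of_classR hm)
      (H.classLR_of_classL ⟨_, _, h₂, hD⟩)⟩, ?_⟩
    simp [← H.weak.sq_comm h₁, reassoc_of% hf₁]
  ext X' X Y f₁ f₂ s hs h := by
    obtain ⟨M, r, l, hr, ⟨D, w, hl, hD⟩, rfl⟩ := hs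
    obtain ⟨Y₁, m₁, hm₁, h₁⟩ := H.exists_classR_comp_eq_zero_of_ideal
      (H.p3.right r hr (l ≫ (f₁ - f₂)) (by
        rw [Preadditive.comp_sub, Preadditive.comp_sub, ← Category.assoc, ← Category.assoc, h,
          sub_self]))
    obtain ⟨g, hg⟩ := H.weak.conf_desc hl ((f₁ - f₂) ≫ m₁) (by simpa using h₁)
    obtain ⟨Y₂, m₂, hm₂, h₂⟩ := H.exists_classR_comp_eq_zero hD g
    refine ⟨Y₂, m₁ ≫ m₂, H.classLR_of_classR (H.classR_comp hm₁ hm₂), ?_⟩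
    rw [← sub_eq_zero, ← Preadditive.sub_comp, ← Category.assoc, ← hg, Category.assoc, h₂,
      comp_zero]

lemma hasRightCalculusOfFractions : (classLR T N).HasRightCalculusOfFractions := by
  have := H.op.hasLeftCalculusOfFractions
  have h : (classLR T.op N.op).unop = classLR T N := by
    ext X Y f
    exact op_classLR f.op
  rw [← h]
  infer_instance

/-- Writing `a = r ≫ l`, the two mapping-cone squares carry `r ∈ R` and `l ∈ L` to their parallel
sides, whose composite is `b`. -/
lemma exists_mid_of_push {A B Z A' B' : C} {x : A ⟶ B} {y : B ⟶ Z} {δ : T.Ext Z A}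
    (h : T.IsTriangle x y δ) {a : A ⟶ A'} (ha : classLR T N a) {x' : A' ⟶ B'} {y' : B' ⟶ Z}
    (h' : T.IsTriangle x' y' (push a δ)) :
    ∃ b : B ⟶ B', classLR T N b ∧ x ≫ b = a ≫ x' ∧ b ≫ y' = y := by
  obtain ⟨M, r, l, ⟨P, i, hr, hP⟩, ⟨D, w, hl, hD⟩, rfl⟩ := ha
  obtain ⟨B'', x'', y'', h''⟩ := exists_triangle (push r δ)
  obtain ⟨b₁, h₁, h₂, h₃⟩ := H.weak.map_right x y δ r x'' y'' h h''
  obtain ⟨b₂, h₄, h₅, h₆⟩ := H.weak.map_right x'' y'' _ l x' y' h'' (by rwa [← push_comp])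
  obtain ⟨w', h₇, -⟩ := H.weak.sq_inflation ⟨_, h₆⟩ hl
  refine ⟨b₁ ≫ b₂, H.classLR_comp
    (H.classLR_of_classR ⟨P, _, H.extriangulated.sq_deflation' ⟨_, h₃⟩ hr, hP⟩)
    (H.classLR_of_classL ⟨D, w', h₇, hD⟩), ?_, ?_⟩
  · rw [reassoc_of% h₁, h₄, Category.assoc]
  · rw [Category.assoc, h₅, h₂]

lemma exists_mid_of_pull {A B Z B' Z' : C} {x : A ⟶ B} {y : B ⟶ Z} {δ : T.Ext Z A}
    (h : T.IsTriangle x y δ) {c : Z' ⟶ Z} (hc : classLR T N c) {x' : A ⟶ B'} {y' : B' ⟶ Z'}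
    (h' : T.IsTriangle x' y' (pull c δ)) :
    ∃ b : B' ⟶ B, classLR T N b ∧ x' ≫ b = x ∧ b ≫ y = y' ≫ c := by
  obtain ⟨b, h₁, h₂, h₃⟩ := H.op.exists_mid_of_push (op_isTriangle.2 h) ((op_classLR c.op).2 hc)
    (op_isTriangle.2 h')
  exact ⟨b.unop, (op_classLR b).1 h₁, congrArg Quiver.Hom.unop h₃, congrArg Quiver.Hom.unop h₂⟩

lemma condM3 : CondM3 T (classLR T N) := by
  intro A B Z A' B' Z' x y δ x' y' δ' a c h h' hac ha hc
  obtain ⟨B'', x'', y'', h''⟩ := exists_triangle (push a δ)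
  obtain ⟨b₁, h₁, h₂, h₃⟩ := H.exists_mid_of_push h ha h''
  obtain ⟨b₂, h₄, h₅, h₆⟩ := H.exists_mid_of_pull h' hc (hac ▸ h'')
  exact ⟨b₁ ≫ b₂, H.classLR_comp h₁ h₄, by rw [reassoc_of% h₂, h₅],
    by rw [Category.assoc, h₆, reassoc_of% h₃]⟩

lemma exists_swap_deflation {A B Z : C} {l : A ⟶ B} (hl : classL T N l) {y : B ⟶ Z}
    (hy : T.deflations y) :
    ∃ (Y : C) (y' : A ⟶ Y) (l' : Y ⟶ Z), T.deflations y' ∧ classL T N l' ∧ y' ≫ l' = l ≫ y := by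
  obtain ⟨K, k, hy⟩ := hy
  obtain ⟨Y, r', x', D', q', h₁, h₂, h₃, -⟩ :=
    H.op.exists_swap_inflation (op_isConflation.2 hy) ((op_classR l.op).2 hl)
  exact ⟨Y.unop, x'.unop, r'.unop, ⟨_, _, op_isConflation.1 h₂⟩, (op_classR _).1 h₁,
    congrArg Quiver.Hom.unop h₃⟩

/-- The part of `S` between two inflations is `r ≫ l`: `r` moves left past the first inflation and
`l` is itself an inflation. For deflations, `l` moves right instead. -/
lemma condM4 : CondM4 T (classLR T N) where
  inf := ⟨by
    rintro X Y Z _ _ ⟨A, B, s, x, t, hs, ⟨D, q, hx⟩, ht, rfl⟩ ⟨A', B', s', x', t', hs', hx', ht', rfl⟩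
    obtain ⟨M, r, l, hr, ⟨_, _, hl, -⟩, h⟩ := H.classLR_comp ht hs'
    obtain ⟨Y', r', x'', D', q', h₁, h₂, h₃, -⟩ := H.exists_swap_inflation hx hr
    refine ⟨_, _, s ≫ r', x'' ≫ l ≫ x', t', H.classLR_comp hs (H.classLR_of_classR h₁),
      H.extriangulated.inflations_comp.comp_mem _ _ ⟨_, _, h₂⟩
        (H.extriangulated.inflations_comp.comp_mem _ _ ⟨_, _, hl⟩ hx'), ht', ?_⟩
    simp only [Category.assoc, reassoc_of% h₃, reassoc_of% h]⟩
  defl := ⟨by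
    rintro X Y Z _ _ ⟨A, B, s, x, t, hs, hx, ht, rfl⟩ ⟨A', B', s', x', t', hs', hx', ht', rfl⟩
    obtain ⟨M, r, l, ⟨_, _, hr, -⟩, hl, h⟩ := H.classLR_comp ht hs'
    obtain ⟨Y', x'', l', h₁, h₂, h₃⟩ := H.exists_swap_deflation hl hx'
    refine ⟨_, _, s, x ≫ r ≫ x'', l' ≫ t', hs, H.extriangulated.deflations_comp.comp_mem _ _ hx
      (H.extriangulated.deflations_comp.comp_mem _ _ ⟨_, _, hr⟩ h₁),
      H.classLR_comp (H.classLR_of_classL h₂) ht', ?_⟩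
    simp only [Category.assoc, reassoc_of% h₃, reassoc_of% h]⟩

lemma nullObjects_eq : nullObjects (classLR T N) = N := by
  ext X
  constructor
  · rintro ⟨⟨M, r, l, ⟨P, i, hr, hP⟩, ⟨D, w, hl, hD⟩, -⟩, -⟩
    exact H.percolating.mid _ _ hr hP (H.percolating.left _ _ hl H.percolating.zero hD)
  · intro hX
    exact ⟨H.classLR_of_classR ⟨X, 𝟙 X, H.weak.conf_of_isIso_left _, hX⟩,
      H.classLR_of_classL ⟨X, 𝟙 X, H.weak.conf_of_isIso_right _, hX⟩⟩

lemma ideal_add {X Y : C} {f g : X ⟶ Y} (hf : ideal N f) (hg : ideal N g) : ideal N (f + g) := by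
  obtain ⟨M, hM, i, j, rfl⟩ := hf
  obtain ⟨M', hM', i', j', rfl⟩ := hg
  exact ⟨M ⊞ M', H.percolating.biprod _ _ hM hM', biprod.lift i i', biprod.desc j j', by simp⟩

lemma congruence : Congruence (idealRel N) where
  comp_left := by
    rintro X Y Z f g g' ⟨M, hM, i, j, h⟩
    exact ⟨M, hM, f ≫ i, j, by simp [h]⟩
  comp_right := by
    rintro X Y Z f f' g ⟨M, hM, i, j, h⟩
    exact ⟨M, hM, i, j ≫ g, by simp [reassoc_of% h]⟩
  equivalence :=
    { refl := fun f => ⟨0, H.percolating.zero, 0, 0, by simp⟩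
      symm := by
        rintro f g ⟨M, hM, i, j, h⟩
        exact ⟨M, hM, i, -j, by simp [h]⟩
      trans := by
        intro f g k h h'
        have := H.ideal_add h h'
        rwa [sub_add_sub_cancel] at this }

lemma idealQuotient_map_eq_iff {X Y : C} (f g : X ⟶ Y) :
    (idealQuotient N).map f = (idealQuotient N).map g ↔ ideal N (f - g) := by
  have := H.congruence
  exact CategoryTheory.Quotient.functor_map_eq_iff _ f g

/-- Isomorphisms modulo `[N]` belong to `S`. -/
lemma classLR_of_ideal {X Y : C} (f : X ⟶ Y) (g : Y ⟶ X) (hfg : ideal N (f ≫ g - 𝟙 X))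
    (hgf : ideal N (g ≫ f - 𝟙 Y)) : classLR T N f := by
  obtain ⟨M, hM, i, j, h⟩ := hfg
  obtain ⟨M₁, hM₁, i₁, j₁, h₁⟩ := hgf
  -- As `f ≫ g - 𝟙 = i ≫ j`, adjoining `i` makes `f` a split monomorphism into `Y ⊞ M`, still
  -- invertible modulo `[N]`; its complement puts it in `L`, and the projection `Y ⊞ M ⟶ Y` is in
  -- `R`.
  obtain ⟨M', hM', k, q, h₂, h₃, h₄, h₅⟩ := H.exists_complement (biprod.lift f i)
    (biprod.desc g (-j)) (by simp [h]) (by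
      have e : 𝟙 (Y ⊞ M) - biprod.desc g (-j) ≫ biprod.lift f i =
          (biprod.fst ≫ i₁) ≫ ((-j₁) ≫ biprod.inl) +
            (biprod.snd ≫ (biprod.inr + j ≫ biprod.lift f i) +
              (biprod.fst ≫ (-(g ≫ i))) ≫ biprod.inr) := by
        apply biprod.hom_ext <;> apply biprod.hom_ext' <;> simp [reassoc_of% h₁]
      rw [e]
      exact H.ideal_add ⟨_, hM₁, _, _, rfl⟩ (H.ideal_add ⟨_, hM, _, _, rfl⟩ ⟨_, hM, _, _, rfl⟩))
  have h₆ : classL T N (biprod.lift f i) := ⟨M', q, H.weak.conf_of_split (by simp [h]) h₂ h₃ h₅, hM'⟩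
  have h₇ : classR T N (biprod.fst : Y ⊞ M ⟶ Y) := ⟨M, _, H.weak.conf_inr_fst _ _, hM⟩
  simpa using H.classLR_comp (H.classLR_of_classL h₆) (H.classLR_of_classR h₇)

/-- An isomorphism of arrows in `C/[N]` lifts to morphisms `a`, `b` that are invertible modulo
`[N]`, hence in `S`. The square commutes modulo `[N]`, and 2-out-of-3 concludes. -/
lemma inverseImage_map {N' : ObjectProperty C} (hN' : N' = N) :
    ((classLR T N).map (idealQuotient N')).inverseImage (idealQuotient N') = classLR T N := by
  subst hN'
  apply le_antisymm
  · rintro X Y f ⟨X', Y', g, hg, ⟨e⟩⟩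
    have key : ∀ {A B : C} (e : (idealQuotient N').obj A ≅ (idealQuotient N').obj B),
        ∃ (a : A ⟶ B), (idealQuotient N').map a = e.hom ∧ classLR T N' a := by
      intro A B e
      obtain ⟨a, ha⟩ := (idealQuotient N').map_surjective e.hom
      obtain ⟨b, hb⟩ := (idealQuotient N').map_surjective e.inv
      refine ⟨a, ha, H.classLR_of_ideal a b ?_ ?_⟩
      · rw [← H.idealQuotient_map_eq_iff, Functor.map_comp, ha, hb]; simp
      · rw [← H.idealQuotient_map_eq_iff, Functor.map_comp, ha, hb]; simp
    obtain ⟨a, ha, ha'⟩ := key (Arrow.leftFunc.mapIso e)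
    obtain ⟨b, hb, hb'⟩ := key (Arrow.rightFunc.mapIso e)
    have h : (idealQuotient N').map (a ≫ f) = (idealQuotient N').map (g ≫ b) := by
      rw [Functor.map_comp, Functor.map_comp, ha, hb]
      exact Arrow.w e.hom
    have := H.hasTwoOutOfThreeProperty
    exact (classLR T N').of_precomp a f ha' (H.classLR_of_ideal_sub (H.classLR_comp hg hb')
      ((H.idealQuotient_map_eq_iff _ _).1 h))
  · intro X Y f hf
    exact MorphismProperty.map_mem_map _ _ _ hf

lemma exists_classL_push_eq_zero {A D : C} (hD : N D) (ε : T.Ext D A) :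
    ∃ (A' : C) (s : A ⟶ A'), classL T N s ∧ push s ε = 0 := by
  obtain ⟨B, x, y, h⟩ := exists_triangle ε
  exact ⟨B, x, ⟨D, y, ⟨_, h⟩, hD⟩, (H.weak.isExactSeq h).push_inc⟩

lemma exists_push_eq_zero_of_classR {A Z Z' : C} (δ : T.Ext Z A) {r : Z' ⟶ Z}
    (hr : classR T N r) (h : pull r δ = 0) :
    ∃ (A' : C) (s : A ⟶ A'), classLR T N s ∧ push s δ = 0 := by
  have hr₀ := hr
  obtain ⟨P, i, hr, hP⟩ := hr
  obtain ⟨B, x, y, hB⟩ := exists_triangle δ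
  have eB := H.weak.isExactSeq hB
  -- The lift `k` of `r` along `y` would descend to a splitting if it vanished on `P`. There it
  -- factors through `A` by `f`, so it vanishes after pushing out along `m`; the descended `k'`
  -- splits `y₁` up to a map through `M` in `N`.
  obtain ⟨k, hk⟩ := (eB.exact₂ _ r).1 h
  obtain ⟨f, hf⟩ := (eB.exact₁ _ (i ≫ k)).1 (by
    rw [Category.assoc, hk, H.weak.conf_comp_eq_zero hr])
  obtain ⟨A₁, m, hm, hfm⟩ := H.exists_classR_comp_eq_zero hP f
  obtain ⟨B₁, x₁, y₁, hB₁⟩ := exists_triangle (push m δ)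
  obtain ⟨b, hb₁, hb₂, -⟩ := H.weak.map_right x y _ m x₁ y₁ hB hB₁
  obtain ⟨k', hk'⟩ := H.weak.conf_desc hr (k ≫ b) (by
    rw [← Category.assoc, ← hf, Category.assoc, hb₁, reassoc_of% hfm, zero_comp])
  obtain ⟨M, hM, u, v, huv⟩ := H.p3.right r hr₀ (𝟙 Z - k' ≫ y₁) (by
    rw [Preadditive.comp_sub, reassoc_of% hk', hb₂, hk, Category.comp_id, sub_self])
  -- `push m δ` is thus pulled back from an extension of `M`, which is killed by the inflation in
  -- its own realization.
  obtain ⟨A₂, m', hm', h₂⟩ := H.exists_classL_push_eq_zero hM (pull v (push m δ))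
  refine ⟨A₂, m ≫ m', H.classLR_comp (H.classLR_of_classR hm) (H.classLR_of_classL hm'), ?_⟩
  have h₃ := congrArg (push m') (congrArg (fun φ => pull φ (push m δ)) huv)
  simp only [sub_pull, pull_comp, (H.weak.isExactSeq hB₁).pull_proj, pull_zero, sub_zero,
    pull_id] at h₃
  rw [push_comp, ← h₃, push_pull, h₂, pull_zero]

/-- An extension annihilated by pulling back along a morphism in `S` is annihilated by pushing
forward along a morphism in `S`. -/
lemma exists_push_eq_zero {A Z Z' : C} (δ : T.Ext Z A) {t : Z' ⟶ Z} (ht : classLR T N t)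
    (h : pull t δ = 0) : ∃ (A' : C) (s : A ⟶ A'), classLR T N s ∧ push s δ = 0 := by
  obtain ⟨M, r, l, hr, ⟨D, w, ⟨ζ, hl⟩, hD⟩, rfl⟩ := ht
  obtain ⟨A₁, s₁, hs₁, h₁⟩ := H.exists_push_eq_zero_of_classR (pull l δ) hr (by rwa [← pull_comp])
  -- What remains vanishes along `l`, so it comes from an extension of the cone `D`, again an object
  -- of `N`.
  obtain ⟨ε, hε⟩ := H.extriangulated.exists_pull_proj_eq hl (push s₁ δ) (by rw [← push_pull, h₁])
  obtain ⟨A₂, s₂, hs₂, h₂⟩ := H.exists_classL_push_eq_zero hD ε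
  exact ⟨A₂, s₁ ≫ s₂, H.classLR_comp hs₁ (H.classLR_of_classL hs₂),
    by rw [push_comp, ← hε, push_pull, h₂, pull_zero]⟩

/-- An extension annihilated by pushing forward along a morphism in `S` is annihilated by pulling
back along a morphism in `S`. -/
lemma exists_pull_eq_zero {A A' Z : C} (δ : T.Ext Z A) {s : A ⟶ A'} (hs : classLR T N s)
    (h : push s δ = 0) : ∃ (Z' : C) (t : Z' ⟶ Z), classLR T N t ∧ pull t δ = 0 := by
  obtain ⟨Z', t, ht, h'⟩ := H.op.exists_push_eq_zero (A := Opposite.op Z) (Z := Opposite.op A) δ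
    ((op_classLR s.op).2 hs) h
  exact ⟨Z'.unop, t.unop, (op_classLR t).1 ht, h'⟩

end IsAdmissible

lemma isAdmissible_of_condP2 (hT : T.IsExtriangulated) (hN : IsPercolating T N) (hP2 : CondP2 N)
    (hP3 : CondP3 T N) : IsAdmissible T N where
  extriangulated := hT
  percolating := hN
  p3 := hP3
  exists_complement {A B} σ ρ h₁ h₂ := by
    have hinv : IsIso ((idealQuotient N).map σ) := by
      refine ⟨(idealQuotient N).map ρ, ?_, ?_⟩
      · rw [← Functor.map_comp, h₁, CategoryTheory.Functor.map_id]
      · rw [← Functor.map_comp, ← CategoryTheory.Functor.map_id]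
        exact (CategoryTheory.Quotient.sound _ h₂).symm
    obtain ⟨M, hM, j, hj⟩ := hP2 σ ⟨⟨ρ, h₁⟩⟩ hinv
    obtain ⟨e, he⟩ : ∃ e : B ⟶ A ⊞ M, e = inv (biprod.desc σ j) := ⟨_, rfl⟩
    have h₃ : σ ≫ e = biprod.inl := by rw [he, IsIso.comp_inv_eq]; simp
    have h₄ : j ≫ e = biprod.inr := by rw [he, IsIso.comp_inv_eq]; simp
    have h₅ : (e ≫ biprod.fst) ≫ σ + (e ≫ biprod.snd) ≫ j = 𝟙 B := by
      rw [Category.assoc, Category.assoc, ← Preadditive.comp_add, ← biprod.desc_eq, he,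
        IsIso.inv_hom_id]
    -- (P2) ignores the given retraction `ρ`; subtracting `j ≫ ρ ≫ σ` moves the complement into the
    -- kernel of `ρ`.
    refine ⟨M, hM, j - j ≫ ρ ≫ σ, e ≫ biprod.snd, ?_, ?_, ?_, ?_⟩
    · simp [reassoc_of% h₃, reassoc_of% h₄]
    · simp [reassoc_of% h₃]
    · simp [h₁]
    · have h₆ := eq_sub_of_add_eq' h₅
      rw [Preadditive.comp_sub, ← Category.assoc _ j, h₆]
      simp [reassoc_of% h₁]

end Extri

/-! ### The glued category, with extensions as morphisms, and its localization. -/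

namespace Extri
open ExtData

/-- Two copies of a category, where the extension groups are the morphisms from the first copy to
the second one. -/
inductive Glue {C : Type u} [Category.{v} C] [Preadditive C] (T : ExtData.{u, v, w} C) : Type u
  | src : C → Glue T
  | tgt : C → Glue T

namespace Glue

variable {C : Type u} [Category.{v} C] [Preadditive C] {T : ExtData.{u, v, w} C}

/-- The morphisms between objects of the two copies. -/
def Hom : Glue T → Glue T → Type (max v w)
  | src X, src Y => ULift.{w} (X ⟶ Y)
  | src Z, tgt A => ULift.{v} (T.Ext Z A)
  | tgt _, src _ => PUnit
  | tgt X, tgt Y => ULift.{w} (X ⟶ Y)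

instance : ∀ X Y : Glue T, AddCommGroup (Hom X Y)
  | src X, src Y => inferInstanceAs (AddCommGroup (ULift.{w} (X ⟶ Y)))
  | src Z, tgt A => inferInstanceAs (AddCommGroup (ULift.{v} (T.Ext Z A)))
  | tgt _, src _ => inferInstanceAs (AddCommGroup PUnit)
  | tgt X, tgt Y => inferInstanceAs (AddCommGroup (ULift.{w} (X ⟶ Y)))

/-- The identity morphisms. -/
def id : ∀ X : Glue T, Hom X X
  | src X => ⟨𝟙 X⟩
  | tgt X => ⟨𝟙 X⟩

/-- The composition of morphisms. -/
def comp : ∀ {X Y Z : Glue T}, Hom X Y → Hom Y Z → Hom X Z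
  | src _, src _, src _, f, g => ⟨f.down ≫ g.down⟩
  | src _, src _, tgt _, f, g => ⟨pull f.down g.down⟩
  | src _, tgt _, tgt _, f, g => ⟨push g.down f.down⟩
  | src _, tgt _, src _, _, _ => 0
  | tgt _, _, src _, _, _ => 0
  | tgt _, src _, tgt _, _, _ => 0
  | tgt _, tgt _, tgt _, f, g => ⟨f.down ≫ g.down⟩

/-- Associativity encodes the functoriality of `E` in each variable and `push_pull`; there are only
zero morphisms from the second copy to the first. -/
instance : Category.{max v w} (Glue T) where
  Hom := Hom
  id := id
  comp := comp
  id_comp := by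
    rintro (X | X) (Y | Y) f
    · exact ULift.ext _ _ (Category.id_comp _)
    · exact ULift.ext _ _ (pull_id _)
    · rfl
    · exact ULift.ext _ _ (Category.id_comp _)
  comp_id := by
    rintro (X | X) (Y | Y) f
    · exact ULift.ext _ _ (Category.comp_id _)
    · exact ULift.ext _ _ (push_id _)
    · rfl
    · exact ULift.ext _ _ (Category.comp_id _)
  assoc := by
    rintro (X | X) (Y | Y) (Z | Z) (W | W) f g h
    · exact ULift.ext _ _ (Category.assoc _ _ _)
    · exact ULift.ext _ _ (pull_comp _ _ _)
    · exact ULift.ext _ _ comp_zero.symm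
    · exact ULift.ext _ _ (push_pull _ _ _)
    · exact ULift.ext _ _ zero_comp
    · exact ULift.ext _ _ ((zero_pull _).trans (zero_push _).symm)
    · exact ULift.ext _ _ rfl
    · exact ULift.ext _ _ (push_comp _ _ _).symm
    · rfl
    · rfl
    · rfl
    · exact ULift.ext _ _ zero_comp
    · rfl
    · exact ULift.ext _ _ (comp_zero.symm)
    · rfl
    · exact ULift.ext _ _ (Category.assoc _ _ _)

instance : Preadditive (Glue T) where
  homGroup := inferInstanceAs (∀ X Y : Glue T, AddCommGroup (Hom X Y))
  add_comp := by
    rintro (X | X) (Y | Y) (Z | Z) f f' g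
    · exact ULift.ext _ _ (Preadditive.add_comp _ _ _ _ _ _)
    · exact ULift.ext _ _ (add_pull _ _ _)
    · exact (add_zero (0 : Hom (src X) (src Z))).symm
    · exact ULift.ext _ _ (push_add _ _ _)
    · rfl
    · exact (add_zero (0 : Hom (tgt X) (tgt Z))).symm
    · rfl
    · exact ULift.ext _ _ (Preadditive.add_comp _ _ _ _ _ _)
  comp_add := by
    rintro (X | X) (Y | Y) (Z | Z) f g g'
    · exact ULift.ext _ _ (Preadditive.comp_add _ _ _ _ _ _)
    · exact ULift.ext _ _ (pull_add _ _ _)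
    · exact (add_zero (0 : Hom (src X) (src Z))).symm
    · exact ULift.ext _ _ (add_push _ _ _)
    · rfl
    · exact (add_zero (0 : Hom (tgt X) (tgt Z))).symm
    · rfl
    · exact ULift.ext _ _ (Preadditive.comp_add _ _ _ _ _ _)

variable (T) in
/-- The inclusion of the first copy. -/
def srcF : C ⥤ Glue T where
  obj := src
  map f := ⟨f⟩
  map_id _ := rfl
  map_comp _ _ := rfl

variable (T) in
/-- The inclusion of the second copy. -/
def tgtF : C ⥤ Glue T where
  obj := tgt
  map f := ⟨f⟩
  map_id _ := rfl
  map_comp _ _ := rfl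

instance : (srcF T).Additive where
  map_add := rfl

instance : (tgtF T).Additive where
  map_add := rfl

/-- An extension as a morphism between the two copies. -/
def ofExt {Z A : C} (δ : T.Ext Z A) : (srcF T).obj Z ⟶ (tgtF T).obj A := ⟨δ⟩

lemma ofExt_add {Z A : C} (δ δ' : T.Ext Z A) : ofExt (δ + δ') = ofExt δ + ofExt δ' := rfl

lemma ofExt_eq_zero {Z A : C} {δ : T.Ext Z A} (h : ofExt δ = 0) : δ = 0 :=
  congrArg ULift.down h

lemma map_comp_ofExt {Z Z' A : C} (c : Z' ⟶ Z) (δ : T.Ext Z A) :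
    (srcF T).map c ≫ ofExt δ = ofExt (pull c δ) := rfl

lemma ofExt_comp_map {Z A A' : C} (δ : T.Ext Z A) (a : A ⟶ A') :
    ofExt δ ≫ (tgtF T).map a = ofExt (push a δ) := rfl

variable (T) (S : MorphismProperty C)

/-- The morphisms in `S` between objects of the second copy, and the isomorphisms of the first
copy. -/
def tgtClass : MorphismProperty (Glue T)
  | src _, src _, f => IsIso (C := C) f.down
  | tgt _, tgt _, f => S f.down
  | _, _, _ => False

/-- The morphisms in `S` between objects of the first copy, and the isomorphisms of the second
copy. -/
def srcClass : MorphismProperty (Glue T)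
  | src _, src _, f => S f.down
  | tgt _, tgt _, f => IsIso (C := C) f.down
  | _, _, _ => False

variable {T S}

lemma isIso_of_tgtClass {X Y : C} (f : src X ⟶ src Y) (hf : tgtClass T S f) : IsIso f := by
  obtain ⟨g, h₁, h₂⟩ := hf
  exact ⟨⟨g⟩, ULift.ext _ _ h₁, ULift.ext _ _ h₂⟩

lemma isIso_of_srcClass {X Y : C} (f : tgt X ⟶ tgt Y) (hf : srcClass T S f) : IsIso f := by
  obtain ⟨g, h₁, h₂⟩ := hf
  exact ⟨⟨g⟩, ULift.ext _ _ h₁, ULift.ext _ _ h₂⟩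

section

variable [S.IsMultiplicative]

lemma tgtClass_id (X : Glue T) : tgtClass T S (𝟙 X) := by
  rcases X with X | X
  · exact inferInstanceAs (IsIso (𝟙 X))
  · exact S.id_mem X

lemma srcClass_id (X : Glue T) : srcClass T S (𝟙 X) := by
  rcases X with X | X
  · exact S.id_mem X
  · exact inferInstanceAs (IsIso (𝟙 X))

lemma tgtClass_comp {X Y Z : Glue T} (f : X ⟶ Y) (g : Y ⟶ Z) (hf : tgtClass T S f)
    (hg : tgtClass T S g) : tgtClass T S (f ≫ g) := by
  rcases X with X | X <;> rcases Y with Y | Y <;> rcases Z with Z | Z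
  · exact @IsIso.comp_isIso C _ _ _ _ f.down g.down hf hg
  · exact hg.elim
  · exact hf.elim
  · exact hf.elim
  · exact hf.elim
  · exact hf.elim
  · exact hg.elim
  · exact S.comp_mem f.down g.down hf hg

lemma srcClass_comp {X Y Z : Glue T} (f : X ⟶ Y) (g : Y ⟶ Z) (hf : srcClass T S f)
    (hg : srcClass T S g) : srcClass T S (f ≫ g) := by
  rcases X with X | X <;> rcases Y with Y | Y <;> rcases Z with Z | Z
  · exact S.comp_mem f.down g.down hf hg
  · exact hg.elim
  · exact hf.elim
  · exact hf.elim
  · exact hf.elim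
  · exact hf.elim
  · exact hg.elim
  · exact @IsIso.comp_isIso C _ _ _ _ f.down g.down hf hg

variable (T S) in
/-- The class of morphisms of the localization at `tgtClass` given by `srcClass`. -/
def srcClass' : MorphismProperty (tgtClass T S).Localization := fun X Y f =>
  ∃ f' : (Localization.Construction.objEquiv _).symm X ⟶
    (Localization.Construction.objEquiv _).symm Y,
    srcClass T S f' ∧ (tgtClass T S).Q.map f' = f

lemma srcClass'_id (X : (tgtClass T S).Localization) : srcClass' T S (𝟙 X) :=
  ⟨𝟙 _, srcClass_id _, CategoryTheory.Functor.map_id _ _⟩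

end

/-- Between first copies the denominators are invertible, and nothing nonzero leads from the second
copy to the first, so the conditions reduce to those for `S` in `C`. -/
instance [S.HasLeftCalculusOfFractions] : (tgtClass T S).HasLeftCalculusOfFractions where
  id_mem := tgtClass_id
  comp_mem := tgtClass_comp
  exists_leftFraction := by
    rintro X Y ⟨s, hs, f⟩
    rename_i X'
    rcases X with X | X <;> rcases X' with X' | X'
    · have := isIso_of_tgtClass s hs
      exact ⟨⟨inv s ≫ f, 𝟙 _, tgtClass_id _⟩, by simp⟩
    · exact hs.elim
    · exact hs.elim
    · rcases Y with Y | Y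
      · exact ⟨⟨0, 𝟙 _, tgtClass_id _⟩, rfl⟩
      · obtain ⟨φ, hφ⟩ := MorphismProperty.RightFraction.exists_leftFraction (W := S)
          ⟨s.down, hs, f.down⟩
        exact ⟨⟨(tgtF T).map φ.f, (tgtF T).map φ.s, φ.hs⟩, ULift.ext _ _ hφ⟩
  ext := by
    rintro X' X Y f₁ f₂ s hs h
    rcases X with X | X <;> rcases X' with X' | X'
    · have := isIso_of_tgtClass s hs
      exact ⟨_, 𝟙 _, tgtClass_id _, by rw [(cancel_epi s).1 h]⟩
    · exact hs.elim
    · exact hs.elim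
    · rcases Y with Y | Y
      · exact ⟨_, 𝟙 _, tgtClass_id _, rfl⟩
      · obtain ⟨Y', t, ht, h'⟩ := MorphismProperty.HasLeftCalculusOfFractions.ext (W := S)
          f₁.down f₂.down s.down hs (congrArg ULift.down h)
        exact ⟨_, (tgtF T).map t, ht, ULift.ext _ _ h'⟩

variable [S.HasLeftCalculusOfFractions] [S.HasRightCalculusOfFractions]

-- Inverting `tgtClass` does not change the morphisms into the first copy, because a denominator
-- starting there is already invertible. This fact lets the right Ore conditions for `srcClass'` be
-- checked in `C`.
omit [S.HasRightCalculusOfFractions] in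
lemma exists_map_eq_of_src {X : Glue T} {W : C}
    (f : (tgtClass T S).Q.obj X ⟶ (tgtClass T S).Q.obj (src W)) :
    ∃ f' : X ⟶ src W, (tgtClass T S).Q.map f' = f := by
  obtain ⟨⟨f', s, hs⟩, rfl⟩ := Localization.exists_leftFraction (tgtClass T S).Q (tgtClass T S) f
  rename_i Y
  rcases Y with Y | Y
  · have := isIso_of_tgtClass s hs
    refine ⟨f' ≫ inv s, ?_⟩
    rw [← cancel_mono ((tgtClass T S).Q.map s), MorphismProperty.LeftFraction.map_comp_map_s,
      ← Functor.map_comp, Category.assoc, IsIso.inv_hom_id, Category.comp_id]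
  · exact hs.elim

omit [S.HasRightCalculusOfFractions] in
lemma map_injective_of_src {X : Glue T} {W : C} {f g : X ⟶ src W}
    (h : (tgtClass T S).Q.map f = (tgtClass T S).Q.map g) : f = g := by
  obtain ⟨Y, s, hs, h'⟩ := (MorphismProperty.map_eq_iff_postcomp _ (tgtClass T S) f g).1 h
  rcases Y with Y | Y
  · have := isIso_of_tgtClass s hs
    exact (cancel_mono s).1 h'
  · exact hs.elim

lemma exists_precomp_eq {X Y Y' : Glue T}
    (f : (tgtClass T S).Q.obj X ⟶ (tgtClass T S).Q.obj Y') (s : Y ⟶ Y') (hs : srcClass T S s) :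
    ∃ (X' : Glue T) (t : X' ⟶ X) (g : (tgtClass T S).Q.obj X' ⟶ (tgtClass T S).Q.obj Y),
      srcClass T S t ∧ (tgtClass T S).Q.map t ≫ f = g ≫ (tgtClass T S).Q.map s := by
  rcases Y with Y | Y <;> rcases Y' with Y' | Y'
  · obtain ⟨f, rfl⟩ := exists_map_eq_of_src f
    rcases X with X | X
    · obtain ⟨φ, hφ⟩ := MorphismProperty.LeftFraction.exists_rightFraction (W := S)
        ⟨f.down, s.down, hs⟩
      have h : (show src φ.X' ⟶ src X from (srcF T).map φ.s) ≫ f =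
        (show src φ.X' ⟶ src Y from (srcF T).map φ.f) ≫ s := ULift.ext _ _ hφ
      refine ⟨src φ.X', (srcF T).map φ.s, (tgtClass T S).Q.map ((srcF T).map φ.f), φ.hs, ?_⟩
      exact ((tgtClass T S).Q.map_comp _ _).symm.trans
        ((congrArg (tgtClass T S).Q.map h).trans ((tgtClass T S).Q.map_comp _ _))
    · refine ⟨_, 𝟙 _, (tgtClass T S).Q.map 0, srcClass_id _, ?_⟩
      rw [← Functor.map_comp, ← Functor.map_comp]
      rfl
  · exact hs.elim
  · exact hs.elim
  · have := isIso_of_srcClass s hs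
    exact ⟨_, 𝟙 _, f ≫ inv ((tgtClass T S).Q.map s), srcClass_id _, by simp⟩

lemma exists_precomp_eq_precomp {X Y Y' : Glue T}
    (f₁ f₂ : (tgtClass T S).Q.obj X ⟶ (tgtClass T S).Q.obj Y) (s : Y ⟶ Y')
    (hs : srcClass T S s) (h : f₁ ≫ (tgtClass T S).Q.map s = f₂ ≫ (tgtClass T S).Q.map s) :
    ∃ (X' : Glue T) (t : X' ⟶ X),
      srcClass T S t ∧ (tgtClass T S).Q.map t ≫ f₁ = (tgtClass T S).Q.map t ≫ f₂ := by
  rcases Y with Y | Y <;> rcases Y' with Y' | Y'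
  · obtain ⟨f₁, rfl⟩ := exists_map_eq_of_src f₁
    obtain ⟨f₂, rfl⟩ := exists_map_eq_of_src f₂
    rw [← Functor.map_comp, ← Functor.map_comp] at h
    have h' := map_injective_of_src h
    rcases X with X | X
    · obtain ⟨X', t, ht, h''⟩ := MorphismProperty.HasRightCalculusOfFractions.ext (W := S)
        f₁.down f₂.down s.down hs (congrArg ULift.down h')
      have h₃ : (show src X' ⟶ src X from (srcF T).map t) ≫ f₁ =
        (show src X' ⟶ src X from (srcF T).map t) ≫ f₂ := ULift.ext _ _ h''
      refine ⟨src X', (srcF T).map t, ht, ?_⟩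
      exact ((tgtClass T S).Q.map_comp _ _).symm.trans
        ((congrArg (tgtClass T S).Q.map h₃).trans ((tgtClass T S).Q.map_comp _ _))
    · exact ⟨_, 𝟙 _, srcClass_id _, rfl⟩
  · exact hs.elim
  · exact hs.elim
  · have := isIso_of_srcClass s hs
    exact ⟨_, 𝟙 _, srcClass_id _, by rw [(cancel_mono ((tgtClass T S).Q.map s)).1 h]⟩

instance : (srcClass' T S).HasRightCalculusOfFractions where
  id_mem := srcClass'_id
  comp_mem := by
    rintro _ _ _ _ _ ⟨f, hf, rfl⟩ ⟨g, hg, rfl⟩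
    exact ⟨f ≫ g, srcClass_comp f g hf hg, Functor.map_comp _ _ _⟩
  exists_rightFraction := by
    rintro X Y ⟨f, s, s', hs, rfl⟩
    obtain ⟨X', t, g, ht, h⟩ := exists_precomp_eq f s' hs
    exact ⟨⟨_, ⟨t, ht, rfl⟩, g⟩, h⟩
  ext := by
    rintro X Y Y' f₁ f₂ _ ⟨s, hs, rfl⟩ h
    obtain ⟨X', t, ht, h'⟩ := exists_precomp_eq_precomp f₁ f₂ s hs h
    exact ⟨_, (tgtClass T S).Q.map t, ⟨t, ht, rfl⟩, h'⟩

variable (T S)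

/-- The localization of the glued category at `tgtClass` and `srcClass`. -/
abbrev Loc : Type _ := ((srcClass' T S).op.Localization)ᵒᵖ

/-- The localization functor. -/
noncomputable def locF : Glue T ⥤ Loc T S := (tgtClass T S).Q ⋙ (srcClass' T S).op.Q.rightOp

instance : (locF T S).Additive := inferInstanceAs (((tgtClass T S).Q ⋙ (srcClass' T S).op.Q.rightOp).Additive)

omit [S.HasLeftCalculusOfFractions] [S.HasRightCalculusOfFractions] in
lemma isInvertedBy_srcF : S.IsInvertedBy (srcF T ⋙ locF T S) := by
  intro X Y f hf
  have : (srcClass' T S).op ((tgtClass T S).Q.map ((srcF T).map f)).op := ⟨(srcF T).map f, hf, rfl⟩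
  have := Localization.inverts (srcClass' T S).op.Q _ _ this
  exact inferInstanceAs (IsIso (((srcClass' T S).op.Q.map ((tgtClass T S).Q.map ((srcF T).map f)).op).op))

omit [S.HasLeftCalculusOfFractions] [S.HasRightCalculusOfFractions] in
lemma isInvertedBy_tgtF : S.IsInvertedBy (tgtF T ⋙ locF T S) := by
  intro X Y f hf
  have : IsIso ((tgtClass T S).Q.map ((tgtF T).map f)) :=
    Localization.inverts (tgtClass T S).Q (tgtClass T S) _ hf
  exact inferInstanceAs (IsIso (((srcClass' T S).op.Q.map ((tgtClass T S).Q.map ((tgtF T).map f)).op).op))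

variable {T S}

lemma exists_rightOp_map_eq {X Y : Glue T} (ε : (locF T S).obj X ⟶ (locF T S).obj Y) :
    ∃ (W : Glue T) (t : W ⟶ X) (g : (tgtClass T S).Q.obj W ⟶ (tgtClass T S).Q.obj Y),
      srcClass T S t ∧ (locF T S).map t ≫ ε = (srcClass' T S).op.Q.rightOp.map g := by
  obtain ⟨⟨g, t, t', ht, h⟩, rfl⟩ : ∃ φ : (srcClass' T S).op.LeftFraction _ _, (φ.map _ _).op = ε :=
    (Localization.exists_leftFraction (srcClass' T S).op.Q (srcClass' T S).op ε.unop).imp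
      fun φ hφ => congrArg Quiver.Hom.op hφ.symm
  refine ⟨_, t', g.unop, ht, Quiver.Hom.unop_inj ?_⟩
  have h' : ((tgtClass T S).Q.map t').op = t := congrArg Quiver.Hom.op h
  subst h'
  exact MorphismProperty.LeftFraction.map_comp_map_s _ _ (Localization.inverts _ _)

/-- The second localization is undone by a denominator at the source and the first one by a
denominator at the target. -/
lemma exists_locF_map_eq {Z A : C}
    (ε : (locF T S).obj ((srcF T).obj Z) ⟶ (locF T S).obj ((tgtF T).obj A)) :
    ∃ (Z₁ A₁ : C) (t : Z₁ ⟶ Z) (s : A ⟶ A₁) (δ : T.Ext Z₁ A₁), S t ∧ S s ∧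
      ((locF T S).map ((srcF T).map t) ≫ ε) ≫ (locF T S).map ((tgtF T).map s) =
        (locF T S).map (ofExt δ) := by
  obtain ⟨Z₁ | Z₁, t, g, ht, h⟩ := exists_rightOp_map_eq ε
  · obtain ⟨⟨f, s, hs⟩, rfl⟩ :=
      Localization.exists_leftFraction (tgtClass T S).Q (tgtClass T S) g
    rename_i A₁
    rcases A₁ with A₁ | A₁
    · exact hs.elim
    · refine ⟨Z₁, A₁, t.down, s.down, f.down, ht, hs, ?_⟩
      refine (congrArg (fun k => k ≫ (locF T S).map s) h).trans ?_
      refine ((srcClass' T S).op.Q.rightOp.map_comp _ _).symm.trans ?_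
      exact congrArg _ (MorphismProperty.LeftFraction.map_comp_map_s _ _ _)
  · exact ht.elim

lemma exists_of_locF_map_eq_zero {Z A : C} (δ : T.Ext Z A) (h : (locF T S).map (ofExt δ) = 0) :
    ∃ (Z₁ A₁ : C) (t : Z₁ ⟶ Z) (s : A ⟶ A₁), S t ∧ S s ∧ push s (pull t δ) = 0 := by
  have h₁ : (srcClass' T S).op.Q.map ((tgtClass T S).Q.map (ofExt δ)).op =
      (srcClass' T S).op.Q.map 0 := by
    rw [Functor.map_zero]
    exact congrArg Quiver.Hom.unop h
  obtain ⟨Z₁, t, ⟨t', ht, h₂⟩, h₃⟩ :=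
    (MorphismProperty.map_eq_iff_postcomp _ (srcClass' T S).op _ _).1 h₁
  have h₄ : (tgtClass T S).Q.map t' ≫ (tgtClass T S).Q.map (ofExt δ) = 0 := by
    rw [h₂]
    exact congrArg Quiver.Hom.unop (h₃.trans zero_comp)
  obtain ⟨⟨Z₁⟩⟩ := Z₁
  obtain ⟨A₁, s, hs, h₅⟩ := (MorphismProperty.map_eq_iff_postcomp (tgtClass T S).Q (tgtClass T S)
    (t' ≫ ofExt δ) 0).1 (((tgtClass T S).Q.map_comp _ _).trans
      (h₄.trans ((tgtClass T S).Q.map_zero _ _).symm))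
  rcases Z₁ with Z₁ | Z₁
  · rcases A₁ with A₁ | A₁
    · exact hs.elim
    · exact ⟨Z₁, A₁, t'.down, s.down, ht, hs, ofExt_eq_zero (h₅.trans zero_comp)⟩
  · exact ht.elim

end Glue

/-! ### Extension groups of the localization. -/

/-- Extension groups for the localization, without a realization: all elements are given by
fractions, and the extensions which vanish are annihilated by morphisms in `S`. -/
structure LocalizedExt {C : Type u} [Category.{v} C] [Preadditive C] (T : ExtData.{u, v, w} C)
    (S : MorphismProperty C) [Preadditive S.Localization] where
  ext : ExtData.{u, max u v, max u v w} S.Localization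
  μ : ∀ Z A : C, T.Ext Z A →+ ext.Ext (S.Q.obj Z) (S.Q.obj A)
  μ_push : ∀ {Z A A' : C} (a : A ⟶ A') (δ : T.Ext Z A),
    μ Z A' (push a δ) = push (S.Q.map a) (μ Z A δ)
  μ_pull : ∀ {Z Z' A : C} (c : Z' ⟶ Z) (δ : T.Ext Z A),
    μ Z' A (pull c δ) = pull (S.Q.map c) (μ Z A δ)
  exists_fraction : ∀ {Z A : C} (ε : ext.Ext (S.Q.obj Z) (S.Q.obj A)),
    ∃ (Z₁ A₁ : C) (t : Z₁ ⟶ Z) (s : A ⟶ A₁) (δ : T.Ext Z₁ A₁), S t ∧ S s ∧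
      push (S.Q.map s) (pull (S.Q.map t) ε) = μ Z₁ A₁ δ
  eq_zero : ∀ {Z A : C} (δ : T.Ext Z A), μ Z A δ = 0 →
    ∃ (Z₁ A₁ : C) (t : Z₁ ⟶ Z) (s : A ⟶ A₁), S t ∧ S s ∧ push s (pull t δ) = 0

section

open Glue

variable {C : Type u} [Category.{v} C] [Preadditive C] (T : ExtData.{u, v, w} C)
  (S : MorphismProperty C) [S.HasLeftCalculusOfFractions] [S.HasRightCalculusOfFractions]

/-- The functor induced by the first copy. -/
noncomputable def srcLift : S.Localization ⥤ Loc T S :=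
  Localization.Construction.lift _ (isInvertedBy_srcF T S)

/-- The functor induced by the second copy. -/
noncomputable def tgtLift : S.Localization ⥤ Loc T S :=
  Localization.Construction.lift _ (isInvertedBy_tgtF T S)

omit [S.HasLeftCalculusOfFractions] [S.HasRightCalculusOfFractions] in
lemma srcLift_map {X Y : C} (f : X ⟶ Y) :
    (srcLift T S).map (S.Q.map f) = (locF T S).map ((srcF T).map f) := by
  exact (Functor.congr_hom (Localization.Construction.fac _ (isInvertedBy_srcF T S)) f).trans
    ((Category.id_comp _).trans (Category.comp_id _))

omit [S.HasLeftCalculusOfFractions] [S.HasRightCalculusOfFractions] in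
lemma tgtLift_map {X Y : C} (f : X ⟶ Y) :
    (tgtLift T S).map (S.Q.map f) = (locF T S).map ((tgtF T).map f) := by
  exact (Functor.congr_hom (Localization.Construction.fac _ (isInvertedBy_tgtF T S)) f).trans
    ((Category.id_comp _).trans (Category.comp_id _))

instance : (srcLift T S).Additive := by
  rw [Localization.functor_additive_iff S.Q S]
  have : S.Q ⋙ srcLift T S = srcF T ⋙ locF T S := Localization.Construction.fac _ _
  rw [this]
  infer_instance

instance : (tgtLift T S).Additive := by
  rw [Localization.functor_additive_iff S.Q S]
  have : S.Q ⋙ tgtLift T S = tgtF T ⋙ locF T S := Localization.Construction.fac _ _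
  rw [this]
  infer_instance

/-- The extension groups of the localization. -/
noncomputable def localizedExt : LocalizedExt T S where
  ext :=
    { E := (srcLift T S).op ⋙ preadditiveCoyoneda ⋙ (Functor.whiskeringLeft _ _ _).obj (tgtLift T S)
      additive_right := fun Z => inferInstanceAs (tgtLift T S ⋙ preadditiveCoyoneda.obj (op ((srcLift T S).obj Z.unop))).Additive
      additive_left := fun A => inferInstanceAs ((srcLift T S).op ⋙ preadditiveYoneda.obj ((tgtLift T S).obj A)).Additive
      realize := fun {Z A} _ => Quotient.mk _ ⟨Z, 0, 0⟩ }
  μ Z A := AddMonoidHom.mk' (fun δ => (locF T S).map (ofExt δ)) (fun δ δ' => by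
    exact (congrArg _ (ofExt_add _ _)).trans (Functor.map_add _))
  μ_push a δ := (congrArg _ (ofExt_comp_map _ _)).symm.trans
    (((locF T S).map_comp _ _).trans (congrArg (_ ≫ ·) (tgtLift_map T S a).symm))
  μ_pull c δ := (congrArg _ (map_comp_ofExt _ _)).symm.trans
    (((locF T S).map_comp _ _).trans (congrArg (· ≫ _) (srcLift_map T S c).symm))
  exists_fraction ε := by
    obtain ⟨Z₁, A₁, t, s, δ, ht, hs, h⟩ := exists_locF_map_eq ε
    refine ⟨Z₁, A₁, t, s, δ, ht, hs, Eq.trans ?_ h⟩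
    rw [← srcLift_map, ← tgtLift_map]
    rfl
  eq_zero δ h := exists_of_locF_map_eq_zero δ h

end

end Extri

/-! ### Systems compatible with triangles, and exactness in the localization. -/

namespace Extri
open ExtData

section

variable {C : Type u} [Category.{v} C] [Preadditive C] [HasZeroObject C] [HasBinaryBiproducts C]

/-- Multiplicative systems which are compatible with the extriangulated structure. -/
structure IsLocalizing (T : ExtData.{u, v, w} C) (S : MorphismProperty C) : Prop where
  extriangulated : T.IsExtriangulated
  left : S.HasLeftCalculusOfFractions
  right : S.HasRightCalculusOfFractions
  exists_mid_of_push : ∀ {A B Z A' B' : C} {x : A ⟶ B} {y : B ⟶ Z} {δ : T.Ext Z A},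
    T.IsTriangle x y δ → ∀ {a : A ⟶ A'}, S a → ∀ {x' : A' ⟶ B'} {y' : B' ⟶ Z},
      T.IsTriangle x' y' (push a δ) → ∃ b : B ⟶ B', S b ∧ x ≫ b = a ≫ x' ∧ b ≫ y' = y
  exists_mid_of_pull : ∀ {A B Z B' Z' : C} {x : A ⟶ B} {y : B ⟶ Z} {δ : T.Ext Z A},
    T.IsTriangle x y δ → ∀ {c : Z' ⟶ Z}, S c → ∀ {x' : A ⟶ B'} {y' : B' ⟶ Z'},
      T.IsTriangle x' y' (pull c δ) → ∃ b : B' ⟶ B, S b ∧ x' ≫ b = x ∧ b ≫ y = y' ≫ c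
  exists_push_eq_zero : ∀ {A Z Z' : C} (δ : T.Ext Z A) {t : Z' ⟶ Z}, S t → pull t δ = 0 →
    ∃ (A' : C) (s : A ⟶ A'), S s ∧ push s δ = 0
  exists_pull_eq_zero : ∀ {A A' Z : C} (δ : T.Ext Z A) {s : A ⟶ A'}, S s → push s δ = 0 →
    ∃ (Z' : C) (t : Z' ⟶ Z), S t ∧ pull t δ = 0
  condM4 : CondM4 T S

omit [Preadditive C] [HasZeroObject C] [HasBinaryBiproducts C] in
lemma op_sandwich (S : MorphismProperty C) {W : MorphismProperty C} {W' : MorphismProperty Cᵒᵖ}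
    (hW : ∀ {X Y : Cᵒᵖ} (f : X ⟶ Y), W' f ↔ W f.unop) {X Y : Cᵒᵖ} (f : X ⟶ Y) :
    sandwich S.op W' f ↔ sandwich S W f.unop :=
  ⟨fun ⟨A, B, s, x, t, hs, hx, ht, h⟩ => ⟨B.unop, A.unop, t.unop, x.unop, s.unop, ht, (hW x).1 hx,
      hs, by rw [← h]; simp⟩,
    fun ⟨A, B, s, x, t, hs, hx, ht, h⟩ => ⟨Opposite.op B, Opposite.op A, t.op, x.op, s.op, ht,
      (hW x.op).2 hx, hs, Quiver.Hom.unop_inj (by rw [← h]; simp)⟩⟩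

protected lemma IsLocalizing.op {T : ExtData.{u, v, w} C} {S : MorphismProperty C}
    (H : IsLocalizing T S) : IsLocalizing T.op S.op where
  extriangulated := H.extriangulated.op
  left := by
    have := H.right
    infer_instance
  right := by
    have := H.left
    infer_instance
  exists_mid_of_push h _ ha _ _ h' := by
    obtain ⟨b, h₁, h₂, h₃⟩ := H.exists_mid_of_pull (op_isTriangle.1 h) ha (op_isTriangle.1 h')
    exact ⟨b.op, h₁, Quiver.Hom.unop_inj h₃, Quiver.Hom.unop_inj h₂⟩
  exists_mid_of_pull h _ ha _ _ h' := by
    obtain ⟨b, h₁, h₂, h₃⟩ := H.exists_mid_of_push (op_isTriangle.1 h) ha (op_isTriangle.1 h')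
    exact ⟨b.op, h₁, Quiver.Hom.unop_inj h₃, Quiver.Hom.unop_inj h₂⟩
  exists_push_eq_zero {A Z Z'} δ t ht h := by
    obtain ⟨A', s, hs, h'⟩ := H.exists_pull_eq_zero (A := Z.unop) (Z := A.unop) δ ht h
    exact ⟨Opposite.op A', s.op, hs, h'⟩
  exists_pull_eq_zero {A A' Z} δ t ht h := by
    obtain ⟨A', s, hs, h'⟩ := H.exists_push_eq_zero (A := Z.unop) (Z := A.unop) δ ht h
    exact ⟨Opposite.op A', s.op, hs, h'⟩
  condM4 :=
    { inf := ⟨fun f g hf hg => (op_sandwich S op_inflations _).2 (H.condM4.defl.comp_mem _ _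
        ((op_sandwich S op_inflations g).1 hg) ((op_sandwich S op_inflations f).1 hf))⟩
      defl := ⟨fun f g hf hg => (op_sandwich S op_deflations _).2 (H.condM4.inf.comp_mem _ _
        ((op_sandwich S op_deflations g).1 hg) ((op_sandwich S op_deflations f).1 hf))⟩ }

lemma IsAdmissible.isLocalizing {T : ExtData.{u, v, w} C} {N : ObjectProperty C}
    (H : IsAdmissible T N) : IsLocalizing T (classLR T N) where
  extriangulated := H.extriangulated
  left := H.hasLeftCalculusOfFractions
  right := H.hasRightCalculusOfFractions
  exists_mid_of_push h _ ha _ _ h' := H.exists_mid_of_push h ha h'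
  exists_mid_of_pull h _ ha _ _ h' := H.exists_mid_of_pull h ha h'
  exists_push_eq_zero δ _ ht h := H.exists_push_eq_zero δ ht h
  exists_pull_eq_zero δ _ ht h := H.exists_pull_eq_zero δ ht h
  condM4 := H.condM4

end

/-- Exactness of a sequence is invariant under isomorphisms. -/
lemma ExtData.IsExactSeq.of_iso {D : Type u'} [Category.{v'} D] [Preadditive D]
    {T' : ExtData.{u', v', w'} D}
    {A B Z A' B' Z' : D} {x : A ⟶ B} {y : B ⟶ Z} {δ : T'.Ext Z A}
    {x' : A' ⟶ B'} {y' : B' ⟶ Z'} {δ' : T'.Ext Z' A'} (h : T'.IsExactSeq x' y' δ')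
    (a : A ≅ A') (b : B ≅ B') (c : Z ≅ Z') (hx : x ≫ b.hom = a.hom ≫ x')
    (hy : b.hom ≫ y' = y ≫ c.hom) (hδ : push a.hom δ = pull c.hom δ') : T'.IsExactSeq x y δ := by
  have hx' : x = a.hom ≫ x' ≫ b.inv := by rw [← reassoc_of% hx]; simp
  have hy' : y = b.hom ≫ y' ≫ c.inv := by rw [reassoc_of% hy]; simp
  have hδ' : δ = push a.inv (pull c.hom δ') := by rw [← hδ, push_inv_push]
  subst hx' hy' hδ'
  refine ⟨fun X f => ?_, fun X f => ?_, fun X f => ?_, fun X f => ?_⟩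
  · rw [← cancel_mono c.hom]
    simp only [Category.assoc, Iso.inv_hom_id, Category.comp_id, zero_comp]
    rw [← Category.assoc, h.exact₁]
    exact ⟨fun ⟨g, hg⟩ => ⟨g ≫ a.inv, by simp [reassoc_of% hg]⟩, fun ⟨g, hg⟩ => ⟨g ≫ a.hom, by
      simp [← hg]⟩⟩
  · rw [← push_pull, ← pull_comp]
    have : push a.inv (pull (f ≫ c.hom) δ') = 0 ↔ pull (f ≫ c.hom) δ' = 0 :=
      ⟨fun h => push_injective a.inv (h.trans (push_zero _).symm), fun h => by rw [h, push_zero]⟩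
    rw [this, h.exact₂]
    exact ⟨fun ⟨g, hg⟩ => ⟨g ≫ b.inv, by simp [reassoc_of% hg]⟩, fun ⟨g, hg⟩ => ⟨g ≫ b.hom, by
      simp [← hg]⟩⟩
  · rw [← cancel_epi a.inv]
    simp only [Category.assoc, Iso.inv_hom_id_assoc, comp_zero]
    rw [h.exact₁']
    exact ⟨fun ⟨g, hg⟩ => ⟨c.hom ≫ g, by simp [hg]⟩, fun ⟨g, hg⟩ => ⟨c.inv ≫ g, by
      simp [← hg]⟩⟩
  · rw [← push_comp, push_pull]
    have : pull c.hom (push (a.inv ≫ f) δ') = 0 ↔ push (a.inv ≫ f) δ' = 0 :=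
      ⟨fun h => pull_injective c.hom (h.trans (pull_zero _).symm), fun h => by rw [h, pull_zero]⟩
    rw [this, h.exact₂']
    exact ⟨fun ⟨g, hg⟩ => ⟨b.hom ≫ g, by simp [hg]⟩, fun ⟨g, hg⟩ => ⟨b.inv ≫ g, by
      simp [← hg]⟩⟩

section

variable {C : Type u} [Category.{v} C] [Preadditive C] [HasZeroObject C] [HasBinaryBiproducts C]
  {D : Type u'} [Category.{v'} D] [Preadditive D]
  (T : ExtData.{u, v, w} C) (T' : ExtData.{u', v', w'} D) (S : MorphismProperty C) (L : C ⥤ D)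

/-- `T'` gives the groups of extensions in the localization `L` of `C` at `S`; there is no condition
on the realization of `T'`. -/
structure IsLocalizedExt (μ : ∀ Z A : C, T.Ext Z A →+ T'.Ext (L.obj Z) (L.obj A)) : Prop where
  isLocalizing : IsLocalizing T S
  isLocalization : L.IsLocalization S
  additive : L.Additive
  surjective : Function.Surjective L.obj
  μ_push : ∀ {Z A A' : C} (a : A ⟶ A') (δ : T.Ext Z A),
    μ Z A' (push a δ) = push (L.map a) (μ Z A δ)
  μ_pull : ∀ {Z Z' A : C} (c : Z' ⟶ Z) (δ : T.Ext Z A),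
    μ Z' A (pull c δ) = pull (L.map c) (μ Z A δ)
  exists_fraction : ∀ {Z A : C} (ε : T'.Ext (L.obj Z) (L.obj A)),
    ∃ (Z₁ A₁ : C) (t : Z₁ ⟶ Z) (s : A ⟶ A₁) (δ : T.Ext Z₁ A₁), S t ∧ S s ∧
      push (L.map s) (pull (L.map t) ε) = μ Z₁ A₁ δ
  eq_zero : ∀ {Z A : C} (δ : T.Ext Z A), μ Z A δ = 0 →
    ∃ (Z₁ A₁ : C) (t : Z₁ ⟶ Z) (s : A ⟶ A₁), S t ∧ S s ∧ push s (pull t δ) = 0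

variable {T T' S L} {μ : ∀ Z A : C, T.Ext Z A →+ T'.Ext (L.obj Z) (L.obj A)}

variable (L μ) in
/-- The sequences in the localization which are isomorphic to images of triangles. -/
def LocTriangle {X Y Z : D} (x : X ⟶ Y) (y : Y ⟶ Z) (ε : T'.Ext Z X) : Prop :=
  ∃ (A B Z₀ : C) (x₀ : A ⟶ B) (y₀ : B ⟶ Z₀) (δ : T.Ext Z₀ A) (a : X ≅ L.obj A) (b : Y ≅ L.obj B)
    (c : Z ≅ L.obj Z₀), T.IsTriangle x₀ y₀ δ ∧ x ≫ b.hom = a.hom ≫ L.map x₀ ∧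
      b.hom ≫ L.map y₀ = y ≫ c.hom ∧ push a.hom ε = pull c.hom (μ _ _ δ)

namespace IsLocalizedExt

variable (H : IsLocalizedExt T T' S L μ)
include H

protected lemma op : IsLocalizedExt T.op T'.op S.op L.op (fun Z A => μ A.unop Z.unop) where
  isLocalizing := H.isLocalizing.op
  isLocalization := by
    have := H.isLocalization
    infer_instance
  additive := by
    have := H.additive
    infer_instance
  surjective := fun ⟨X⟩ => by
    obtain ⟨X', rfl⟩ := H.surjective X
    exact ⟨Opposite.op X', rfl⟩
  μ_push a δ := H.μ_pull a.unop δ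
  μ_pull a δ := H.μ_push a.unop δ
  exists_fraction {Z A} ε := by
    obtain ⟨Z₁, A₁, t, s, δ, ht, hs, h⟩ := H.exists_fraction (Z := A.unop) (A := Z.unop) ε
    exact ⟨Opposite.op A₁, Opposite.op Z₁, s.op, t.op, δ, hs, ht, (push_pull _ _ _).symm.trans h⟩
  eq_zero {Z A} δ hδ := by
    obtain ⟨Z₁, A₁, t, s, ht, hs, h⟩ := H.eq_zero (Z := A.unop) (A := Z.unop) δ hδ
    exact ⟨Opposite.op A₁, Opposite.op Z₁, s.op, t.op, hs, ht, (push_pull _ _ _).symm.trans h⟩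

lemma isIso_map {X Y : C} {f : X ⟶ Y} (hf : S f) : IsIso (L.map f) := by
  have := H.isLocalization
  exact Localization.inverts L S f hf

lemma exists_left {X Y : C} (f : L.obj X ⟶ L.obj Y) :
    ∃ (Y' : C) (g : X ⟶ Y') (s : Y ⟶ Y'), S s ∧ f ≫ L.map s = L.map g := by
  have := H.isLocalization
  have := H.isLocalizing.left
  obtain ⟨⟨g, s, hs⟩, rfl⟩ := Localization.exists_leftFraction L S f
  exact ⟨_, g, s, hs, MorphismProperty.LeftFraction.map_comp_map_s _ _ _⟩

lemma exists_right {X Y : C} (f : L.obj X ⟶ L.obj Y) :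
    ∃ (X' : C) (t : X' ⟶ X) (g : X' ⟶ Y), S t ∧ L.map t ≫ f = L.map g := by
  have := H.isLocalization
  have := H.isLocalizing.right
  obtain ⟨⟨t, ht, g⟩, rfl⟩ := Localization.exists_rightFraction L S f
  exact ⟨_, t, g, ht, MorphismProperty.RightFraction.map_s_comp_map ⟨t, ht, g⟩ L
    (Localization.inverts L S)⟩

lemma exists_precomp_eq_zero {X Y : C} {f : X ⟶ Y} (hf : L.map f = 0) :
    ∃ (X' : C) (t : X' ⟶ X), S t ∧ t ≫ f = 0 := by
  have := H.isLocalization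
  have := H.isLocalizing.right
  have := H.additive
  obtain ⟨X', t, ht, h⟩ := (MorphismProperty.map_eq_iff_precomp L S f 0).1 (by rw [hf, L.map_zero])
  exact ⟨X', t, ht, by rw [h, comp_zero]⟩

/-- `S` is not assumed saturated here. The inverse of `L.map f` is a left fraction `g`, `s`, and `f
≫ g` agrees with `s` after a further morphism of `S`. -/
lemma exists_comp_mem {X Y : C} {f : X ⟶ Y} (hf : IsIso (L.map f)) :
    ∃ (Z : C) (g : Y ⟶ Z), S (f ≫ g) := by
  have := H.isLocalization
  have := H.isLocalizing.left
  obtain ⟨Z, g, s, hs, h⟩ := H.exists_left (inv (L.map f))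
  obtain ⟨Z', t, ht, h'⟩ := (MorphismProperty.map_eq_iff_postcomp L S (f ≫ g) s).1 (by
    rw [L.map_comp, ← h, IsIso.hom_inv_id_assoc])
  exact ⟨Z', g ≫ t, by rw [← Category.assoc, h']; exact S.comp_mem _ _ hs ht⟩

lemma μ_eq_zero_of_push {Z A A' : C} {δ : T.Ext Z A} {s : A ⟶ A'} (hs : S s) (h : push s δ = 0) :
    μ Z A δ = 0 := by
  have := H.isIso_map hs
  exact push_injective (L.map s) (by rw [← H.μ_push, h, map_zero, push_zero])

lemma exists_push_eq_zero {Z A : C} {δ : T.Ext Z A} (h : μ Z A δ = 0) :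
    ∃ (A' : C) (s : A ⟶ A'), S s ∧ push s δ = 0 := by
  have := H.isLocalizing.left
  obtain ⟨Z₁, A₁, t, s, ht, hs, h'⟩ := H.eq_zero δ h
  rw [push_pull] at h'
  obtain ⟨A₂, s', hs', h''⟩ := H.isLocalizing.exists_push_eq_zero _ ht h'
  exact ⟨A₂, s ≫ s', S.comp_mem _ _ hs hs', by rw [push_comp, h'']⟩

lemma exists_pull_eq_zero {Z A : C} {δ : T.Ext Z A} (h : μ Z A δ = 0) :
    ∃ (Z' : C) (t : Z' ⟶ Z), S t ∧ pull t δ = 0 := by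
  obtain ⟨Z', t, ht, h'⟩ := H.op.exists_push_eq_zero (Z := Opposite.op A) (A := Opposite.op Z) h
  exact ⟨Z'.unop, t.unop, ht, h'⟩

lemma exists_push_eq {Z A : C} {δ δ' : T.Ext Z A} (h : μ Z A δ = μ Z A δ') :
    ∃ (A' : C) (s : A ⟶ A'), S s ∧ push s δ = push s δ' := by
  obtain ⟨A', s, hs, h'⟩ := H.exists_push_eq_zero (δ := δ - δ') (by rw [map_sub, h, sub_self])
  exact ⟨A', s, hs, by rwa [push_sub, sub_eq_zero] at h'⟩

variable {A B Z A' B' Z' : C} {x : A ⟶ B} {y : B ⟶ Z} {δ : T.Ext Z A}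
    {x' : A' ⟶ B'} {y' : B' ⟶ Z'} {δ' : T.Ext Z' A'}

/-- With `α` a left fraction `a`, `s` and `γ` a right fraction `t`, `c`, the map `β` is a zigzag of
maps between triangles of `C`; the legs over `t` and `s` lie in `S` and become invertible. -/
lemma exists_mid (h : T.IsTriangle x y δ)
    (h' : T.IsTriangle x' y' δ') (α : L.obj A ⟶ L.obj A') (γ : L.obj Z ⟶ L.obj Z')
    (hδ : push α (μ _ _ δ) = pull γ (μ _ _ δ')) :
    ∃ β : L.obj B ⟶ L.obj B', L.map x ≫ β = α ≫ L.map x' ∧ β ≫ L.map y' = L.map y ≫ γ := by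
  have := H.isLocalizing.left
  obtain ⟨A₁, a, s, hs, hα⟩ := H.exists_left α
  obtain ⟨Z₁, t, c, ht, hγ⟩ := H.exists_right γ
  -- The compatibility holds only after `μ`; enlarging the denominator `s` by `w` makes it hold in
  -- `C`.
  obtain ⟨A₁, a, s, hs, hα, hδ₁⟩ : ∃ (A₁ : C) (a : A ⟶ A₁) (s : A' ⟶ A₁), S s ∧
      α ≫ L.map s = L.map a ∧ push a (pull t δ) = push s (pull c δ') := by
    obtain ⟨A₂, w, hw, h⟩ := H.exists_push_eq (δ := push a (pull t δ)) (δ' := push s (pull c δ'))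
      (by
        rw [H.μ_push, H.μ_push, H.μ_pull, H.μ_pull, ← hα, ← hγ, push_comp, push_pull, hδ,
          push_pull, push_pull, pull_comp, push_pull (L.map s) (L.map t),
          push_pull (L.map s) γ])
    refine ⟨A₂, a ≫ w, s ≫ w, S.comp_mem _ _ hs hw, ?_, ?_⟩
    · simp [reassoc_of% hα]
    · rw [push_comp, h, push_comp]
  obtain ⟨B₁, x₁, y₁, h₁⟩ := exists_triangle (pull t δ)
  obtain ⟨B₂, x₂, y₂, h₂⟩ := exists_triangle (push a (pull t δ))
  obtain ⟨B₃, x₃, y₃, h₃⟩ := exists_triangle (pull c δ')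
  obtain ⟨b₁, hb₁, e₁, e₁'⟩ := H.isLocalizing.exists_mid_of_pull h ht h₁
  obtain ⟨b₂, e₂, e₂', -⟩ := H.isLocalizing.extriangulated.map_right _ _ _ a _ _ h₁ h₂
  obtain ⟨b₃, e₃, e₃', -⟩ := H.isLocalizing.extriangulated.map_left _ _ _ c _ _ h' h₃
  obtain ⟨b₄, hb₄, e₄, e₄'⟩ := H.isLocalizing.exists_mid_of_push h₃ hs (hδ₁ ▸ h₂)
  have := H.isIso_map hb₁
  have := H.isIso_map hb₄
  have := H.isIso_map hs
  refine ⟨inv (L.map b₁) ≫ L.map b₂ ≫ inv (L.map b₄) ≫ L.map b₃, ?_, ?_⟩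
  · rw [← e₁, L.map_comp, Category.assoc, IsIso.hom_inv_id_assoc, ← Functor.map_comp_assoc, e₂,
      L.map_comp, ← hα]
    have : L.map s ≫ L.map x₂ = L.map x₃ ≫ L.map b₄ := by rw [← L.map_comp, ← L.map_comp, e₄]
    simp only [Category.assoc]
    rw [reassoc_of% this, IsIso.hom_inv_id_assoc, ← L.map_comp, e₃]
  · simp only [Category.assoc]
    rw [← L.map_comp, e₃', ← e₄', L.map_comp, L.map_comp, Category.assoc, IsIso.inv_hom_id_assoc,
      ← Functor.map_comp_assoc, e₂', ← hγ, ← Functor.map_comp_assoc, ← e₁',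
      L.map_comp, Category.assoc, IsIso.inv_hom_id_assoc]

lemma exact₁_map (h : T.IsTriangle x y δ) (X : D) (f : X ⟶ L.obj B) :
    f ≫ L.map y = 0 ↔ ∃ g : X ⟶ L.obj A, g ≫ L.map x = f := by
  have := H.additive
  have e := H.isLocalizing.extriangulated.isExactSeq h
  constructor
  · obtain ⟨X, rfl⟩ := H.surjective X
    intro hf
    obtain ⟨X', t, g, ht, hg⟩ := H.exists_right f
    obtain ⟨X'', t', ht', h'⟩ := H.exists_precomp_eq_zero (f := g ≫ y) (by
      rw [L.map_comp, ← hg, Category.assoc, hf, comp_zero])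
    obtain ⟨k, hk⟩ := (e.exact₁ _ (t' ≫ g)).1 (by rw [Category.assoc, h'])
    have := H.isIso_map ht
    have := H.isIso_map ht'
    refine ⟨inv (L.map t) ≫ inv (L.map t') ≫ L.map k, ?_⟩
    simp only [Category.assoc]
    rw [← L.map_comp, hk, IsIso.inv_comp_eq, IsIso.inv_comp_eq, hg, L.map_comp]
  · rintro ⟨g, rfl⟩
    rw [Category.assoc, ← L.map_comp, e.comp_eq_zero, L.map_zero, comp_zero]

lemma exact₂_map (h : T.IsTriangle x y δ) (X : D) (f : X ⟶ L.obj Z) :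
    pull f (μ _ _ δ) = 0 ↔ ∃ g : X ⟶ L.obj B, g ≫ L.map y = f := by
  have e := H.isLocalizing.extriangulated.isExactSeq h
  constructor
  · obtain ⟨X, rfl⟩ := H.surjective X
    intro hf
    obtain ⟨X', t, g, ht, hg⟩ := H.exists_right f
    obtain ⟨X'', t', ht', h'⟩ := H.exists_pull_eq_zero (δ := pull g δ) (by
      rw [H.μ_pull, ← hg, pull_comp, hf, pull_zero])
    obtain ⟨k, hk⟩ := (e.exact₂ _ (t' ≫ g)).1 (by rw [pull_comp, h'])
    have := H.isIso_map ht
    have := H.isIso_map ht'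
    refine ⟨inv (L.map t) ≫ inv (L.map t') ≫ L.map k, ?_⟩
    simp only [Category.assoc]
    rw [← L.map_comp, hk, IsIso.inv_comp_eq, IsIso.inv_comp_eq, hg, L.map_comp]
  · rintro ⟨g, rfl⟩
    rw [pull_comp, ← H.μ_pull, e.pull_proj, map_zero, pull_zero]

lemma isExactSeq_map (h : T.IsTriangle x y δ) :
    T'.IsExactSeq (L.map x) (L.map y) (μ _ _ δ) := by
  refine ⟨H.exact₁_map h, H.exact₂_map h, fun X f => ?_, fun X f => ?_⟩
  · have := H.op.exact₁_map (op_isTriangle.2 h) (Opposite.op X) f.op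
    constructor
    · intro hf
      obtain ⟨g, hg⟩ := this.1 (Quiver.Hom.unop_inj hf)
      exact ⟨g.unop, congrArg Quiver.Hom.unop hg⟩
    · rintro ⟨g, hg⟩
      exact congrArg Quiver.Hom.unop (this.2 ⟨g.op, Quiver.Hom.unop_inj hg⟩)
  · refine (H.op.exact₂_map (op_isTriangle.2 h) (Opposite.op X) f.op).trans ?_
    exact ⟨fun ⟨g, hg⟩ => ⟨g.unop, congrArg Quiver.Hom.unop hg⟩,
      fun ⟨g, hg⟩ => ⟨g.op, Quiver.Hom.unop_inj hg⟩⟩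

end IsLocalizedExt

end

end Extri

/-! ### The realization on the localization. -/

namespace Extri
open ExtData

section

variable {D : Type u'} [Category.{v'} D] [Preadditive D] {T : ExtData.{u', v', w'} D}
  {A A' Z Z' : D}

lemma ExtData.pull_inv_eq_push_inv {ε : T.Ext Z A} {δ : T.Ext Z' A'} (a : A ≅ A') (c : Z ≅ Z')
    (h : push a.hom ε = pull c.hom δ) : pull c.inv ε = push a.inv δ := by
  rw [← push_inv_push a (pull c.inv ε), push_pull, h, pull_inv_hom]

lemma ExtData.push_inv_eq_pull_inv {ε : T.Ext Z A} {δ : T.Ext Z' A'} (a : A' ≅ A) (c : Z' ≅ Z)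
    (h : pull c.hom ε = push a.hom δ) : push a.inv ε = pull c.inv δ :=
  (pull_inv_eq_push_inv a c h.symm).symm

end

section

variable {C : Type u} [Category.{v} C] [Preadditive C] [HasZeroObject C] [HasBinaryBiproducts C]
  {D : Type u'} [Category.{v'} D] [Preadditive D]
  {T : ExtData.{u, v, w} C} {T' : ExtData.{u', v', w'} D} {S : MorphismProperty C} {L : C ⥤ D}
  {μ : ∀ Z A : C, T.Ext Z A →+ T'.Ext (L.obj Z) (L.obj A)}

/-- The comparison of a biproduct with the image of a biproduct under an additive functor. -/
noncomputable def biprodMapIso (L : C ⥤ D) [L.Additive] [HasBinaryBiproducts D] {X Y : D} {A B : C}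
    (e : X ≅ L.obj A) (f : Y ≅ L.obj B) : X ⊞ Y ≅ L.obj (A ⊞ B) where
  hom := biprod.desc (e.hom ≫ L.map biprod.inl) (f.hom ≫ L.map biprod.inr)
  inv := biprod.lift (L.map biprod.fst ≫ e.inv) (L.map biprod.snd ≫ f.inv)
  hom_inv_id := by
    apply biprod.hom_ext' <;> apply biprod.hom_ext <;> simp [← Functor.map_comp_assoc, -Functor.map_comp]
  inv_hom_id := by
    simp only [biprod.lift_desc, Category.assoc, Iso.inv_hom_id_assoc]
    rw [← L.map_comp, ← L.map_comp, ← L.map_add, biprod.total, L.map_id]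

namespace LocTriangle

variable {X Y Z Y' : D} {x : X ⟶ Y} {y : Y ⟶ Z} {ε : T'.Ext Z X}

omit [HasZeroObject C] [HasBinaryBiproducts C] in
lemma congr (h : LocTriangle L μ x y ε) (b : Y ≅ Y') {x' : X ⟶ Y'} {y' : Y' ⟶ Z}
    (hx : x ≫ b.hom = x') (hy : b.hom ≫ y' = y) : LocTriangle L μ x' y' ε := by
  obtain ⟨A, B, Z₀, x₀, y₀, δ, a, b', c, h₁, h₂, h₃, h₄⟩ := h
  refine ⟨A, B, Z₀, x₀, y₀, δ, a, b.symm ≪≫ b', c, h₁, ?_, ?_, h₄⟩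
  · simp [← hx, h₂]
  · simp [h₃, ← hy]

lemma isExactSeq (h : LocTriangle L μ x y ε) (H : IsLocalizedExt T T' S L μ) :
    T'.IsExactSeq x y ε := by
  obtain ⟨A, B, Z₀, x₀, y₀, δ, a, b, c, h₁, h₂, h₃, h₄⟩ := h
  exact (H.isExactSeq_map h₁).of_iso a b c h₂ h₃ h₄

/-- Any triangle of `C` whose extension matches `ε` through isomorphisms of the end terms can
replace the chosen representative; `unique` and the mapping-cone axioms rest on this. -/
lemma exists_iso (h : LocTriangle L μ x y ε) (H : IsLocalizedExt T T' S L μ) {A B Z₀ : C}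
    {x₀ : A ⟶ B} {y₀ : B ⟶ Z₀} {δ : T.Ext Z₀ A} (h₀ : T.IsTriangle x₀ y₀ δ) (a : X ≅ L.obj A)
    (c : Z ≅ L.obj Z₀) (hδ : push a.hom ε = pull c.hom (μ _ _ δ)) :
    ∃ b : Y ≅ L.obj B, x ≫ b.hom = a.hom ≫ L.map x₀ ∧ b.hom ≫ L.map y₀ = y ≫ c.hom := by
  obtain ⟨A', B', Z', x', y', δ', a', b', c', h₁, h₂, h₃, h₄⟩ := h
  have h₅ : push (a'.inv ≫ a.hom) (μ _ _ δ') = pull (c'.inv ≫ c.hom) (μ _ _ δ) := by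
    rw [push_comp, pull_comp, ← hδ, ← push_pull, ← pull_inv_hom c' (μ _ _ δ'), ← h₄,
      push_pull a'.inv, push_inv_push]
  obtain ⟨β, h₆, h₇⟩ := H.exists_mid h₁ h₀ _ _ h₅
  have := (H.isExactSeq_map h₁).isIso_mid (H.isExactSeq_map h₀) _ _ _ h₆ h₇ h₅
  refine ⟨b' ≪≫ asIso β, ?_, ?_⟩
  · simp [reassoc_of% h₂, h₆]
  · simp [h₇, reassoc_of% h₃]

lemma unique (h : LocTriangle L μ x y ε) (H : IsLocalizedExt T T' S L μ) {x' : X ⟶ Y'}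
    {y' : Y' ⟶ Z} (h' : LocTriangle L μ x' y' ε) :
    ∃ b : Y ≅ Y', x ≫ b.hom = x' ∧ b.hom ≫ y' = y := by
  obtain ⟨A, B, Z₀, x₀, y₀, δ, a, b, c, h₁, h₂, h₃, h₄⟩ := h'
  obtain ⟨b', h₅, h₆⟩ := h.exists_iso H h₁ a c h₄
  refine ⟨b' ≪≫ b.symm, ?_, ?_⟩
  · rw [← cancel_mono b.hom]; simp [h₂, h₅]
  · rw [← cancel_mono c.hom]; simp [← h₃, h₆]

end LocTriangle

namespace IsLocalizedExt

variable (H : IsLocalizedExt T T' S L μ)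
include H

lemma locTriangle_of_fraction {Z A Z₁ A₁ B : C} {ε : T'.Ext (L.obj Z) (L.obj A)} {t : Z₁ ⟶ Z}
    {s : A ⟶ A₁} {δ : T.Ext Z₁ A₁} {x : A₁ ⟶ B} {y : B ⟶ Z₁} (ht : S t) (hs : S s)
    (h : push (L.map s) (pull (L.map t) ε) = μ _ _ δ) (hδ : T.IsTriangle x y δ) :
    LocTriangle L μ (L.map (s ≫ x)) (L.map (y ≫ t)) ε := by
  have := H.isIso_map ht
  have := H.isIso_map hs
  refine ⟨A₁, B, Z₁, x, y, δ, asIso (L.map s), Iso.refl _, (asIso (L.map t)).symm, hδ, by simp,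
    by simp, ?_⟩
  rw [← h, push_pull, Iso.symm_hom, ← pull_comp]
  simp

lemma exists_locTriangle {Z X : D} (ε : T'.Ext Z X) :
    ∃ (Y : D) (x : X ⟶ Y) (y : Y ⟶ Z), LocTriangle L μ x y ε := by
  obtain ⟨Z, rfl⟩ := H.surjective Z
  obtain ⟨A, rfl⟩ := H.surjective X
  obtain ⟨Z₁, A₁, t, s, δ, ht, hs, h⟩ := H.exists_fraction ε
  obtain ⟨B, x, y, hB⟩ := exists_triangle δ
  exact ⟨_, _, _, H.locTriangle_of_fraction ht hs h hB⟩

/-- The extension groups of the localization, with the realization given by the images of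
triangles. -/
noncomputable def realization : ExtData.{u', v', w'} D where
  E := T'.E
  additive_right := T'.additive_right
  additive_left := T'.additive_left
  realize {Z A} ε := Quotient.mk (seqSetoid A Z) ⟨(H.exists_locTriangle ε).choose,
    (H.exists_locTriangle ε).choose_spec.choose,
    (H.exists_locTriangle ε).choose_spec.choose_spec.choose⟩

lemma realization_isTriangle_iff {X Y Z : D} (x : X ⟶ Y) (y : Y ⟶ Z) (ε : T'.Ext Z X) :
    H.realization.IsTriangle x y ε ↔ LocTriangle L μ x y ε := by
  have h := (H.exists_locTriangle ε).choose_spec.choose_spec.choose_spec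
  constructor
  · intro h'
    obtain ⟨b, h₁, h₂⟩ := _root_.Quotient.exact h'
    exact h.congr b h₁ h₂
  · intro h'
    obtain ⟨b, h₁, h₂⟩ := h.unique H h'
    exact _root_.Quotient.sound ⟨b, h₁, h₂⟩

lemma realization_isLocalizedExt : IsLocalizedExt T H.realization S L μ where
  isLocalizing := H.isLocalizing
  isLocalization := H.isLocalization
  additive := H.additive
  surjective := H.surjective
  μ_push := H.μ_push
  μ_pull := H.μ_pull
  exists_fraction := H.exists_fraction
  eq_zero := H.eq_zero

end IsLocalizedExt

variable (T T' S L μ) in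
/-- The localized extension groups together with the realization given by the images of
triangles. -/
structure IsRealizedExt : Prop extends IsLocalizedExt T T' S L μ where
  isTriangle_iff : ∀ {X Y Z : D} (x : X ⟶ Y) (y : Y ⟶ Z) (ε : T'.Ext Z X),
    T'.IsTriangle x y ε ↔ LocTriangle L μ x y ε

lemma IsLocalizedExt.isRealizedExt (H : IsLocalizedExt T T' S L μ) :
    IsRealizedExt T H.realization S L μ where
  toIsLocalizedExt := H.realization_isLocalizedExt
  isTriangle_iff := H.realization_isTriangle_iff

/-! ### The extriangulated axioms in the localization. -/

namespace IsRealizedExt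

variable (H : IsRealizedExt T T' S L μ)
include H

protected lemma op : IsRealizedExt T.op T'.op S.op L.op (fun Z A => μ A.unop Z.unop) where
  toIsLocalizedExt := H.toIsLocalizedExt.op
  isTriangle_iff {X Y Z} x y ε := by
    refine (op_isTriangle (T := T') (x := y.unop) (y := x.unop)).trans
      ((H.isTriangle_iff _ _ _).trans ?_)
    constructor
    · rintro ⟨A, B, Z₀, x₀, y₀, δ, a, b, c, h₁, h₂, h₃, h₄⟩
      refine ⟨_, _, _, y₀.op, x₀.op, δ, c.symm.op, b.symm.op, a.symm.op, op_isTriangle.2 h₁,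
        Quiver.Hom.unop_inj ?_, Quiver.Hom.unop_inj ?_, ?_⟩
      · change b.inv ≫ x.unop = L.map y₀ ≫ c.inv
        rw [Iso.inv_comp_eq, reassoc_of% h₃]
        simp
      · change L.map x₀ ≫ b.inv = a.inv ≫ y.unop
        rw [Iso.eq_inv_comp, ← reassoc_of% h₂]
        simp
      · change pull (T := T') c.inv ε = push a.inv (μ _ _ δ)
        exact pull_inv_eq_push_inv a c h₄
    · rintro ⟨A, B, Z₀, x₀, y₀, δ, a, b, c, h₁, h₂, h₃, h₄⟩
      have h₂' : b.unop.hom ≫ x.unop = L.map x₀.unop ≫ a.unop.hom := congrArg Quiver.Hom.unop h₂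
      have h₃' : L.map y₀.unop ≫ b.unop.hom = c.unop.hom ≫ y.unop := congrArg Quiver.Hom.unop h₃
      have h₄' : pull (T := T') a.unop.hom ε = push c.unop.hom (μ _ _ δ) := h₄
      refine ⟨_, _, _, y₀.unop, x₀.unop, δ, c.symm.unop, b.symm.unop, a.symm.unop,
        op_isTriangle.1 h₁, ?_, ?_, ?_⟩
      · change y.unop ≫ b.unop.inv = c.unop.inv ≫ L.map y₀.unop
        rw [Iso.eq_inv_comp, ← Category.assoc, Iso.comp_inv_eq]
        exact h₃'.symm
      · change b.unop.inv ≫ L.map x₀.unop = x.unop ≫ a.unop.inv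
        rw [Iso.inv_comp_eq, ← Category.assoc, Iso.eq_comp_inv]
        exact h₂'.symm
      · change push (T := T') c.unop.inv ε = pull a.unop.inv (μ _ _ δ)
        exact push_inv_eq_pull_inv c.unop a.unop h₄'

variable {A B Z A' B' Z' : D} {x : A ⟶ B} {y : B ⟶ Z} {δ : T'.Ext Z A}

lemma map_right [HasBinaryBiproducts D] {a : A ⟶ A'}
    {x' : A' ⟶ B'} {y' : B' ⟶ Z} (h : T'.IsTriangle x y δ) (h' : T'.IsTriangle x' y' (push a δ)) :
    ∃ b : B ⟶ B', x ≫ b = a ≫ x' ∧ b ≫ y' = y ∧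
      T'.IsTriangle (biprod.lift x a) (biprod.desc b (-x')) (pull y' δ) := by
  have := H.additive
  rw [H.isTriangle_iff] at h h'
  obtain ⟨A₀, B₀, Z₀, x₀, y₀, δ₀, α, β, γ, h₁, h₂, h₃, h₄⟩ := h
  obtain ⟨A', rfl⟩ := H.surjective A'
  -- Only the numerator `a₁` matters: the mapping cone is formed in `C` along `a₁`, and the
  -- denominator `s` joins the comparison isomorphisms.
  obtain ⟨A₁, a₁, s, hs, ha⟩ := H.exists_left (α.inv ≫ a)
  have := H.isIso_map hs
  obtain ⟨B₁, x₁, y₁, h₅⟩ := exists_triangle (push a₁ δ₀)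
  obtain ⟨b, h₆, h₇, h₈⟩ := H.isLocalizing.extriangulated.map_right _ _ _ _ _ _ h₁ h₅
  have ha' : a ≫ L.map s = α.hom ≫ L.map a₁ := by rw [← ha]; simp
  obtain ⟨β', h₉, h₁₀⟩ := h'.exists_iso H.toIsLocalizedExt h₅ (asIso (L.map s)) γ (by
    rw [H.μ_push, ← push_pull, ← h₄, ← push_comp, ← push_comp, ← ha']; rfl)
  refine ⟨β.hom ≫ L.map b ≫ β'.inv, ?_, ?_, ?_⟩
  · rw [← cancel_mono β'.hom]
    simp only [Category.assoc, Iso.inv_hom_id, Category.comp_id, h₉, asIso_hom]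
    rw [reassoc_of% h₂, ← L.map_comp, h₆, L.map_comp, reassoc_of% ha']
  · rw [← cancel_mono γ.hom]
    simp only [Category.assoc, ← h₁₀, Iso.inv_hom_id_assoc]
    rw [← L.map_comp, h₇, h₃]
  · rw [H.isTriangle_iff]
    refine ⟨_, _, _, _, _, _, α, biprodMapIso L β (asIso (L.map s)), β',
      h₈, ?_, ?_, ?_⟩
    · simp only [biprodMapIso, biprod.lift_desc, asIso_hom]
      rw [reassoc_of% h₂, reassoc_of% ha', ← Preadditive.comp_add, ← L.map_comp, ← L.map_comp,
        ← L.map_add, biprod.lift_eq]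
    · have e₁ : L.map biprod.inl ≫ L.map (biprod.desc b (-x₁)) = L.map b := by
        rw [← L.map_comp, biprod.inl_desc]
      have e₂ : L.map biprod.inr ≫ L.map (biprod.desc b (-x₁)) = -L.map x₁ := by
        rw [← L.map_comp, biprod.inr_desc, L.map_neg]
      rw [biprodMapIso]
      apply biprod.hom_ext'
      · simp [e₁]
      · simp [e₂, h₉]
    · rw [push_pull, h₄, ← pull_comp, ← h₁₀, pull_comp, H.μ_pull]

lemma map_left [HasBinaryBiproducts D] {c : Z' ⟶ Z}
    {x' : A ⟶ B'} {y' : B' ⟶ Z'} (h : T'.IsTriangle x y δ) (h' : T'.IsTriangle x' y' (pull c δ)) :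
    ∃ b : B' ⟶ B, x' ≫ b = x ∧ b ≫ y = y' ≫ c ∧
      T'.IsTriangle (biprod.lift (-y') b) (biprod.desc c y) (push x' δ) := by
  have := H.additive
  rw [H.isTriangle_iff] at h h'
  obtain ⟨A₀, B₀, Z₀, x₀, y₀, δ₀, α, β, γ, h₁, h₂, h₃, h₄⟩ := h
  obtain ⟨Z', rfl⟩ := H.surjective Z'
  obtain ⟨Z₁, t, c₁, ht, hc⟩ := H.exists_right (c ≫ γ.hom)
  have := H.isIso_map ht
  obtain ⟨B₁, x₁, y₁, h₅⟩ := exists_triangle (pull c₁ δ₀)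
  obtain ⟨b, h₆, h₇, h₈⟩ := H.isLocalizing.extriangulated.map_left _ _ _ _ _ _ h₁ h₅
  have hc' : inv (L.map t) ≫ L.map c₁ = c ≫ γ.hom := by rw [← hc]; simp
  obtain ⟨β', h₉, h₁₀⟩ := h'.exists_iso H.toIsLocalizedExt h₅ α (asIso (L.map t)).symm (by
    rw [H.μ_pull, push_pull, h₄, ← pull_comp, ← pull_comp, ← hc']; rfl)
  have h₉' : x' = α.hom ≫ L.map x₁ ≫ β'.inv := by rw [← reassoc_of% h₉]; simp
  have h₁₀' : y' = β'.hom ≫ L.map y₁ ≫ L.map t := by rw [reassoc_of% h₁₀]; simp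
  refine ⟨β'.hom ≫ L.map b ≫ β.inv, ?_, ?_, ?_⟩
  · rw [← cancel_mono β.hom, h₉', h₂]
    simp [← h₆]
  · rw [← cancel_mono γ.hom]
    simp only [Category.assoc, ← h₃, Iso.inv_hom_id_assoc]
    rw [← L.map_comp, h₇, h₁₀', L.map_comp, ← hc]
    simp
  · rw [H.isTriangle_iff]
    refine ⟨_, _, _, _, _, _, β', biprodMapIso L (asIso (L.map t)).symm β, γ, h₈, ?_, ?_, ?_⟩
    · simp only [biprodMapIso, biprod.lift_desc, h₁₀', Preadditive.neg_comp, Category.assoc,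
        Iso.symm_hom, asIso_inv, IsIso.hom_inv_id_assoc, Iso.inv_hom_id_assoc]
      rw [← L.map_comp, ← L.map_comp, biprod.lift_eq, L.map_add, Preadditive.comp_add,
        Preadditive.neg_comp, L.map_neg, Preadditive.comp_neg]
    · have e₁ : L.map biprod.inl ≫ L.map (biprod.desc c₁ y₀) = L.map c₁ := by
        rw [← L.map_comp, biprod.inl_desc]
      have e₂ : L.map biprod.inr ≫ L.map (biprod.desc c₁ y₀) = L.map y₀ := by
        rw [← L.map_comp, biprod.inr_desc]
      rw [biprodMapIso]
      apply biprod.hom_ext'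
      · simp [e₁, hc']
      · simp [e₂, h₃]
    · rw [← push_comp, h₉, push_comp, h₄, push_pull, H.μ_push]

lemma zero_right [HasZeroObject D] (X : D) : T'.IsTriangle (𝟙 X) (0 : X ⟶ 0) (0 : T'.Ext 0 X) := by
  have := H.additive
  obtain ⟨A, rfl⟩ := H.surjective X
  rw [H.isTriangle_iff]
  exact ⟨A, A, 0, _, _, _, Iso.refl _, Iso.refl _, L.mapZeroObject.symm,
    H.isLocalizing.extriangulated.zero_right A, by simp, by simp, by simp⟩

lemma zero_left [HasZeroObject D] (X : D) : T'.IsTriangle (0 : 0 ⟶ X) (𝟙 X) (0 : T'.Ext X 0) := by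
  have := H.additive
  obtain ⟨A, rfl⟩ := H.surjective X
  rw [H.isTriangle_iff]
  exact ⟨0, A, A, _, _, _, L.mapZeroObject.symm, Iso.refl _, Iso.refl _,
    H.isLocalizing.extriangulated.zero_left A, by simp, by simp, by simp⟩

lemma inflations_of_iso {A B : C} {x₀ : A ⟶ B} (h₀ : T.inflations x₀) {X Y : D} {x : X ⟶ Y}
    (a : X ≅ L.obj A) (b : Y ≅ L.obj B) (h : x ≫ b.hom = a.hom ≫ L.map x₀) : T'.inflations x := by
  obtain ⟨Z, y₀, δ, h₀⟩ := h₀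
  refine ⟨L.obj Z, b.hom ≫ L.map y₀, push a.inv (μ _ _ δ), (H.isTriangle_iff _ _ _).2
    ⟨A, B, Z, x₀, y₀, δ, a, b, Iso.refl _, h₀, h, by simp, ?_⟩⟩
  rw [push_hom_inv]; simp

/-- Both inflations are images of inflations of `C`, joined by an isomorphism of the localization.
Once this isomorphism is represented by a morphism of `S`, (M4) applies to the composite in `C`. -/
lemma inflations_comp {X Y W : D} {f : X ⟶ Y} {g : Y ⟶ W} (hf : T'.inflations f)
    (hg : T'.inflations g) : T'.inflations (f ≫ g) := by
  obtain ⟨_, _, _, hf⟩ := hf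
  obtain ⟨_, _, _, hg⟩ := hg
  obtain ⟨A, B, Z, x, y, δ, a, b, c, h₁, h₂, -, -⟩ := (H.isTriangle_iff _ _ _).1 hf
  obtain ⟨A', B', Z', x', y', δ', a', b', c', h₁', h₂', -, -⟩ := (H.isTriangle_iff _ _ _).1 hg
  have := H.isLocalizing.left
  obtain ⟨A₁, φ, s, hs, h₃⟩ := H.exists_left (b.inv ≫ a'.hom)
  have := H.isIso_map hs
  have hφ : IsIso (L.map φ) := by rw [← h₃]; infer_instance
  obtain ⟨B₁, x₁, y₁, h₄⟩ := exists_triangle (push s δ')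
  obtain ⟨b₁, hb₁, h₅, -⟩ := H.isLocalizing.exists_mid_of_push h₁' hs h₄
  have := H.isIso_map hb₁
  -- `φ` becomes invertible but need not lie in `S`; `φ ≫ ψ` does, at the price of pushing the
  -- second triangle forward along `ψ` as well.
  obtain ⟨A₂, ψ, hψ⟩ := H.exists_comp_mem hφ
  have hψ' := H.isIso_map hψ
  rw [L.map_comp] at hψ'
  have := IsIso.of_isIso_comp_left (L.map φ) (L.map ψ)
  obtain ⟨B₂, x₂, y₂, h₆⟩ := exists_triangle (push ψ (push s δ'))
  obtain ⟨b₂, h₇, h₈, -⟩ := H.isLocalizing.extriangulated.map_right _ _ _ ψ _ _ h₄ h₆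
  have hb₂ : IsIso (L.map b₂) := (H.isExactSeq_map h₄).isIso_mid (H.isExactSeq_map h₆) (L.map ψ)
    (L.map b₂) (𝟙 _) (by rw [← L.map_comp, ← L.map_comp, h₇]) (by rw [← L.map_comp, h₈]; simp)
    (by rw [pull_id, H.μ_push ψ])
  obtain ⟨P, Q, s', z, t', hs', hz, ht', h₉⟩ := H.isLocalizing.condM4.inf.comp_mem x
    ((φ ≫ ψ) ≫ x₂) ⟨_, _, 𝟙 _, x, 𝟙 _, S.id_mem _, ⟨_, _, _, h₁⟩, S.id_mem _, by simp⟩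
    ⟨_, _, φ ≫ ψ, x₂, 𝟙 _, hψ, ⟨_, _, _, h₆⟩, S.id_mem _, by simp⟩
  have := H.isIso_map hs'
  have := H.isIso_map ht'
  refine H.inflations_of_iso hz (a ≪≫ asIso (L.map s'))
    (b' ≪≫ asIso (L.map b₁) ≪≫ asIso (L.map b₂) ≪≫ (asIso (L.map t')).symm) ?_
  simp only [Iso.trans_hom, asIso_hom, Iso.symm_hom, asIso_inv, Category.assoc]
  rw [reassoc_of% h₂', ← cancel_mono (L.map t')]
  simp only [Category.assoc, IsIso.inv_hom_id, Category.comp_id]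
  rw [← L.map_comp z, ← L.map_comp s', h₉, ← Functor.map_comp_assoc, h₅]
  have h₁₀ : a'.hom ≫ L.map s = b.hom ≫ L.map φ := by rw [← h₃]; simp
  rw [L.map_comp s, Category.assoc, ← L.map_comp x₁, h₇, L.map_comp ψ, reassoc_of% h₁₀,
    reassoc_of% h₂]
  simp

lemma deflations_comp {X Y W : D} {f : X ⟶ Y} {g : Y ⟶ W} (hf : T'.deflations f)
    (hg : T'.deflations g) : T'.deflations (f ≫ g) :=
  (op_inflations (T := T') (f ≫ g).op).1
    (H.op.inflations_comp ((op_inflations g.op).2 hg) ((op_inflations f.op).2 hf))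

/-- The localization of an extriangulated category is extriangulated. -/
lemma isExtriangulated [HasZeroObject D] [HasBinaryBiproducts D] : T'.IsExtriangulated where
  exact₁ _ _ _ h := (((H.isTriangle_iff _ _ _).1 h).isExactSeq H.toIsLocalizedExt).exact₁
  exact₂ _ _ _ h := (((H.isTriangle_iff _ _ _).1 h).isExactSeq H.toIsLocalizedExt).exact₂
  exact₁' _ _ _ h := (((H.isTriangle_iff _ _ _).1 h).isExactSeq H.toIsLocalizedExt).exact₁'
  exact₂' _ _ _ h := (((H.isTriangle_iff _ _ _).1 h).isExactSeq H.toIsLocalizedExt).exact₂'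
  zero_right := H.zero_right
  zero_left := H.zero_left
  map_right _ _ _ _ _ _ h h' := H.map_right h h'
  map_left _ _ _ _ _ _ h h' := H.map_left h h'
  inflations_comp := ⟨fun _ _ hf hg => H.inflations_comp hf hg⟩
  deflations_comp := ⟨fun _ _ hf hg => H.deflations_comp hf hg⟩

variable (μ) in
/-- The localization functor as an exact functor. -/
def exactStructure : ExactStructure T T' L where
  additive := H.additive
  φ := μ
  φ_push := H.μ_push
  φ_pull := H.μ_pull
  φ_triangle x y δ h := (H.isTriangle_iff _ _ _).2
    ⟨_, _, _, x, y, δ, Iso.refl _, Iso.refl _, Iso.refl _, h, by simp, by simp, by simp⟩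

lemma exists_fraction_iso {Z A : D} (ε : T'.Ext Z A) :
    ∃ (Z₁ A₁ : C) (t : L.obj Z₁ ⟶ Z) (s : A ⟶ L.obj A₁) (δ : T.Ext Z₁ A₁), IsIso t ∧ IsIso s ∧
      push s (pull t ε) = μ _ _ δ := by
  obtain ⟨Z, rfl⟩ := H.surjective Z
  obtain ⟨A, rfl⟩ := H.surjective A
  obtain ⟨Z₁, A₁, t, s, δ, ht, hs, h⟩ := H.exists_fraction ε
  exact ⟨Z₁, A₁, L.map t, L.map s, δ, H.isIso_map ht, H.isIso_map hs, h⟩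

/-! ### The universal property on extensions. -/

section Universal

variable {D' : Type u''} [Category.{v''} D'] [Preadditive D'] {U : ExtData.{u'', v'', w''} D'}
  {F : D ⥤ D'} (σ : ExactStructure T U (L ⋙ F))

/-- Relations between elements of `μ` hold in `C` after applying morphisms of `S`, so `σ` respects
them. This makes `extMap` independent of the fraction. -/
lemma φ_eq_of_push_pull {Z A Z' A' : C} {δ : T.Ext Z A} {δ' : T.Ext Z' A'}
    (α : L.obj A ⟶ L.obj A') (γ : L.obj Z' ⟶ L.obj Z) (h : push α (pull γ (μ _ _ δ)) = μ _ _ δ') :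
    push (F.map α) (pull (F.map γ) (σ.φ _ _ δ)) = σ.φ _ _ δ' := by
  have := H.isLocalizing.left
  obtain ⟨A₁, a, s, hs, hα⟩ := H.exists_left α
  obtain ⟨Z₁, t, c, ht, hγ⟩ := H.exists_right γ
  obtain ⟨A₂, w, hw, h'⟩ := H.exists_push_eq (δ := push a (pull c δ)) (δ' := push s (pull t δ')) (by
    rw [H.μ_push, H.μ_push, H.μ_pull, H.μ_pull, ← h, ← hα, ← hγ, pull_comp, push_comp,
      ← push_pull α (L.map t)])
  have := H.isIso_map (S.comp_mem _ _ hs hw)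
  have := H.isIso_map ht
  refine push_injective (F.map (L.map (s ≫ w))) (pull_injective (F.map (L.map t)) ?_)
  have h'' := congrArg (σ.φ _ _) h'
  rw [← push_comp, ← push_comp, σ.φ_push, σ.φ_push, σ.φ_pull, σ.φ_pull] at h''
  simp only [Functor.comp_map] at h''
  rw [← push_pull (F.map (L.map (s ≫ w))) (F.map (L.map t)) (σ.φ _ _ δ'), ← h'',
    ← push_pull (F.map (L.map (s ≫ w))), ← push_pull (F.map α), ← push_comp, ← pull_comp,
    ← F.map_comp, ← F.map_comp, hγ, L.map_comp s, reassoc_of% hα, ← L.map_comp]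

variable (μ) in
/-- Compatibility of an extension with its image under the exact functor induced by `σ`. -/
def ExtRel {Z A : D} (ε : T'.Ext Z A) (e : U.Ext (F.obj Z) (F.obj A)) : Prop :=
  ∀ (Z₁ A₁ : C) (t : L.obj Z₁ ⟶ Z) (s : A ⟶ L.obj A₁) (δ : T.Ext Z₁ A₁),
    push s (pull t ε) = μ _ _ δ → push (F.map s) (pull (F.map t) e) = σ.φ _ _ δ

/-- One fraction determines `e`, its denominators being invertible; compatibility with any other
fraction is `φ_eq_of_push_pull`. -/
lemma existsUnique_extRel {Z A : D} (ε : T'.Ext Z A) : ∃! e, ExtRel μ σ ε e := by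
  obtain ⟨Z₁, A₁, t, s, δ, ht, hs, h⟩ := H.exists_fraction_iso ε
  have h₀ : ∀ e, push (F.map s) (pull (F.map t) e) = σ.φ _ _ δ → 
      e = push (F.map (inv s)) (pull (F.map (inv t)) (σ.φ _ _ δ)) := by
    intro e he
    rw [← he, ← push_pull, ← push_comp, ← pull_comp, ← F.map_comp, ← F.map_comp]
    simp
  refine ⟨push (F.map (inv s)) (pull (F.map (inv t)) (σ.φ _ _ δ)), ?_,
    fun e he => h₀ e (he _ _ t s δ h)⟩
  intro Z₂ A₂ t' s' δ' h'
  rw [← push_pull, ← push_comp, ← pull_comp, ← F.map_comp, ← F.map_comp]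
  refine H.φ_eq_of_push_pull σ _ _ ?_
  rw [← h, ← h', ← push_pull, ← push_comp, ← pull_comp]
  simp

/-- The map on extensions induced by `σ`. -/
noncomputable def extMap {Z A : D} (ε : T'.Ext Z A) : U.Ext (F.obj Z) (F.obj A) :=
  (H.existsUnique_extRel σ ε).choose

lemma extMap_spec {Z A : D} (ε : T'.Ext Z A) {Z₁ A₁ : C} {t : L.obj Z₁ ⟶ Z} {s : A ⟶ L.obj A₁}
    {δ : T.Ext Z₁ A₁} (h : push s (pull t ε) = μ _ _ δ) :
    push (F.map s) (pull (F.map t) (H.extMap σ ε)) = σ.φ _ _ δ :=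
  (H.existsUnique_extRel σ ε).choose_spec.1 _ _ _ _ _ h

lemma extMap_add {Z A : D} (ε ε' : T'.Ext Z A) :
    H.extMap σ (ε + ε') = H.extMap σ ε + H.extMap σ ε' := by
  obtain ⟨Z₁, A₁, t, s, δ, ht, hs, h⟩ := H.exists_fraction_iso ε
  -- Taking the fraction of `ε'` after transport along `t` and `s` yields common denominators for
  -- `ε` and `ε'`.
  obtain ⟨Z₂, A₂, t', s', δ', ht', hs', h'⟩ := H.exists_fraction (push s (pull t ε'))
  have := H.isIso_map ht'
  have := H.isIso_map hs'
  have key : ∀ η : T'.Ext Z A, push (s ≫ L.map s') (pull (L.map t' ≫ t) η) =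
      push (L.map s') (pull (L.map t') (push s (pull t η))) := fun η => by
    rw [push_comp, pull_comp, push_pull s]
  have h₁ : push (s ≫ L.map s') (pull (L.map t' ≫ t) ε) = μ _ _ (push s' (pull t' δ)) := by
    rw [key, h, H.μ_push, H.μ_pull]
  have h₂ : push (s ≫ L.map s') (pull (L.map t' ≫ t) ε') = μ _ _ δ' := by rw [key, h']
  refine push_injective (F.map (s ≫ L.map s')) (pull_injective (F.map (L.map t' ≫ t)) ?_)
  rw [← push_pull, H.extMap_spec σ (δ := push s' (pull t' δ) + δ') _
    (by rw [pull_add, push_add, map_add, h₁, h₂]), push_add, pull_add, ← push_pull, ← push_pull,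
    H.extMap_spec σ _ h₁, H.extMap_spec σ _ h₂, map_add]

lemma extMap_push {Z A A' : D} (a : A ⟶ A') (ε : T'.Ext Z A) :
    H.extMap σ (push a ε) = push (F.map a) (H.extMap σ ε) := by
  obtain ⟨Z₁, A₁, t, s, δ, ht, hs, h⟩ := H.exists_fraction_iso (push a ε)
  refine push_injective (F.map s) (pull_injective (F.map t) ?_)
  rw [← push_pull, H.extMap_spec σ _ h, ← push_comp, ← F.map_comp, ← push_pull]
  exact (H.extMap_spec σ _ (by rw [← h, push_comp, push_pull a])).symm

lemma extMap_pull {Z Z' A : D} (c : Z' ⟶ Z) (ε : T'.Ext Z A) :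
    H.extMap σ (pull c ε) = pull (F.map c) (H.extMap σ ε) := by
  obtain ⟨Z₁, A₁, t, s, δ, ht, hs, h⟩ := H.exists_fraction_iso (pull c ε)
  refine push_injective (F.map s) (pull_injective (F.map t) ?_)
  rw [← push_pull, H.extMap_spec σ _ h, ← push_pull, ← pull_comp, ← F.map_comp]
  exact (H.extMap_spec σ _ (by rw [← h, pull_comp])).symm

lemma extMap_μ {Z A : C} (δ : T.Ext Z A) : H.extMap σ (μ Z A δ) = σ.φ Z A δ := by
  have := H.extMap_spec σ (μ Z A δ) (t := 𝟙 _) (s := 𝟙 _) (by rw [pull_id, push_id])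
  simpa using this

/-- The exact structure induced by `σ`. -/
noncomputable def inducedStructure [HasZeroObject D'] [HasBinaryBiproducts D']
    (hU : U.IsWeaklyExtriangulated) : ExactStructure T' U F where
  additive := by
    have := H.isLocalization
    have := H.isLocalizing.left
    have := H.additive
    exact (Localization.functor_additive_iff L S F).2 σ.additive
  φ Z A := AddMonoidHom.mk' (H.extMap σ) (H.extMap_add σ)
  φ_push a ε := H.extMap_push σ a ε
  φ_pull c ε := H.extMap_pull σ c ε
  φ_triangle := fun x y ε h => by
    obtain ⟨A, B, Z₀, x₀, y₀, δ, a, b, c, h₁, h₂, h₃, h₄⟩ := (H.isTriangle_iff _ _ _).1 h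
    refine hU.transport (σ.φ_triangle _ _ _ h₁) (F.mapIso a.symm) (F.mapIso b.symm)
      (F.mapIso c.symm) ?_ ?_ ?_
    · have : L.map x₀ ≫ b.inv = a.inv ≫ x := by rw [Iso.eq_inv_comp, ← reassoc_of% h₂]; simp
      simp only [Functor.comp_map, Functor.mapIso_hom, Iso.symm_hom]
      rw [← F.map_comp, ← F.map_comp, this]
    · have : b.inv ≫ y = L.map y₀ ≫ c.inv := by rw [Iso.inv_comp_eq, reassoc_of% h₃]; simp
      simp only [Functor.comp_map, Functor.mapIso_hom, Iso.symm_hom]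
      rw [← F.map_comp, ← F.map_comp, this]
    · have : push a.hom (pull c.inv ε) = μ _ _ δ := by rw [push_pull, h₄, pull_inv_hom]
      rw [← H.extMap_spec σ ε this]
      exact push_inv_push (F.mapIso a) _

end Universal

end IsRealizedExt

end

end Extri

/-! ### Assembly: fractions, universality and the theorem. -/

namespace Extri
open ExtData

lemma ExactStructure.ext {C : Type u} [Category.{v} C] [Preadditive C] {T : ExtData.{u, v, w} C}
    {D : Type u'} [Category.{v'} D] [Preadditive D]
    {U : ExtData.{u', v', w'} D} {F : C ⥤ D} {σ τ : ExactStructure T U F}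
    (h : ∀ {Z A : C} (δ : T.Ext Z A), σ.φ Z A δ = τ.φ Z A δ) : σ = τ := by
  revert h
  obtain ⟨-, φ, -, -, -⟩ := σ
  obtain ⟨-, ψ, -, -, -⟩ := τ
  intro h
  obtain rfl : φ = ψ := by
    ext Z A δ
    exact h δ
  rfl

section

variable {C : Type u} [Category.{v} C] [Preadditive C] [HasZeroObject C] [HasBinaryBiproducts C]
  {T : ExtData.{u, v, w} C} {S : MorphismProperty C}

lemma IsLocalizing.isLocalizedExt [S.HasLeftCalculusOfFractions] [S.HasRightCalculusOfFractions]
    (H : IsLocalizing T S) :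
    IsLocalizedExt T (localizedExt T S).ext S S.Q (localizedExt T S).μ where
  isLocalizing := H
  isLocalization := inferInstance
  additive := inferInstance
  surjective := fun X => ⟨(Localization.Construction.objEquiv S).symm X, rfl⟩
  μ_push := (localizedExt T S).μ_push
  μ_pull := (localizedExt T S).μ_pull
  exists_fraction := (localizedExt T S).exists_fraction
  eq_zero := (localizedExt T S).eq_zero

variable [Preadditive S.Localization] {T' : ExtData.{u, max u v, w'} S.Localization}
  {μ : ∀ Z A : C, T.Ext Z A →+ T'.Ext (S.Q.obj Z) (S.Q.obj A)}

namespace IsRealizedExt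

variable (H : IsRealizedExt T T' S S.Q μ)
include H

lemma isFractionExtension : IsFractionExtension T S T' H.exactStructure where
  exists_fraction := H.exists_fraction
  eq_zero_iff _ := ⟨fun h => H.exists_push_eq_zero h, fun ⟨_, _, hs, h⟩ => H.μ_eq_zero_of_push hs h⟩
  realize_fraction _ _ _ _ _ _ ht hs h hδ :=
    (H.isTriangle_iff _ _ _).2 (H.locTriangle_of_fraction ht hs h hδ)

lemma isUniversal : IsUniversal.{u, v, w, w', u'', v'', w''} T S T' H.exactStructure where
  functor D _ _ _ _ U hU P hP := by
    obtain ⟨F, σ⟩ := P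
    -- The strict factorization through `S.Q` allows equalities of functors here and in the
    -- uniqueness part.
    obtain ⟨F, rfl⟩ : ∃ F' : S.Localization ⥤ D, S.Q ⋙ F' = F :=
      ⟨Localization.Construction.lift F hP, Localization.Construction.fac F hP⟩
    refine ⟨⟨F, H.inducedStructure σ hU⟩, ?_, ?_⟩
    · exact congrArg (ExactFunctor.mk _) (ExactStructure.ext fun δ => (H.extMap_μ σ δ).symm)
    · rintro ⟨G, τ⟩ h
      have hG : S.Q ⋙ F = S.Q ⋙ G := congrArg ExactFunctor.F h
      obtain rfl := Localization.Construction.uniq F G hG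
      obtain ⟨-, hτ⟩ := ExactFunctor.mk.inj h
      have hτ' : ∀ {Z A : C} (δ : T.Ext Z A), σ.φ Z A δ = τ.φ _ _ (μ Z A δ) := fun δ => by
        rw [eq_of_heq hτ]
        rfl
      refine congrArg (ExactFunctor.mk _) (ExactStructure.ext fun {Z A} ε => ?_)
      -- Any exact structure restricting to `σ` satisfies `ExtRel`, so it agrees with `extMap`.
      refine (H.existsUnique_extRel σ ε).unique (fun Z₁ A₁ t s δ h' => ?_)
        (H.existsUnique_extRel σ ε).choose_spec.1
      rw [hτ', ← h', τ.φ_push, τ.φ_pull]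
  natTrans D _ _ _ _ U hU P R η hη := by
    refine ⟨Localization.Construction.natTransExtension η, ⟨?_, ?_⟩, ?_⟩
    · intro Z A ε
      obtain ⟨Z₁, A₁, t, s, δ, ht, hs, h⟩ := H.exists_fraction_iso ε
      -- After clearing the invertible denominators by naturality, the condition is the given one
      -- for `δ` in `C`.
      refine push_injective (R.F.map s) (pull_injective (P.F.map t) ?_)
      have h₁ := hη δ
      obtain ⟨η', hη'⟩ : ∃ η', η' = Localization.Construction.natTransExtension η := ⟨_, rfl⟩
      have h₂ : ∀ X : C, η.app X = η'.app (S.Q.obj X) := fun X => by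
        rw [hη']
        exact (Localization.Construction.NatTransExtension.app_eq η X).symm
      rw [h₂, h₂] at h₁
      rw [← hη', ← push_comp, ← η'.naturality, push_comp, ← push_pull, ← push_pull (P.F.map s),
        ← P.str.φ_pull, ← P.str.φ_push, h, push_pull (R.F.map s), ← pull_comp, η'.naturality,
        pull_comp, ← R.str.φ_push, ← R.str.φ_pull, ← push_pull, h]
      exact h₁
    · exact (Localization.Construction.whiskerLeft_natTransExtension η).symm
    · rintro η' ⟨-, rfl⟩
      refine NatTrans.ext (funext ?_)
      rintro ⟨⟨X⟩⟩
      exact (congr_app (Localization.Construction.whiskerLeft_natTransExtension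
        (Functor.whiskerLeft S.Q η')) X).symm

end IsRealizedExt

-- `S.Q` is additive and every object of the localization is the image of one of `C`.
omit [HasZeroObject C] [Preadditive S.Localization] in
lemma hasBinaryBiproducts_localization [Preadditive S.Localization] [S.Q.Additive] : HasBinaryBiproducts S.Localization where
  has_binary_biproduct := by
    rintro ⟨⟨X⟩⟩ ⟨⟨Y⟩⟩
    have : PreservesBinaryBiproducts S.Q := preservesBinaryBiproducts_of_preservesBiproducts S.Q
    exact S.Q.hasBinaryBiproduct_of_preserves X Y

end

end Extri

theorem proposition4p36 {C : Type u} [Category.{v} C] [Preadditive C] [HasZeroObject C]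
    [HasBinaryBiproducts C] (T : ExtData.{u, v, w} C) (hT : T.IsExtriangulated)
    (N : ObjectProperty C) (hN : IsPercolating T N) (hP2 : CondP2 N) (hP3 : CondP3 T N) :
    classS T N = classLR T N ∧
    (classS T N).HasTwoOutOfThreeProperty ∧
    CondM2 (classS T N) ∧
    CondM3 T (classS T N) ∧
    CondM4 T (classS T N) ∧
    nullObjects (classS T N) = N ∧
    (bar (classS T N)).inverseImage (idealQuotient (nullObjects (classS T N))) = classS T N ∧
    ∃ (_ : Preadditive (classS T N).Localization) (_ : HasZeroObject (classS T N).Localization)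
      (_ : HasBinaryBiproducts (classS T N).Localization)
      (T' : ExtData.{u, max u v, max u v w} (classS T N).Localization)
      (μ : ExactStructure T T' (classS T N).Q),
      T'.IsExtriangulated ∧
      IsFractionExtension T (classS T N) T' μ ∧
      IsUniversal.{u, v, w, max u v w, u', v', w'} T (classS T N) T' μ := by
  have H := isAdmissible_of_condP2 hT hN hP2 hP3
  rw [H.classS_eq]
  refine ⟨rfl, H.hasTwoOutOfThreeProperty, ⟨H.hasLeftCalculusOfFractions,
    H.hasRightCalculusOfFractions⟩, H.condM3, H.condM4, H.nullObjects_eq,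
    H.inverseImage_map H.nullObjects_eq, ?_⟩
  have := H.hasLeftCalculusOfFractions
  have := H.hasRightCalculusOfFractions
  have := hasBinaryBiproducts_localization (S := classLR T N)
  have H' := H.isLocalizing.isLocalizedExt.isRealizedExt
  exact ⟨inferInstance, inferInstance, this, _, H'.exactStructure, H'.isExtriangulated,
    H'.isFractionExtension, H'.isUniversal⟩
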